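/- Let $k$ be a perfect field, $\overline{k}$ an algebraic closure of $k$, and $\mathrm{Gal}(\overline{k}/k)$ its Galois group with the Krull topology. A groupoid over $\overline{k}/k$ is a groupoid $F$ in the category of $k$-schemes with scheme of objects $\mathrm{Spec}(\overline{k})$, with target $d_0$ and source $d_1$; a morphism of such groupoids is a morphism of schemes of arrows compatible with $d_0$, $d_1$ and composition. $F$ is transitive affine if $(d_0,d_1)\colon F\to \mathrm{Spec}(\overline{k})\times_k\mathrm{Spec}(\overline{k})$ is affine and faithfully flat. $F^{\mathrm{diag}}$ is the $\overline{k}$-group scheme obtained by restricting $F$ to the diagonal. For a $\overline{k}$-scheme $Z$, the set $Z(\overline{k})_{\overline{k}}$ of $\overline{k}$-points over $\overline{k}$ is given the Krull topology, with open base the sets of points in an open $U\subset Z$ at which given sections $f_1,\dots,f_n\in\mathcal O_Z(U)$ take given values $\alpha_1,\dots,\alpha_n\in\overline{k}$. For $\sigma\in\mathrm{Gal}(\overline{k}/k)$, a $\sigma$-morphism of $\overline{k}$-groups $D\to D'$ is a morphism of schemes lying over $\mathrm{Spec}(\sigma^{-1})$ and compatible with products and identities; it induces a homomorphism $D(\overline{k})_{\overline{k}}\to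 D'(\overline{k})_{\overline{k}}$. An action of a topological group $M$ on a scheme $Z$ is continuous if $(m,z)\mapsto mz$ underlies a morphism of locally ringed spaces $M\times Z\to Z$, restricting to the given automorphism on each $\{m\}\times Z$, where $M\times Z$ carries the inverse image of $\mathcal O_Z$ along the projection. A Galois extended $\overline{k}$-group $(D,E)$ consists of an affine $\overline{k}$-group scheme $D$, an extension of topological groups \[1\to D(\overline{k})_{\overline{k}}\to E\to\mathrm{Gal}(\overline{k}/k)\to 1\] (the homomorphisms are continuous, the first is a topological isomorphism onto the kernel of the second, and the second has continuous sections locally on $\mathrm{Gal}(\overline{k}/k)$), and a continuous action $e\mapsto a_e$ of $E$ on the scheme $D$ with $e$ above $\sigma$ acting as a $\sigma$-automorphism of the $\overline{k}$-group $D$, such that (a) the automorphism of $D(\overline{k})_{\overline{k}}$ induced by $a_e$ is conjugation by $e$, and (b) for $e\in D(\overline{k})_{\overline{k}}$, $a_e$ is conjugation by $e$ on $D$. A morphism $(D,E)\to(D',E')$ is a pair $(h,l)$ of a homomorphism of $\overline{k}$-groups $h\colon D\to D'$ and a continuous homomorphism $l\colon E\to E'$ which are compatible with the two extensions (inducing the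 identity on $\mathrm{Gal}(\overline{k}/k)$) and satisfy $h\circ a_e=a'_{l(e)}\circ h$ for every $e\in E$. For a groupoid $F$ over $\overline{k}/k$, let $F(\overline{k})_{\overline{k}}$ be the set of $\overline{k}$-points $u$ of $F$ with $d_0(u)=1$, with the Krull topology. Define $\gamma(u)\in\mathrm{Gal}(\overline{k}/k)$ by $d_1(u)=\mathrm{Spec}(\gamma(u))$, and the product by $u\cdot v=u\circ(v\circ\mathrm{Spec}(\gamma(u)))$, where the outer $\circ$ is composition in $F$; let $F(\overline{k})_{\overline{k}}$ act on $F^{\mathrm{diag}}$ by conjugation in $F$. Then for every transitive affine groupoid $F$ over $\overline{k}/k$ the pair $(F^{\mathrm{diag}},F(\overline{k})_{\overline{k}})$, with the embedding $F^{\mathrm{diag}}(\overline{k})_{\overline{k}}\to F(\overline{k})_{\overline{k}}$, the homomorphism $\gamma$ and this action, is a Galois extended $\overline{k}$-group, and the functor $F\mapsto(F^{\mathrm{diag}},F(\overline{k})_{\overline{k}})$, sending a morphism to its restriction to the diagonals together with the map it induces on $\overline{k}$-points over $\overline{k}$, is an equivalence from the category of transitive affine groupoids over $\overline{k}/k$ to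 the category of Galois extended $\overline{k}$-groups. -/

import Mathlib

open CategoryTheory CategoryTheory.Limits AlgebraicGeometry MonoidalCategory
open scoped Topology MonObj

universe u

noncomputable section

attribute [-instance] CategoryTheory.catToReflQuiver

namespace GalGrpd

/-! ### Spectra of fields and Galois automorphisms -/

section Base

/-- The spectrum of a field. -/
abbrev SpecF (K : Type u) [Field K] : Scheme.{u} := Spec (CommRingCat.of K)

variable (k K : Type u) [Field k] [Field K] [Algebra k K]

/-- The structural morphism `Spec K ⟶ Spec k`. -/
abbrev structureMap : SpecF K ⟶ SpecF k := Spec.map (CommRingCat.ofHom (algebraMap k K))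

variable {k K}

/-- `Spec σ` for `σ ∈ Gal(K/k)`. -/
def specGal (σ : Gal(K/k)) : SpecF K ⟶ SpecF K :=
  Spec.map (CommRingCat.ofHom (σ : K →+* K))

lemma specGal_one : specGal (1 : Gal(K/k)) = 𝟙 _ := Spec.map_id _

lemma specGal_mul (σ τ : Gal(K/k)) : specGal (σ * τ) = specGal σ ≫ specGal τ :=
  Spec.map_comp (CommRingCat.ofHom (τ : K →+* K)) (CommRingCat.ofHom (σ : K →+* K))

lemma specGal_inv_comp (σ : Gal(K/k)) : specGal σ⁻¹ ≫ specGal σ = 𝟙 _ := by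
  rw [← specGal_mul, inv_mul_cancel, specGal_one]

lemma specGal_comp_inv (σ : Gal(K/k)) : specGal σ ≫ specGal σ⁻¹ = 𝟙 _ := by
  rw [← specGal_mul, mul_inv_cancel, specGal_one]

lemma specGal_injective : Function.Injective (specGal : Gal(K/k) → (SpecF K ⟶ SpecF K)) := by
  intro σ τ h
  have h' := congrArg CommRingCat.Hom.hom (Spec.map_injective h)
  ext x
  exact congrArg (fun f : K →+* K => f x) h'

lemma exists_specGal [Algebra.IsAlgebraic k K] (f : SpecF K ⟶ SpecF K)
    (hf : f ≫ structureMap k K = structureMap k K) : ∃ σ : Gal(K/k), specGal σ = f := by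
  obtain ⟨φ, rfl⟩ := Spec.map_surjective f
  have h : CommRingCat.ofHom (algebraMap k K) ≫ φ = CommRingCat.ofHom (algebraMap k K) := by
    apply Spec.map_injective
    rw [Spec.map_comp]
    exact hf
  let ψ : K →ₐ[k] K :=
    { φ.hom with
      commutes' := fun r => congrArg (fun g => (CommRingCat.Hom.hom g) r) h }
  refine ⟨AlgEquiv.ofBijective ψ (Algebra.IsAlgebraic.algHom_bijective ψ), ?_⟩
  rfl

end Base

/-! ### Groupoids over `K/k` -/

section Groupoids

variable (k K : Type u) [Field k] [Field K] [Algebra k K]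

/-- A graph over `Spec K` in the category of `k`-schemes, with target `d₀` and source `d₁`,
equipped with a composition law `(u, v) ↦ u ∘ v` on pairs with `d₁ u = d₀ v`. The structure of
`k`-scheme on the scheme of arrows is the common composite of `d₀` and `d₁` with
`Spec K ⟶ Spec k`. -/
structure CompGraph where
  /-- the scheme of arrows -/
  arr : Scheme.{u}
  /-- the target -/
  d₀ : arr ⟶ SpecF K
  /-- the source -/
  d₁ : arr ⟶ SpecF K
  d_over : d₀ ≫ structureMap k K = d₁ ≫ structureMap k K
  /-- the composition -/
  comp : pullback d₁ d₀ ⟶ arr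
  comp_d₀ : comp ≫ d₀ = pullback.fst d₁ d₀ ≫ d₀
  comp_d₁ : comp ≫ d₁ = pullback.snd d₁ d₀ ≫ d₁

variable {k K}

namespace CompGraph

variable (F : CompGraph k K) {T T' : Scheme.{u}}

/-- The composite `u ∘ v` of points `u`, `v` in a scheme `T` with `d₁ u = d₀ v`. -/
def mul (u v : T ⟶ F.arr) (h : u ≫ F.d₁ = v ≫ F.d₀) : T ⟶ F.arr :=
  pullback.lift u v h ≫ F.comp

lemma mul_d₀ (u v : T ⟶ F.arr) (h) : F.mul u v h ≫ F.d₀ = u ≫ F.d₀ := by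
  simp [mul, comp_d₀, pullback.lift_fst_assoc]

lemma mul_d₁ (u v : T ⟶ F.arr) (h) : F.mul u v h ≫ F.d₁ = v ≫ F.d₁ := by
  simp [mul, comp_d₁, pullback.lift_snd_assoc]

lemma comp_mul (f : T' ⟶ T) (u v : T ⟶ F.arr) (h) :
    f ≫ F.mul u v h = F.mul (f ≫ u) (f ≫ v) (by simp [h]) := by
  simp only [mul, ← Category.assoc]
  congr 1
  apply pullback.hom_ext <;> simp [pullback.lift_fst, pullback.lift_snd]

end CompGraph

variable (k K) in
/-- A groupoid over `Spec K` in the category of `k`-schemes. -/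
structure GroupoidOver extends CompGraph k K where
  assoc : ∀ {T : Scheme.{u}} (u v w : T ⟶ arr) (h : u ≫ d₁ = v ≫ d₀) (h' : v ≫ d₁ = w ≫ d₀),
    toCompGraph.mul (toCompGraph.mul u v h) w (by rw [CompGraph.mul_d₁, h']) =
      toCompGraph.mul u (toCompGraph.mul v w h') (by rw [CompGraph.mul_d₀, h])
  /-- the identities -/
  ident : SpecF K ⟶ arr
  ident_d₀ : ident ≫ d₀ = 𝟙 _
  ident_d₁ : ident ≫ d₁ = 𝟙 _
  ident_mul : ∀ {T : Scheme.{u}} (u : T ⟶ arr),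
    toCompGraph.mul (u ≫ d₀ ≫ ident) u
      (by change (u ≫ d₀ ≫ ident) ≫ d₁ = u ≫ d₀; simp [ident_d₁]) = u
  mul_ident : ∀ {T : Scheme.{u}} (u : T ⟶ arr),
    toCompGraph.mul u (u ≫ d₁ ≫ ident)
      (by change u ≫ d₁ = (u ≫ d₁ ≫ ident) ≫ d₀; simp [ident_d₀]) = u
  /-- the inverse -/
  inv : arr ⟶ arr
  inv_d₀ : inv ≫ d₀ = d₁
  inv_d₁ : inv ≫ d₁ = d₀
  mul_inv : ∀ {T : Scheme.{u}} (u : T ⟶ arr),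
    toCompGraph.mul u (u ≫ inv)
      (by change u ≫ d₁ = (u ≫ inv) ≫ d₀; simp [inv_d₀]) = u ≫ d₀ ≫ ident
  inv_mul : ∀ {T : Scheme.{u}} (u : T ⟶ arr),
    toCompGraph.mul (u ≫ inv) u
      (by change (u ≫ inv) ≫ d₁ = u ≫ d₀; simp [inv_d₁]) = u ≫ d₁ ≫ ident

namespace GroupoidOver

/-- A morphism of groupoids over `Spec K`. -/
@[ext]
structure Hom (F F' : GroupoidOver k K) where
  /-- the morphism on schemes of arrows -/
  left : F.arr ⟶ F'.arr
  left_d₀ : left ≫ F'.d₀ = F.d₀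
  left_d₁ : left ≫ F'.d₁ = F.d₁
  comp_left : F.comp ≫ left =
    F'.mul (pullback.fst F.d₁ F.d₀ ≫ left) (pullback.snd F.d₁ F.d₀ ≫ left)
      (by simp [left_d₀, left_d₁, pullback.condition])

lemma Hom.map_mul {F F' : GroupoidOver k K} (f : Hom F F') {T : Scheme.{u}} (u v : T ⟶ F.arr)
    (h : u ≫ F.d₁ = v ≫ F.d₀) :
    F.mul u v h ≫ f.left =
      F'.mul (u ≫ f.left) (v ≫ f.left) (by simp [f.left_d₀, f.left_d₁, h]) := by
  rw [CompGraph.mul, Category.assoc, f.comp_left, CompGraph.comp_mul]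
  congr 1 <;> simp [pullback.lift_fst_assoc, pullback.lift_snd_assoc]

instance : Category (GroupoidOver k K) where
  Hom := Hom
  id F := ⟨𝟙 _, by simp, by simp, by
    rw [Category.comp_id, CompGraph.mul]
    conv_lhs => rw [← Category.id_comp F.comp]
    congr 1
    apply pullback.hom_ext <;> simp [pullback.lift]⟩
  comp f g := ⟨f.left ≫ g.left, by simp [Hom.left_d₀], by simp [Hom.left_d₁], by
    rw [← Category.assoc, f.comp_left, g.map_mul]
    simp only [Category.assoc]⟩
  id_comp _ := Hom.ext (Category.id_comp _)
  comp_id _ := Hom.ext (Category.comp_id _)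
  assoc _ _ _ := Hom.ext (Category.assoc _ _ _)

@[simp] lemma id_left (F : GroupoidOver k K) : Hom.left (𝟙 F) = 𝟙 F.arr := rfl

@[simp] lemma comp_left' {F F' F'' : GroupoidOver k K} (f : F ⟶ F') (g : F' ⟶ F'') :
    Hom.left (f ≫ g) = Hom.left f ≫ Hom.left g := rfl

variable (F : GroupoidOver k K)

/-- The morphism `(d₀, d₁)` to `Spec K ×ₖ Spec K`. -/
def d₀d₁ : F.arr ⟶ pullback (structureMap k K) (structureMap k K) :=
  pullback.lift F.d₀ F.d₁ F.d_over

/-- A groupoid over `Spec K` is transitive affine if `(d₀, d₁)` is affine and faithfully flat. -/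
def IsTransitiveAffine : ObjectProperty (GroupoidOver k K) := fun F =>
  IsAffineHom F.d₀d₁ ∧ Flat F.d₀d₁ ∧ Surjective F.d₀d₁

variable {F} {T : Scheme.{u}}

lemma eq_inv_of_mul (u v : T ⟶ F.arr) (h : u ≫ F.d₁ = v ≫ F.d₀)
    (huv : F.mul u v h = u ≫ F.d₀ ≫ F.ident) : v = u ≫ F.inv := by
  have h₁ : (u ≫ F.inv) ≫ F.d₁ = u ≫ F.d₀ := by simp [F.inv_d₁]
  have e := F.assoc (u ≫ F.inv) u v (by simp [F.inv_d₁]) h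
  have hd : v ≫ F.d₁ = u ≫ F.d₀ := by
    have := congrArg (· ≫ F.d₁) huv
    simpa [CompGraph.mul_d₁, F.ident_d₁] using this
  have e₁ : F.mul (F.mul (u ≫ F.inv) u (by simp [F.inv_d₁])) v
      (by rw [CompGraph.mul_d₁, h]) = v := by
    have : F.mul (v ≫ F.d₀ ≫ F.ident) v (by simp [F.ident_d₁]) = v := F.ident_mul v
    conv_rhs => rw [← this]
    congr 1
    rw [F.inv_mul, ← Category.assoc, h, Category.assoc]
  have e₂ : F.mul (u ≫ F.inv) (F.mul u v h)
      (by rw [CompGraph.mul_d₀]; simp [F.inv_d₁]) = u ≫ F.inv := by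
    have := F.mul_ident (u ≫ F.inv)
    conv_rhs => rw [← this]
    congr 1
    rw [huv, ← Category.assoc (u ≫ F.inv), h₁, Category.assoc]
  rw [← e₁, e, e₂]

lemma inv_of_mul (u v : T ⟶ F.arr) (h : u ≫ F.d₁ = v ≫ F.d₀) :
    F.mul u v h ≫ F.inv = F.mul (v ≫ F.inv) (u ≫ F.inv) (by simp [F.inv_d₀, F.inv_d₁, h]) := by
  symm
  have hv : (v ≫ F.inv) ≫ F.d₁ = (u ≫ F.inv) ≫ F.d₀ := by simp [F.inv_d₀, F.inv_d₁, h]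
  have hvv : v ≫ F.d₁ = (v ≫ F.inv) ≫ F.d₀ := by simp [F.inv_d₀]
  have hu : u ≫ F.d₁ = (u ≫ F.inv) ≫ F.d₀ := by simp [F.inv_d₀]
  apply eq_inv_of_mul _ _ (by rw [CompGraph.mul_d₁, CompGraph.mul_d₀, hvv])
  rw [F.assoc u v _ h (by rw [CompGraph.mul_d₀, hvv])]
  have e := F.assoc v (v ≫ F.inv) (u ≫ F.inv) hvv hv
  have e' : F.mul v (F.mul (v ≫ F.inv) (u ≫ F.inv) hv) (by rw [CompGraph.mul_d₀, hvv])
      = u ≫ F.inv := by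
    rw [← e]
    have := F.ident_mul (u ≫ F.inv)
    conv_rhs => rw [← this]
    congr 1
    rw [F.mul_inv, ← Category.assoc (u ≫ F.inv), ← hu, ← Category.assoc, ← h, Category.assoc]
  simp only [e']
  rw [F.mul_inv, ← Category.assoc (F.mul u v h), CompGraph.mul_d₀, Category.assoc]

lemma conj_assoc (v w x w' v' : T ⟶ F.arr) (h₁ : v ≫ F.d₁ = w ≫ F.d₀)
    (h₂ : w ≫ F.d₁ = x ≫ F.d₀) (h₃ : x ≫ F.d₁ = w' ≫ F.d₀) (h₄ : w' ≫ F.d₁ = v' ≫ F.d₀) :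
    F.mul (F.mul (F.mul v w h₁) x (by rw [CompGraph.mul_d₁, h₂])) (F.mul w' v' h₄)
        (by rw [CompGraph.mul_d₁, CompGraph.mul_d₀, h₃]) =
      F.mul (F.mul v (F.mul (F.mul w x h₂) w' (by rw [CompGraph.mul_d₁, h₃]))
          (by rw [CompGraph.mul_d₀, CompGraph.mul_d₀, h₁])) v'
        (by rw [CompGraph.mul_d₁, CompGraph.mul_d₁, h₄]) := by
  have hwx : F.mul w x h₂ ≫ F.d₁ = w' ≫ F.d₀ := by rw [CompGraph.mul_d₁, h₃]
  have hv : v ≫ F.d₁ = F.mul w x h₂ ≫ F.d₀ := by rw [CompGraph.mul_d₀, h₁]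
  have e₁ := F.assoc v w x h₁ h₂
  have e₂ := F.assoc v (F.mul w x h₂) (F.mul w' v' h₄) hv (by rw [CompGraph.mul_d₀, hwx])
  have e₃ := F.assoc (F.mul w x h₂) w' v' hwx h₄
  have e₄ := F.assoc v (F.mul (F.mul w x h₂) w' hwx) v'
    (by rw [CompGraph.mul_d₀, hv]) (by rw [CompGraph.mul_d₁, h₄])
  simp only [e₁]
  rw [e₂, e₄]
  simp only [e₃]

lemma ident_inv (x : T ⟶ SpecF K) : (x ≫ F.ident) ≫ F.inv = x ≫ F.ident := by
  symm
  apply eq_inv_of_mul _ _ (by simp [F.ident_d₀, F.ident_d₁])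
  have := F.ident_mul (x ≫ F.ident)
  have e : (x ≫ F.ident) ≫ F.d₀ ≫ F.ident = x ≫ F.ident := by
    rw [Category.assoc, ← Category.assoc F.ident, F.ident_d₀, Category.id_comp]
  simp only [e] at this ⊢
  exact this

lemma Hom.map_ident {F F' : GroupoidOver k K} (f : Hom F F') :
    F.ident ≫ f.left = F'.ident := by
  have h0 : (F.ident ≫ f.left) ≫ F'.d₀ = 𝟙 _ := by simp [f.left_d₀, F.ident_d₀]
  have h1 : (F.ident ≫ f.left) ≫ F'.d₁ = 𝟙 _ := by simp [f.left_d₁, F.ident_d₁]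
  set e := F.ident ≫ f.left with he
  have hee : F'.mul e e (by rw [h0, h1]) = e := by
    have := congrArg (· ≫ f.left) (F.ident_mul F.ident)
    simp only [f.map_mul] at this
    conv_rhs => rw [he, ← this]
    congr 1
    rw [he, ← Category.assoc F.ident, F.ident_d₀, Category.id_comp]
  have a := F'.assoc (e ≫ F'.inv) e e (by simp [F'.inv_d₁]) (by rw [h0, h1])
  have l : F'.mul (F'.mul (e ≫ F'.inv) e (by simp [F'.inv_d₁])) e
      (by rw [CompGraph.mul_d₁, h0, h1]) = e := by
    have := F'.ident_mul e
    conv_rhs => rw [← this]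
    congr 1
    rw [F'.inv_mul, ← Category.assoc, h1, ← Category.assoc, h0]
  simp only [hee] at a
  rw [l, F'.inv_mul, ← Category.assoc, h1, Category.id_comp] at a
  exact a

lemma Hom.map_inv {F F' : GroupoidOver k K} (f : Hom F F') (u : T ⟶ F.arr) :
    (u ≫ F.inv) ≫ f.left = (u ≫ f.left) ≫ F'.inv := by
  apply eq_inv_of_mul _ _ (by simp [f.left_d₀, f.left_d₁, F.inv_d₀])
  rw [← f.map_mul u (u ≫ F.inv) (by simp [F.inv_d₀]), F.mul_inv]
  simp only [Category.assoc]
  rw [f.map_ident, ← Category.assoc f.left, f.left_d₀]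

end GroupoidOver

end Groupoids

/-! ### Points, the Krull topology, semilinear morphisms and continuous actions -/

section Points

variable {k K : Type u} [Field k] [Field K] [Algebra k K]

/-- The Krull topology on the set of `K`-points of a scheme `Z`: it is generated by the sets of
points `w` lying in an open subset `U` of `Z` at which a section `f` of the structure sheaf
over `U` takes a given value `α` in `K`. -/
abbrev krullTop (K : Type u) [Field K] (Z : Scheme.{u}) : TopologicalSpace (SpecF K ⟶ Z) :=
  TopologicalSpace.generateFrom
    {W | ∃ (U : Z.Opens) (f : Γ(Z, U)) (α : K), W = {w : SpecF K ⟶ Z | ∃ h : ⊤ ≤ w ⁻¹ᵁ U,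
      (Scheme.ΓSpecIso (CommRingCat.of K)).hom (w.appLE U ⊤ h f) = α}}

lemma continuous_krullTop {Z Z' : Scheme.{u}} (g : Z ⟶ Z') :
    @Continuous _ _ (krullTop K Z) (krullTop K Z') (fun w => w ≫ g) := by
  let := krullTop K Z
  refine continuous_generateFrom_iff.mpr ?_
  rintro _ ⟨U, f, α, rfl⟩
  apply TopologicalSpace.isOpen_generateFrom_of_mem
  refine ⟨g ⁻¹ᵁ U, g.app U f, α, ?_⟩
  ext w
  have key (h : ⊤ ≤ (w ≫ g) ⁻¹ᵁ U) (h' : ⊤ ≤ w ⁻¹ᵁ g ⁻¹ᵁ U) :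
      (w ≫ g).appLE U ⊤ h f = w.appLE (g ⁻¹ᵁ U) ⊤ h' (g.app U f) :=
    congrArg (fun φ => (CommRingCat.Hom.hom φ) f) (Scheme.Hom.comp_appLE w g U ⊤ h)
  constructor
  · rintro ⟨h, e⟩
    exact ⟨h, (congrArg _ (key h h)).symm.trans e⟩
  · rintro ⟨h, e⟩
    exact ⟨h, (congrArg _ (key h h)).trans e⟩

/-- The group `D(K)_K` of `K`-points over `K` of a group scheme `D` over `K`. -/
def Points (D : Grp (Over (SpecF K))) : Type u := 𝟙_ (Over (SpecF K)) ⟶ D.X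

instance (D : Grp (Over (SpecF K))) : Group (Points D) :=
  inferInstanceAs (Group (𝟙_ (Over (SpecF K)) ⟶ D.X))

/-- The point `Spec K ⟶ D` underlying an element of `D(K)_K`. -/
def Points.left {D : Grp (Over (SpecF K))} (d : Points D) : SpecF K ⟶ D.X.left :=
  Over.Hom.left (d : 𝟙_ (Over (SpecF K)) ⟶ D.X)

instance (D : Grp (Over (SpecF K))) : TopologicalSpace (Points D) :=
  TopologicalSpace.induced Points.left (krullTop K D.X.left)

/-- The map induced on `K`-points over `K` by a homomorphism of group schemes over `K`. -/
def Points.map {D D' : Grp (Over (SpecF K))} (h : D ⟶ D') (d : Points D) : Points D' :=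
  (d : 𝟙_ (Over (SpecF K)) ⟶ D.X) ≫ h.hom.hom

/-- Conjugation `x ↦ d x d⁻¹` by a `K`-point `d` over `K` of the group scheme `D`. -/
def conjHom {D : Grp (Over (SpecF K))} (d : Points D) : D.X ⟶ D.X :=
  (CartesianMonoidalCategory.toUnit D.X ≫ d) * 𝟙 D.X *
    (CartesianMonoidalCategory.toUnit D.X ≫ d)⁻¹

/-- A morphism of schemes `f : D ⟶ D'` between group schemes over `K` is a `σ`-morphism of
`K`-groups if it lies over `Spec σ⁻¹` and is compatible with products and identities. -/
structure IsSemilinearHom (σ : Gal(K/k)) {D D' : Grp (Over (SpecF K))}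
    (f : D.X.left ⟶ D'.X.left) : Prop where
  over_specGal : f ≫ D'.X.hom = D.X.hom ≫ specGal σ⁻¹
  mul_comp : (μ[D.X]).left ≫ f =
    pullback.map D.X.hom D.X.hom D'.X.hom D'.X.hom f f (specGal σ⁻¹)
      over_specGal.symm over_specGal.symm ≫ (μ[D'.X]).left
  one_comp : (η[D.X]).left ≫ f = specGal σ⁻¹ ≫ (η[D'.X]).left

/-- The map induced on `K`-points over `K` by a morphism `f` over `Spec σ⁻¹`. It sends `z` to the
unique `z'` with `z ≫ f = Spec σ⁻¹ ≫ z'`. -/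
def semilinearOnPoints (σ : Gal(K/k)) {D D' : Grp (Over (SpecF K))}
    (f : D.X.left ⟶ D'.X.left) (hf : f ≫ D'.X.hom = D.X.hom ≫ specGal σ⁻¹)
    (z : Points D) : Points D' :=
  Over.homMk (U := 𝟙_ (Over (SpecF K))) (V := D'.X) (specGal σ ≫ z.left ≫ f) (by
    have hz : z.left ≫ D.X.hom = 𝟙 (SpecF K) :=
      Over.w (z : 𝟙_ (Over (SpecF K)) ⟶ D.X)
    change (specGal σ ≫ z.left ≫ f) ≫ D'.X.hom = 𝟙 (SpecF K)
    rw [Category.assoc, Category.assoc, hf, ← Category.assoc z.left, hz, Category.id_comp,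
      specGal_comp_inv])

/-- An action `a` of a topological group `M` on a scheme `Z` is continuous if `(m, z) ↦ a m z`
underlies a morphism of locally ringed spaces to `Z` from the space `M × Z` equipped with the
inverse image of `𝒪_Z` along the projection. Explicitly, this means that for every section `f`
of `𝒪_Z` over `U` and every `(m, z)` with `a m z ∈ U`, there are neighbourhoods `N` of `m` and
`V` of `z` such that for `m' ∈ N` the pullback of `f` along `a m'` is defined on `V` and is there
independent of `m'`. -/
def IsContinuousAction {M : Type u} [Group M] [TopologicalSpace M] {Z : Scheme.{u}}
    (a : M →* Aut Z) : Prop :=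
  ∀ (U : Z.Opens) (f : Γ(Z, U)) (m : M) (z : Z), (a m).hom z ∈ U →
    ∃ N ∈ 𝓝 m, ∃ V : Z.Opens, z ∈ V ∧ ∃ g : Γ(Z, V),
      ∀ m' ∈ N, ∃ h : V ≤ (a m').hom ⁻¹ᵁ U, (a m').hom.appLE U V h f = g

end Points

/-! ### Galois extended groups -/

section GaloisExtended

variable (k K : Type u) [Field k] [Field K] [Algebra k K]

/-- The data underlying a Galois extended `K`-group: a group scheme `D` over `K`, a group `E` with
a topology, homomorphisms `D(K)_K → E → Gal(K/k)`, and an action of `E` on the scheme `D`. -/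
structure ExtData where
  /-- the group scheme -/
  D : Grp (Over (SpecF K))
  /-- the extension -/
  E : Type u
  [group : Group E]
  [top : TopologicalSpace E]
  /-- the homomorphism `D(K)_K → E` -/
  incl : Points D →* E
  /-- the homomorphism `E → Gal(K/k)` -/
  proj : E →* Gal(K/k)
  /-- the action of `E` on the scheme `D` -/
  act : E →* Aut D.X.left

attribute [instance] ExtData.group ExtData.top

variable {k K}

namespace ExtData

/-- The conditions on the data for a Galois extended `K`-group: `D` is affine, `E` is an extension
of topological groups of `Gal(K/k)` by `D(K)_K`, the action is continuous, and `e` in `E` above `σ`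
acts as a `σ`-automorphism of the `K`-group `D`, inducing on `D(K)_K` conjugation by `e`, and equal
to conjugation by `e` when `e` lies in `D(K)_K`. -/
structure IsGaloisExtended (G : ExtData k K) : Prop where
  affine : IsAffine G.D.X.left
  topologicalGroup : IsTopologicalGroup G.E
  continuous_proj : Continuous G.proj
  isEmbedding_incl : Topology.IsEmbedding G.incl
  range_incl : G.incl.range = G.proj.ker
  local_section : ∀ σ : Gal(K/k), ∃ U : Set Gal(K/k), IsOpen U ∧ σ ∈ U ∧
    ∃ s : Gal(K/k) → G.E, ContinuousOn s U ∧ ∀ τ ∈ U, G.proj (s τ) = τ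
  continuous_act : IsContinuousAction G.act
  semilinear : ∀ e : G.E, IsSemilinearHom (D := G.D) (D' := G.D) (G.proj e) (G.act e).hom
  act_points : ∀ (e : G.E) (d : Points G.D),
    G.incl (semilinearOnPoints (G.proj e) (G.act e).hom (semilinear e).over_specGal d) =
      e * G.incl d * e⁻¹
  act_incl : ∀ d : Points G.D, (G.act (G.incl d)).hom = (conjHom d).left

/-- A morphism `(h, l)`, with `h` a homomorphism of group schemes over `K` and `l` a continuous
homomorphism, compatible with the extensions and the actions. -/
@[ext]
structure Hom (G G' : ExtData k K) where
  /-- the homomorphism of group schemes -/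
  h : G.D ⟶ G'.D
  /-- the continuous homomorphism on extensions -/
  l : G.E →ₜ* G'.E
  l_incl : ∀ d : Points G.D, l (G.incl d) = G'.incl (Points.map h d)
  proj_l : ∀ e : G.E, G'.proj (l e) = G.proj e
  act_h : ∀ e : G.E, (G.act e).hom ≫ h.hom.hom.left = h.hom.hom.left ≫ (G'.act (l e)).hom

/-- The identity morphism. -/
def Hom.id (G : ExtData k K) : Hom G G where
  h := 𝟙 _
  l := ContinuousMonoidHom.id _
  l_incl _ := congrArg G.incl (Category.comp_id _).symm
  proj_l _ := rfl
  act_h _ := (Category.comp_id _).trans (Category.id_comp _).symm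

/-- The composite of two morphisms. -/
def Hom.comp {G G' G'' : ExtData k K} (f : Hom G G') (g : Hom G' G'') : Hom G G'' where
  h := f.h ≫ g.h
  l := g.l.comp f.l
  l_incl d := by
    change g.l (f.l (G.incl d)) = _
    rw [f.l_incl, g.l_incl]
    exact congrArg G''.incl (Category.assoc _ _ _)
  proj_l e := by
    change G''.proj (g.l (f.l e)) = _
    rw [g.proj_l, f.proj_l]
  act_h e := by
    change (G.act e).hom ≫ f.h.hom.hom.left ≫ g.h.hom.hom.left =
      (f.h.hom.hom.left ≫ g.h.hom.hom.left) ≫ (G''.act (g.l (f.l e))).hom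
    rw [← Category.assoc, f.act_h, Category.assoc, g.act_h, Category.assoc]

lemma Hom.comp_h {G G' G'' : ExtData k K} (f : Hom G G') (g : Hom G' G'') :
    (f.comp g).h = f.h ≫ g.h := rfl

lemma Hom.comp_l {G G' G'' : ExtData k K} (f : Hom G G') (g : Hom G' G'') :
    (f.comp g).l = g.l.comp f.l := rfl

instance : Category (ExtData k K) where
  Hom := Hom
  id := Hom.id
  comp := Hom.comp
  id_comp f := Hom.ext (by rw [Hom.comp_h]; exact Category.id_comp f.h)
    (by rw [Hom.comp_l]; rfl)
  comp_id f := Hom.ext (by rw [Hom.comp_h]; exact Category.comp_id f.h)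
    (by rw [Hom.comp_l]; rfl)
  assoc f g h := Hom.ext (by simp only [Hom.comp_h, Category.assoc])
    (by simp only [Hom.comp_l]; rfl)

end ExtData

end GaloisExtended

/-! ### The Galois extended group of a groupoid -/

namespace GroupoidOver

section Diagonal

variable {k K : Type u} [Field k] [Field K] [Algebra k K] (F : GroupoidOver k K)

/-- The scheme `F^diag` over `K`: the inverse image under `(d₀, d₁)` of the diagonal. -/
def diag : Over (SpecF K) :=
  Over.mk (pullback.snd F.d₀d₁ (pullback.diagonal (structureMap k K)))

/-- The embedding of `F^diag` in `F`. -/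
def diagι : F.diag.left ⟶ F.arr := pullback.fst F.d₀d₁ (pullback.diagonal (structureMap k K))

lemma diagι_d₀ : F.diagι ≫ F.d₀ = F.diag.hom := by
  have := congrArg (· ≫ pullback.fst _ _)
    (pullback.condition (f := F.d₀d₁) (g := pullback.diagonal (structureMap k K)))
  simp only [d₀d₁, Category.assoc, pullback.lift_fst, pullback.diagonal_fst, Category.comp_id] at this
  exact this

lemma diagι_d₁ : F.diagι ≫ F.d₁ = F.diag.hom := by
  have := congrArg (· ≫ pullback.snd _ _)
    (pullback.condition (f := F.d₀d₁) (g := pullback.diagonal (structureMap k K)))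
  simp only [d₀d₁, Category.assoc, pullback.lift_snd, pullback.diagonal_snd, Category.comp_id] at this
  exact this

variable {F}

/-- The point of `F^diag` defined by a point of `F` above the diagonal. -/
def diagLift {T : Scheme.{u}} (u : T ⟶ F.arr) (t : T ⟶ SpecF K) (h₀ : u ≫ F.d₀ = t)
    (h₁ : u ≫ F.d₁ = t) : T ⟶ F.diag.left :=
  pullback.lift u t (by
    apply pullback.hom_ext <;>
      simp [d₀d₁, pullback.lift_fst, pullback.lift_snd, h₀, h₁])

lemma diagLift_ι {T : Scheme.{u}} (u : T ⟶ F.arr) (t : T ⟶ SpecF K) (h₀ h₁) :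
    diagLift u t h₀ h₁ ≫ F.diagι = u := pullback.lift_fst _ _ _

lemma diagLift_hom {T : Scheme.{u}} (u : T ⟶ F.arr) (t : T ⟶ SpecF K) (h₀ h₁) :
    diagLift u t h₀ h₁ ≫ F.diag.hom = t := pullback.lift_snd _ _ _

lemma diag_hom_ext {T : Scheme.{u}} {x y : T ⟶ F.diag.left} (h : x ≫ F.diagι = y ≫ F.diagι) :
    x = y := by
  apply pullback.hom_ext h
  have := congrArg (· ≫ F.d₀) h
  simp only [Category.assoc, diagι_d₀] at this
  exact this

variable (F)

/-- The group of points of `F` in `T` above the diagonal point defined by `T ⟶ Spec K`. -/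
def Isotropy (T : Over (SpecF K)) : Type u :=
  {u : T.left ⟶ F.arr // u ≫ F.d₀ = T.hom ∧ u ≫ F.d₁ = T.hom}

instance (T : Over (SpecF K)) : Group (F.Isotropy T) where
  mul u v := ⟨F.mul u.1 v.1 (u.2.2.trans v.2.1.symm),
    (F.mul_d₀ _ _ _).trans u.2.1, (F.mul_d₁ _ _ _).trans v.2.2⟩
  one := ⟨T.hom ≫ F.ident, by simp [F.ident_d₀], by simp [F.ident_d₁]⟩
  inv u := ⟨u.1 ≫ F.inv, by simp [F.inv_d₀, u.2.2], by simp [F.inv_d₁, u.2.1]⟩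
  mul_assoc u v w := Subtype.ext (F.assoc _ _ _ _ _)
  one_mul u := Subtype.ext (by
    refine Eq.trans ?_ (F.ident_mul u.1)
    change F.mul (T.hom ≫ F.ident) u.1 _ = _
    congr 1
    rw [← Category.assoc, u.2.1])
  mul_one u := Subtype.ext (by
    refine Eq.trans ?_ (F.mul_ident u.1)
    change F.mul u.1 (T.hom ≫ F.ident) _ = _
    congr 1
    rw [← Category.assoc, u.2.2])
  inv_mul_cancel u := Subtype.ext (by
    refine (F.inv_mul u.1).trans ?_
    change _ = T.hom ≫ F.ident
    rw [← Category.assoc, u.2.2])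

/-- The functor of points of the group scheme `F^diag`. -/
def isotropyFunctor : (Over (SpecF K))ᵒᵖ ⥤ GrpCat.{u} where
  obj T := GrpCat.of (F.Isotropy T.unop)
  map {T T'} f := GrpCat.ofHom
    { toFun := fun u => ⟨f.unop.left ≫ u.1, by simp [u.2.1], by simp [u.2.2]⟩
      map_one' := Subtype.ext (by
        change f.unop.left ≫ T.unop.hom ≫ F.ident = T'.unop.hom ≫ F.ident
        rw [← Category.assoc, Over.w])
      map_mul' := fun u v => Subtype.ext (F.comp_mul _ _ _ _) }
  map_id T := by
    ext u
    exact Subtype.ext (Category.id_comp _)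
  map_comp f g := by
    ext u
    exact Subtype.ext (Category.assoc _ _ _)

/-- The points of `F^diag` are the points of `F` above the diagonal. -/
def isotropyEquiv (T : Over (SpecF K)) : (T ⟶ F.diag) ≃ F.Isotropy T where
  toFun x := ⟨x.left ≫ F.diagι,
    by rw [Category.assoc, diagι_d₀, Over.w], by rw [Category.assoc, diagι_d₁, Over.w]⟩
  invFun u := Over.homMk (diagLift u.1 T.hom u.2.1 u.2.2) (diagLift_hom u.1 T.hom u.2.1 u.2.2)
  left_inv x := by
    apply Over.OverMorphism.ext
    exact diag_hom_ext (diagLift_ι (x.left ≫ F.diagι) T.hom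
      (by rw [Category.assoc, diagι_d₀, Over.w]) (by rw [Category.assoc, diagι_d₁, Over.w]))
  right_inv u := Subtype.ext (diagLift_ι u.1 T.hom u.2.1 u.2.2)

/-- `F^diag` represents the functor of isotropy groups of `F`. -/
def diagRepresentableBy : (F.isotropyFunctor ⋙ forget _).RepresentableBy F.diag where
  homEquiv {T} := F.isotropyEquiv T
  homEquiv_comp {T T'} f g :=
    Subtype.ext (p := fun u : T.left ⟶ F.arr => u ≫ F.d₀ = T.hom ∧ u ≫ F.d₁ = T.hom)
      (a1 := F.isotropyEquiv T (f ≫ g))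
      (a2 := F.isotropyFunctor.map f.op (F.isotropyEquiv T' g))
      (Category.assoc f.left g.left F.diagι)

instance : GrpObj F.diag := GrpObj.ofRepresentableBy F.diag F.isotropyFunctor F.diagRepresentableBy

/-- The group scheme `F^diag` over `K`, with product given by composition in `F`. -/
abbrev diagGrp : Grp (Over (SpecF K)) := ⟨F.diag⟩

lemma isotropyEquiv_mul {T : Over (SpecF K)} (x y : T ⟶ F.diag) :
    F.isotropyEquiv T (x * y) = F.isotropyEquiv T x * F.isotropyEquiv T y :=
  ((yonedaGrpObjIsoOfRepresentableBy F.diag F.isotropyFunctor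
      F.diagRepresentableBy).hom.app (Opposite.op T)).hom.map_mul x y

lemma diag_mul_left {T : Over (SpecF K)} (x y : T ⟶ F.diag) :
    (x * y).left ≫ F.diagι = F.mul (x.left ≫ F.diagι) (y.left ≫ F.diagι)
      (by simp [diagι_d₀, diagι_d₁]) :=
  congrArg Subtype.val (F.isotropyEquiv_mul x y)

/-- The morphism of schemes over `K` induced on diagonals by a morphism of groupoids. -/
def diagMapOver {F F' : GroupoidOver k K} (f : F ⟶ F') : F.diag ⟶ F'.diag :=
  Over.homMk (diagLift (F.diagι ≫ Hom.left f) F.diag.hom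
    (by rw [Category.assoc, Hom.left_d₀, diagι_d₀])
    (by rw [Category.assoc, Hom.left_d₁, diagι_d₁])) (diagLift_hom _ _ _ _)

lemma diagMapOver_ι {F F' : GroupoidOver k K} (f : F ⟶ F') :
    (diagMapOver f).left ≫ F'.diagι = F.diagι ≫ Hom.left f :=
  diagLift_ι (F.diagι ≫ Hom.left f) F.diag.hom
    (by rw [Category.assoc, Hom.left_d₀, diagι_d₀])
    (by rw [Category.assoc, Hom.left_d₁, diagι_d₁])

lemma mul_diagMapOver {F F' : GroupoidOver k K} (f : F ⟶ F') {T : Over (SpecF K)}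
    (x y : T ⟶ F.diag) :
    (x * y) ≫ diagMapOver f = (x ≫ diagMapOver f) * (y ≫ diagMapOver f) := by
  apply Over.OverMorphism.ext
  apply diag_hom_ext
  rw [diag_mul_left]
  simp only [Over.comp_left, Category.assoc, diagMapOver_ι]
  rw [← Category.assoc, diag_mul_left, Hom.map_mul]
  simp only [Category.assoc]

/-- The homomorphism induced on diagonals by a morphism of groupoids. -/
def diagMap {F F' : GroupoidOver k K} (f : F ⟶ F') : F.diagGrp ⟶ F'.diagGrp :=
  Grp.homMk'' (A := F.diagGrp) (B := F'.diagGrp) (diagMapOver f)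
    (by
      have h := mul_diagMapOver f (η[F.diag]) (η[F.diag])
      have h1 : (η[F.diag] : 𝟙_ (Over (SpecF K)) ⟶ F.diag) = 1 := MonObj.one_eq_one _
      have h2 : (η[F'.diag] : 𝟙_ (Over (SpecF K)) ⟶ F'.diag) = 1 := MonObj.one_eq_one _
      change η[F.diag] ≫ diagMapOver f = η[F'.diag]
      rw [h2]
      rw [h1, mul_one] at h
      rw [h1]
      exact left_eq_mul.mp h)
    (by
      have h := mul_diagMapOver f (CartesianMonoidalCategory.fst F.diag F.diag)
        (CartesianMonoidalCategory.snd F.diag F.diag)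
      change μ[F.diag] ≫ diagMapOver f = (diagMapOver f ⊗ₘ diagMapOver f) ≫ μ[F'.diag]
      rw [Hom.mul_def, Hom.mul_def, CartesianMonoidalCategory.lift_fst_snd,
        Category.id_comp] at h
      rw [h]
      congr 1)

lemma diagMap_id (F : GroupoidOver k K) : diagMap (𝟙 F) = 𝟙 F.diagGrp := by
  apply Grp.hom_ext
  apply Over.OverMorphism.ext
  apply diag_hom_ext
  refine (diagMapOver_ι (𝟙 F)).trans ?_
  rw [id_left, Category.comp_id]
  exact (Category.id_comp _).symm

lemma diagMap_comp {F F' F'' : GroupoidOver k K} (f : F ⟶ F') (g : F' ⟶ F'') :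
    diagMap (f ≫ g) = diagMap f ≫ diagMap g := by
  apply Grp.hom_ext
  apply Over.OverMorphism.ext
  apply diag_hom_ext
  refine (diagMapOver_ι (f ≫ g)).trans ?_
  change _ = ((diagMapOver f).left ≫ (diagMapOver g).left) ≫ F''.diagι
  rw [Category.assoc, diagMapOver_ι, ← Category.assoc, diagMapOver_ι, Category.assoc,
    comp_left']

end Diagonal

section PointsGroup

variable {k K : Type u} [Field k] [Field K] [Algebra k K] (F : GroupoidOver k K)

/-- The set `F(K)_K` of `K`-points of `F` over `K`, where `F` is a `K`-scheme by `d₀`. -/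
@[ext]
structure KPoints where
  /-- the underlying `K`-point -/
  val : SpecF K ⟶ F.arr
  val_d₀ : val ≫ F.d₀ = 𝟙 (SpecF K)

instance : TopologicalSpace F.KPoints :=
  TopologicalSpace.induced KPoints.val (krullTop K F.arr)

instance : One F.KPoints where
  one := ⟨F.ident, F.ident_d₀⟩

lemma KPoints.one_val : (1 : F.KPoints).val = F.ident := rfl

variable {F} in
lemma diagPoint_d₀ (d : Points F.diagGrp) : (d.left ≫ F.diagι) ≫ F.d₀ = 𝟙 (SpecF K) := by
  rw [Category.assoc, diagι_d₀]
  exact Over.w (d : 𝟙_ (Over (SpecF K)) ⟶ F.diag)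

variable {F} in
lemma diagPoint_d₁ (d : Points F.diagGrp) : (d.left ≫ F.diagι) ≫ F.d₁ = 𝟙 (SpecF K) := by
  rw [Category.assoc, diagι_d₁]
  exact Over.w (d : 𝟙_ (Over (SpecF K)) ⟶ F.diag)

/-- The map induced on `K`-points over `K` by a morphism of groupoids. -/
def pointsMap {F F' : GroupoidOver k K} (f : F ⟶ F') (u : F.KPoints) : F'.KPoints :=
  ⟨u.val ≫ Hom.left f, by rw [Category.assoc, Hom.left_d₀, u.val_d₀]⟩

lemma pointsMap_id (F : GroupoidOver k K) (u : F.KPoints) : pointsMap (𝟙 F) u = u :=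
  KPoints.ext (Category.comp_id _)

lemma pointsMap_comp {F F' F'' : GroupoidOver k K} (f : F ⟶ F') (g : F' ⟶ F'')
    (u : F.KPoints) : pointsMap (f ≫ g) u = pointsMap g (pointsMap f u) :=
  KPoints.ext (Category.assoc _ _ _).symm

lemma continuous_pointsMap {F F' : GroupoidOver k K} (f : F ⟶ F') :
    Continuous (pointsMap f) := by
  let := krullTop K F.arr
  let := krullTop K F'.arr
  apply continuous_induced_rng.mpr
  exact (continuous_krullTop (Hom.left f)).comp continuous_induced_dom

variable [IsAlgClosure k K]

variable {F} in
lemma exists_gal (u : F.KPoints) : ∃ σ : Gal(K/k), specGal σ = u.val ≫ F.d₁ := by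
  have := IsAlgClosure.isAlgebraic (R := k) (K := K)
  apply exists_specGal
  rw [Category.assoc, ← F.d_over, ← Category.assoc, u.val_d₀, Category.id_comp]

variable {F} in
/-- The element `γ u` of `Gal(K/k)` with `d₁ u = Spec (γ u)`. -/
def gal (u : F.KPoints) : Gal(K/k) := Classical.choose (exists_gal u)

variable {F} in
lemma specGal_gal (u : F.KPoints) : specGal (gal u) = u.val ≫ F.d₁ :=
  Classical.choose_spec (exists_gal u)

/-- The product of `F(K)_K` is `u . v = u ∘ (v ∘ Spec (γ u))`. -/
instance : Mul F.KPoints where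
  mul u v := ⟨F.mul u.val (specGal (gal u) ≫ v.val)
      (by rw [Category.assoc, v.val_d₀, Category.comp_id, specGal_gal]),
    (F.mul_d₀ _ _ _).trans u.val_d₀⟩

instance : Inv F.KPoints where
  inv u := ⟨specGal (gal u)⁻¹ ≫ u.val ≫ F.inv, by
    rw [Category.assoc, Category.assoc, F.inv_d₀, ← specGal_gal, specGal_inv_comp]⟩

variable {F}

lemma KPoints.mul_val (u v : F.KPoints) : (u * v).val = F.mul u.val (specGal (gal u) ≫ v.val)
      (by rw [Category.assoc, v.val_d₀, Category.comp_id, specGal_gal]) := rfl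

lemma KPoints.inv_val (u : F.KPoints) : (u⁻¹).val = specGal (gal u)⁻¹ ≫ u.val ≫ F.inv := rfl

lemma gal_mul (u v : F.KPoints) : gal (u * v) = gal u * gal v := by
  apply specGal_injective
  rw [specGal_gal, specGal_mul, KPoints.mul_val, CompGraph.mul_d₁, Category.assoc, specGal_gal v]

lemma gal_one : gal (1 : F.KPoints) = 1 := by
  apply specGal_injective
  rw [specGal_gal, KPoints.one_val, F.ident_d₁, specGal_one]

lemma gal_inv (u : F.KPoints) : gal u⁻¹ = (gal u)⁻¹ := by
  apply specGal_injective
  rw [specGal_gal, KPoints.inv_val, Category.assoc, Category.assoc, F.inv_d₁, u.val_d₀,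
    Category.comp_id]

instance : Group F.KPoints where
  mul_assoc u v w := KPoints.ext (by
    simp only [KPoints.mul_val, gal_mul, specGal_mul, F.comp_mul, Category.assoc]
    exact F.assoc _ _ _ _ _)
  one_mul u := KPoints.ext (by
    refine Eq.trans ?_ (F.ident_mul u.val)
    simp only [KPoints.mul_val, KPoints.one_val, gal_one, specGal_one, Category.id_comp,
      ← Category.assoc u.val F.d₀, u.val_d₀])
  mul_one u := KPoints.ext (by
    refine Eq.trans ?_ (F.mul_ident u.val)
    simp only [KPoints.mul_val, KPoints.one_val, specGal_gal, Category.assoc])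
  inv_mul_cancel u := KPoints.ext (by
    have h := congrArg (specGal (gal u)⁻¹ ≫ ·) (F.inv_mul u.val)
    simp only [F.comp_mul] at h
    simp only [KPoints.mul_val, KPoints.inv_val, KPoints.one_val, gal_inv]
    rw [h, ← Category.assoc u.val F.d₁, ← specGal_gal, ← Category.assoc, specGal_inv_comp,
      Category.id_comp])

/-- The homomorphism `γ : F(K)_K → Gal(K/k)`. -/
def galHom (F : GroupoidOver k K) : F.KPoints →* Gal(K/k) where
  toFun := gal
  map_one' := gal_one
  map_mul' := gal_mul

lemma gal_diagPoint (d : Points F.diagGrp) :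
    gal (F := F) ⟨d.left ≫ F.diagι, diagPoint_d₀ d⟩ = 1 := by
  apply specGal_injective
  rw [specGal_gal, diagPoint_d₁, specGal_one]

/-- The embedding `F^diag(K)_K → F(K)_K`. -/
def diagPoints (F : GroupoidOver k K) : Points F.diagGrp →* F.KPoints :=
  MonoidHom.mk' (fun d => ⟨d.left ≫ F.diagι, diagPoint_d₀ d⟩)
    (fun d d' => KPoints.ext (by
      simp only [KPoints.mul_val, gal_diagPoint, specGal_one, Category.id_comp]
      exact F.diag_mul_left (T := 𝟙_ (Over (SpecF K))) d d'))

/-- The pullback of `v` along the composite of the structural morphism of `F^diag` with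
`Spec (γ v)⁻¹`. Its source is the structural morphism of `F^diag`. -/
def actPoint (v : F.KPoints) : F.diag.left ⟶ F.arr :=
  F.diag.hom ≫ specGal (gal v)⁻¹ ≫ v.val

lemma actPoint_d₀ (v : F.KPoints) : actPoint v ≫ F.d₀ = F.diag.hom ≫ specGal (gal v)⁻¹ := by
  simp only [actPoint, Category.assoc, v.val_d₀, Category.comp_id]

lemma actPoint_d₁ (v : F.KPoints) : actPoint v ≫ F.d₁ = F.diag.hom := by
  simp only [actPoint, Category.assoc, ← specGal_gal, specGal_inv_comp, Category.comp_id]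

/-- The composite `v ∘ x ∘ v⁻¹` for `v` in `F(K)_K` and `x` the universal point of `F^diag`. -/
def conjPoint (v : F.KPoints) : F.diag.left ⟶ F.arr :=
  F.mul (F.mul (actPoint v) F.diagι (by rw [actPoint_d₁, diagι_d₀])) (actPoint v ≫ F.inv)
    (by rw [CompGraph.mul_d₁, diagι_d₁, Category.assoc, F.inv_d₀, actPoint_d₁])

lemma conjPoint_d₀ (v : F.KPoints) : conjPoint v ≫ F.d₀ = F.diag.hom ≫ specGal (gal v)⁻¹ := by
  rw [conjPoint, CompGraph.mul_d₀, CompGraph.mul_d₀, actPoint_d₀]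

lemma conjPoint_d₁ (v : F.KPoints) : conjPoint v ≫ F.d₁ = F.diag.hom ≫ specGal (gal v)⁻¹ := by
  rw [conjPoint, CompGraph.mul_d₁, Category.assoc, F.inv_d₁, actPoint_d₀]

/-- The action `x ↦ v ∘ x ∘ v⁻¹` on `F^diag` of `v` in `F(K)_K`. -/
def actHom (v : F.KPoints) : F.diag.left ⟶ F.diag.left :=
  diagLift (conjPoint v) (F.diag.hom ≫ specGal (gal v)⁻¹) (conjPoint_d₀ v) (conjPoint_d₁ v)

lemma actHom_ι (v : F.KPoints) : actHom v ≫ F.diagι = conjPoint v := diagLift_ι _ _ _ _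

lemma actHom_hom (v : F.KPoints) : actHom v ≫ F.diag.hom = F.diag.hom ≫ specGal (gal v)⁻¹ :=
  diagLift_hom _ _ _ _

lemma actHom_one : actHom (1 : F.KPoints) = 𝟙 _ := by
  apply diag_hom_ext
  have h : actPoint (1 : F.KPoints) = F.diag.hom ≫ F.ident := by
    simp only [actPoint, gal_one, inv_one, specGal_one, KPoints.one_val, Category.id_comp]
  rw [actHom_ι, Category.id_comp, conjPoint]
  simp only [h, ident_inv]
  have h₁ := F.ident_mul F.diagι
  simp only [← Category.assoc, diagι_d₀] at h₁
  have h₂ := F.mul_ident F.diagι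
  simp only [← Category.assoc, diagι_d₁] at h₂
  simp only [h₁, h₂]

lemma comp_conjPoint {T : Scheme.{u}} (x : T ⟶ F.diag.left) (v : F.KPoints) :
    x ≫ conjPoint v = F.mul (F.mul (x ≫ actPoint v) (x ≫ F.diagι)
        (by rw [Category.assoc, Category.assoc, actPoint_d₁, diagι_d₀]))
      ((x ≫ actPoint v) ≫ F.inv)
      (by
        rw [CompGraph.mul_d₁]
        simp only [Category.assoc, diagι_d₁, F.inv_d₀, actPoint_d₁]) := by
  rw [conjPoint, F.comp_mul]
  simp only [F.comp_mul, Category.assoc]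

lemma actHom_mul (v w : F.KPoints) : actHom (v * w) = actHom w ≫ actHom v := by
  apply diag_hom_ext
  rw [Category.assoc, actHom_ι, actHom_ι, comp_conjPoint]
  set W := actPoint w with hW
  set V := actHom w ≫ actPoint v with hV
  have hVd₁ : V ≫ F.d₁ = W ≫ F.d₀ := by
    rw [hV, hW, Category.assoc, actPoint_d₁, actHom_hom, actPoint_d₀]
  have hVW : actPoint (v * w) = F.mul V W hVd₁ := by
    have hd : V = (F.diag.hom ≫ specGal (gal w)⁻¹ ≫ specGal (gal v)⁻¹) ≫ v.val := by
      rw [hV, actPoint, ← Category.assoc (actHom w), actHom_hom]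
      simp only [Category.assoc]
    rw [actPoint, gal_mul, mul_inv_rev, specGal_mul, KPoints.mul_val, F.comp_mul, F.comp_mul]
    congr 1
    · rw [hd]; simp only [Category.assoc]
    · rw [hW, actPoint]
      simp only [Category.assoc]
      rw [← Category.assoc (specGal (gal v)⁻¹), specGal_inv_comp, Category.id_comp]
  rw [conjPoint]
  simp only [hVW, actHom_ι, inv_of_mul]
  simp only [conjPoint, ← hW]
  exact conj_assoc V W F.diagι _ _ _ (by rw [hW, actPoint_d₁, diagι_d₀])
    (by rw [Category.assoc, F.inv_d₀, hW, actPoint_d₁, diagι_d₁])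
    (by rw [Category.assoc, Category.assoc, F.inv_d₀, F.inv_d₁, hVd₁])

/-- The action of `F(K)_K` on the scheme `F^diag` by conjugation. -/
def diagAct (F : GroupoidOver k K) : F.KPoints →* Aut F.diag.left where
  toFun v :=
    { hom := actHom v
      inv := actHom v⁻¹
      hom_inv_id := by rw [← actHom_mul, inv_mul_cancel, actHom_one]
      inv_hom_id := by rw [← actHom_mul, mul_inv_cancel, actHom_one] }
  map_one' := Aut.ext actHom_one
  map_mul' v w := Aut.ext (actHom_mul v w)

/-- The data `(F^diag, F(K)_K)` associated to a groupoid `F` over `K`. -/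
def extData (F : GroupoidOver k K) : ExtData k K where
  D := F.diagGrp
  E := F.KPoints
  incl := F.diagPoints
  proj := F.galHom
  act := F.diagAct

lemma gal_pointsMap {F F' : GroupoidOver k K} (f : F ⟶ F') (u : F.KPoints) :
    gal (pointsMap f u) = gal u := by
  apply specGal_injective
  rw [specGal_gal, specGal_gal, pointsMap, Category.assoc, Hom.left_d₁]

lemma pointsMap_mul {F F' : GroupoidOver k K} (f : F ⟶ F') (u v : F.KPoints) :
    pointsMap f (u * v) = pointsMap f u * pointsMap f v := KPoints.ext (by
  rw [KPoints.mul_val]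
  simp only [gal_pointsMap]
  change (u * v).val ≫ Hom.left f = _
  rw [KPoints.mul_val, Hom.map_mul]
  simp only [pointsMap, Category.assoc])

lemma actHom_diagMapOver {F F' : GroupoidOver k K} (f : F ⟶ F') (v : F.KPoints) :
    actHom v ≫ (diagMapOver f).left = (diagMapOver f).left ≫ actHom (pointsMap f v) := by
  apply diag_hom_ext
  have h : (diagMapOver f).left ≫ actPoint (pointsMap f v) = actPoint v ≫ Hom.left f := by
    rw [actPoint, gal_pointsMap, actPoint]
    simp only [pointsMap, ← Category.assoc, Over.w]
  rw [Category.assoc, Category.assoc, diagMapOver_ι, actHom_ι, comp_conjPoint, ← Category.assoc,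
    actHom_ι, conjPoint, Hom.map_mul]
  simp only [h, diagMapOver_ι, Hom.map_mul, Hom.map_inv]

lemma pointsMap_diagPoints {F F' : GroupoidOver k K} (f : F ⟶ F') (d : Points F.diagGrp) :
    pointsMap f (F.diagPoints d) = F'.diagPoints (Points.map (diagMap f) d) :=
  KPoints.ext (by
    have h : (Points.map (diagMap f) d).left = d.left ≫ (diagMapOver f).left := rfl
    change (d.left ≫ F.diagι) ≫ Hom.left f = (Points.map (diagMap f) d).left ≫ F'.diagι
    rw [h, Category.assoc, Category.assoc, diagMapOver_ι])

/-- The morphism `(h, l)` induced by a morphism of groupoids `F ⟶ F'`, with `h` the restriction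
to the diagonals and `l` the map on `K`-points over `K`. -/
def extMap {F F' : GroupoidOver k K} (f : F ⟶ F') : ExtData.Hom F.extData F'.extData where
  h := diagMap f
  l := { MonoidHom.mk' (pointsMap f) (pointsMap_mul f) with
    continuous_toFun := continuous_pointsMap f }
  l_incl d := pointsMap_diagPoints f d
  proj_l e := gal_pointsMap f e
  act_h e := by
    change actHom e ≫ (diagMapOver f).left = (diagMapOver f).left ≫ actHom (pointsMap f e)
    exact actHom_diagMapOver f e

end PointsGroup

end GroupoidOver

section Main

variable (k K : Type u) [Field k] [Field K] [Algebra k K]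

/-- The category of transitive affine groupoids over `K/k`. -/
abbrev TransitiveAffineGroupoid : Type (u + 1) :=
  (GroupoidOver.IsTransitiveAffine (k := k) (K := K)).FullSubcategory

/-- The property of being a Galois extended `K`-group. -/
def galoisExtended : ObjectProperty (ExtData k K) := fun G => G.IsGaloisExtended

/-- The category of Galois extended `K`-groups. -/
abbrev GaloisExtendedGroup : Type (u + 1) := (galoisExtended k K).FullSubcategory

variable [IsAlgClosure k K]

/-- The functor sending a groupoid `F` over `K/k` to the data `(F^diag, F(K)_K)`. -/
def extFunctor : GroupoidOver k K ⥤ ExtData k K where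
  obj F := F.extData
  map f := GroupoidOver.extMap f
  map_id F := ExtData.Hom.ext (GroupoidOver.diagMap_id F)
    (ContinuousMonoidHom.ext fun u => GroupoidOver.pointsMap_id F u)
  map_comp f g := ExtData.Hom.ext (GroupoidOver.diagMap_comp f g)
    (ContinuousMonoidHom.ext fun u => GroupoidOver.pointsMap_comp f g u)

end Main

end GalGrpd
end

noncomputable section

namespace GalGrpd

/-! ### Points of finitely generated algebras over an algebraically closed field -/

section Nullstellensatz

variable {K : Type*} [Field K] [IsAlgClosed K]

/-! On the spectrum of a local ring, two morphisms to `Spec K` that agree over `k` differ by a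
unique element of `Gal(K/k)` (`exists_eq_comp_specGal`, `comp_specGal_injective`): as `k` is
perfect, minimal polynomials split in `K` with distinct roots, whose differences are units. On a
scheme `T` this element is a continuous function of the point (`continuous_galAt`). A transitive
affine groupoid is therefore a family, parametrised by the profinite space `Gal(K/k)`, of torsors
under its diagonal `D`.

If `γ` has a continuous section, every arrow with values in a local ring can be written `y ∘ e`,
with `y` a point of `D` and `e` in `F(K)_K`, and the composition is `(y ∘ e)(y' ∘ e') = (y · e(y'))
∘ ee'`, with `e(y')` the action by conjugation. So `D`, the extension and the action determine the
groupoid. A morphism is determined by its effect on `y` and `e`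
(`Hom.faithful_of_transitiveAffine`); a compatible pair `(h, l)` defines one by `y ∘ e ↦ h(y) ∘
l(e)` (`IsCompatible.exists_left`, `IsCompatible.exists_hom`); and for an abstract Galois extended
group the same formulas define a groupoid on `D ×ₖ Spec K` (`Sectioned.groupoid`,
`Sectioned.isoExtData`). Continuity makes these formulas, given for each `σ` separately, into
morphisms of schemes: a locally constant family of morphisms glues along a continuous map to its
parameters (`LocConst.exists_glue`). Identities are then checked on local rings
(`hom_ext_of_local`).

The hard point is the continuous section (`RingGroupoid.exists_section`), since `D` need not be of
finite type. Consider pairs formed by a closed subgroup of `D` and a closed subscheme of `F` which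
is a torsor under it above every `σ`. Zorn's lemma gives a minimal such subscheme. Every function on
`F` is a combination of entries of a finite-dimensional representation `c` (`exists_rep`). The
closed image of a fibre under `c` is of finite type, so it has a `K`-point, and such a point remains
valid for nearby `σ`; hence a choice `g σ` can be made locally constant in `σ`. Locally constant
functions on `Gal(K/k)` come from the subring generated by source and target (`exists_isInducedBy`),
so the condition `c = g` is given by global equations, and it defines a torsor under the kernel of
`c` (`isReduction_sup`). Its fibres are non-empty because projections between closed images of a
group are surjective on `K`-points (`IsGroupPoint.exists_restrGLs_eq`). By minimality these
equations hold already: each fibre is a single `K`-point, varying in a locally constant way. -/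

lemma exists_algHom_of_finiteType (B : Type*) [CommRing B] [Algebra K B] [Algebra.FiniteType K B]
    [Nontrivial B] : Nonempty (B →ₐ[K] K) := by
  obtain ⟨m, hm⟩ := Ideal.exists_maximal B
  let _ : Field (B ⧸ m) := Ideal.Quotient.field m
  have : Algebra.FiniteType K (B ⧸ m) :=
    Algebra.FiniteType.of_surjective (Ideal.Quotient.mkₐ K m) Ideal.Quotient.mk_surjective
  have : Module.Finite K (B ⧸ m) := finite_of_finite_type_of_isJacobsonRing K (B ⧸ m)
  have hb : Function.Bijective (algebraMap K (B ⧸ m)) :=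
    IsAlgClosed.algebraMap_bijective_of_isIntegral
  let e : K ≃ₐ[K] (B ⧸ m) := AlgEquiv.ofBijective (Algebra.ofId K _) hb
  exact ⟨e.symm.toAlgHom.comp (Ideal.Quotient.mkₐ K m)⟩

/-- Otherwise the localization at `b` is a non-zero finitely generated algebra, and has a `K`-point,
at which `b` is invertible. -/
lemma isNilpotent_of_forall_algHom {B : Type*} [CommRing B] [Algebra K B]
    [Algebra.FiniteType K B] (b : B) (h : ∀ x : B →ₐ[K] K, x b = 0) : IsNilpotent b := by
  by_contra hb
  have : Nontrivial (Localization.Away b) := by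
    by_contra hn
    rw [not_nontrivial_iff_subsingleton, IsLocalization.subsingleton_iff
      (M := Submonoid.powers b)] at hn
    exact hb (Submonoid.mem_powers_iff _ _ |>.mp hn)
  have : Algebra.FiniteType K (Localization.Away b) := by
    have := IsLocalization.finiteType_of_monoid_fg (Submonoid.powers b) (Localization.Away b)
    exact Algebra.FiniteType.trans (S := B) inferInstance this
  obtain ⟨x⟩ := exists_algHom_of_finiteType (K := K) (Localization.Away b)
  have h1 := h (x.comp (IsScalarTower.toAlgHom K B (Localization.Away b)))
  have h2 : IsUnit (algebraMap B (Localization.Away b) b) :=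
    IsLocalization.Away.algebraMap_isUnit b
  exact (h2.map x).ne_zero h1

/-- Take `c` to be a product of elements of the finitely many other minimal primes, each chosen
outside `p`. The open set where `c` is invertible then meets no irreducible component other than
that of `p`. -/
lemma exists_notMem_forall_le_of_minimalPrimes {B : Type*} [CommRing B] [IsNoetherianRing B]
    {p : Ideal B} (hp : p ∈ minimalPrimes B) :
    ∃ c ∉ p, ∀ q : Ideal B, q.IsPrime → c ∉ q → p ≤ q := by
  classical
  have hfin : (minimalPrimes B).Finite := minimalPrimes.finite_of_isNoetherianRing B
  have hprime : p.IsPrime := hp.1.1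
  have hex : ∀ q ∈ hfin.toFinset.erase p, ∃ c ∈ q, c ∉ p := by
    intro q hq
    rw [Finset.mem_erase, Set.Finite.mem_toFinset] at hq
    by_contra! hcon
    exact hq.1 (le_antisymm hcon (hp.2 hq.2.1 hcon))
  choose! c hc hc' using hex
  refine ⟨∏ q ∈ hfin.toFinset.erase p, c q, ?_, fun q hq hcq => ?_⟩
  · rw [hprime.prod_mem_iff]
    rintro ⟨q, hq, h⟩
    exact hc' q hq h
  · obtain ⟨q₀, hq₀, hle⟩ := Ideal.exists_minimalPrimes_le (I := ⊥) (J := q) bot_le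
    by_cases hpq : q₀ = p
    · exact hpq ▸ hle
    · exact absurd (q.mem_of_dvd (Finset.dvd_prod_of_mem c
        (Finset.mem_erase.mpr ⟨hpq, hfin.mem_toFinset.mpr hq₀⟩)) (hle (hc q₀ (Finset.mem_erase.mpr
          ⟨hpq, hfin.mem_toFinset.mpr hq₀⟩)))) hcq

/-- For an inclusion of finitely generated algebras over an algebraically closed field, the points
of a nonempty principal open subset extend. -/
lemma exists_forall_extend {B C : Type*} [CommRing B] [CommRing C] [Algebra K B] [Algebra K C]
    [Algebra.FiniteType K B] [Algebra.FiniteType K C] [Nontrivial B]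
    (φ : B →ₐ[K] C) (hφ : Function.Injective φ) :
    ∃ b : B, ¬ IsNilpotent b ∧ ∀ x : B →ₐ[K] K, x b ≠ 0 → ∃ y : C →ₐ[K] K, y.comp φ = x := by
  have : IsNoetherianRing B := Algebra.FiniteType.isNoetherianRing K B
  have hft : φ.toRingHom.FiniteType := by
    have h1 : (φ.toRingHom.comp (algebraMap K B)).FiniteType := by
      rw [AlgHom.toRingHom_eq_coe, AlgHom.comp_algebraMap]
      exact (RingHom.finiteType_algebraMap (A := K) (B := C)).mpr inferInstance
    exact h1.of_comp_finiteType
  have hfp : φ.toRingHom.FinitePresentation := RingHom.FinitePresentation.of_finiteType.mp hft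
  obtain ⟨⟨p, hp⟩⟩ : Nonempty (minimalPrimes B) := Ideal.nonempty_minimalPrimes bot_ne_top
  have hprime : p.IsPrime := hp.1.1
  obtain ⟨c, hc, hcq⟩ := exists_notMem_forall_le_of_minimalPrimes hp
  -- Chevalley: the image of `Spec C` is a finite union of locally closed pieces. It contains the
  -- generic point `p`, since minimal primes lift along an injection, so `p` lies in one piece `Z`.
  obtain ⟨S, hS⟩ := PrimeSpectrum.exists_constructibleSetData_iff.mpr
    (PrimeSpectrum.isConstructible_range_comap hfp)
  have hmem : (⟨p, hprime⟩ : PrimeSpectrum B) ∈ S.toSet := by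
    rw [hS]
    obtain ⟨P, hP, hPc⟩ := Ideal.exists_comap_eq_of_mem_minimalPrimes_of_injective
      (f := φ.toRingHom) hφ p hp
    exact ⟨⟨P, hP⟩, PrimeSpectrum.ext hPc⟩
  obtain ⟨Z, hZS, hZ1, hZ2⟩ : ∃ Z ∈ S, (⟨p, hprime⟩ : PrimeSpectrum B) ∈ Z.toSet := by
    simpa [PrimeSpectrum.ConstructibleSetData.toSet] using hmem
  have hf : Z.f ∉ p := by simpa using hZ2
  -- Where `c` is invertible only the component of `p` remains, and there the equations of `Z` hold;
  -- inverting `Z.f` as well gives a principal open subset inside the image.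
  refine ⟨Z.f * c, fun hn => ?_, fun x hx => ?_⟩
  · obtain ⟨n, hn⟩ := hn
    have : Z.f * c ∈ p := hprime.mem_of_pow_mem n (hn ▸ p.zero_mem)
    exact (hprime.mem_or_mem this).elim hf hc
  · have hker : (RingHom.ker x).IsPrime := RingHom.ker_isPrime _
    rw [map_mul] at hx
    have hpx : p ≤ RingHom.ker x := hcq _ hker (right_ne_zero_of_mul hx)
    have hxm : (⟨RingHom.ker x, hker⟩ : PrimeSpectrum B) ∈ S.toSet := by
      have : (⟨RingHom.ker x, hker⟩ : PrimeSpectrum B) ∈ Z.toSet := by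
        refine ⟨fun a ha => hpx (hZ1 ha), ?_⟩
        simpa using left_ne_zero_of_mul hx
      simpa [PrimeSpectrum.ConstructibleSetData.toSet] using ⟨Z, hZS, this⟩
    rw [hS] at hxm
    obtain ⟨⟨q, hq⟩, hqx⟩ := hxm
    have hqx' : q.comap φ.toRingHom = RingHom.ker x := congrArg PrimeSpectrum.asIdeal hqx
    -- `C ⧸ J` is the ring of the fibre above `x`. It is non-zero because the prime `q` lies above
    -- `x`, so it has a `K`-point.
    let J : Ideal C := (RingHom.ker x).map φ.toRingHom
    have hJ : J ≤ q := Ideal.map_le_iff_le_comap.mpr hqx'.ge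
    have : Nontrivial (C ⧸ J) := Ideal.Quotient.nontrivial_iff.mpr
      fun h => hq.ne_top (top_le_iff.mp (h ▸ hJ))
    have : Algebra.FiniteType K (C ⧸ J) :=
      Algebra.FiniteType.of_surjective (Ideal.Quotient.mkₐ K J) Ideal.Quotient.mk_surjective
    obtain ⟨y⟩ := exists_algHom_of_finiteType (K := K) (C ⧸ J)
    refine ⟨y.comp (Ideal.Quotient.mkₐ K J), AlgHom.ext fun b => ?_⟩
    have h1 : b - algebraMap K B (x b) ∈ RingHom.ker x := by
      simp [RingHom.mem_ker]
    have h2 : Ideal.Quotient.mkₐ K J (φ (b - algebraMap K B (x b))) = 0 :=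
      Ideal.Quotient.eq_zero_iff_mem.mpr (Ideal.mem_map_of_mem _ h1)
    have h3 := congrArg y h2
    simpa [sub_eq_zero] using h3

end Nullstellensatz

/-! ### Locally constant choices on profinite spaces -/

/-- A choice valid near `x` is valid on a clopen neighbourhood; finitely many of these cover, and on
overlaps one of them is given priority. This is applied to `Gal(K/k)`, both for points of torsors
and for local sections of an extension. -/
lemma exists_isLocallyConstant_choice {X S : Type*} [TopologicalSpace X] [CompactSpace X]
    [T2Space X] [TotallyDisconnectedSpace X] (P : X → S → Prop)
    (h : ∀ x, ∃ s, ∀ᶠ x' in 𝓝 x, P x' s) :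
    ∃ g : X → S, IsLocallyConstant g ∧ ∀ x, P x (g x) := by
  classical
  rcases isEmpty_or_nonempty X with hX | ⟨⟨x₀⟩⟩
  · exact ⟨fun x => hX.elim x, (IsLocallyConstant.iff_eventually_eq _).mpr fun x => hX.elim x, fun x => hX.elim x⟩
  choose s hs using h
  have hV : ∀ x, ∃ V : Set X, IsClopen V ∧ x ∈ V ∧ ∀ x' ∈ V, P x' (s x) := by
    intro x
    obtain ⟨U, hUP, hU, hxU⟩ := eventually_nhds_iff.mp (hs x)
    obtain ⟨V, hV, hxV, hVU⟩ := compact_exists_isClopen_in_isOpen hU hxU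
    exact ⟨V, hV, hxV, fun x' hx' => hUP x' (hVU hx')⟩
  choose V hV hxV hVP using hV
  suffices H : ∀ t : Finset X, ∃ g : X → S, IsLocallyConstant g ∧
      ∀ x ∈ ⋃ y ∈ t, V y, P x (g x) by
    obtain ⟨t, ht⟩ := isCompact_univ.elim_finite_subcover V (fun x => (hV x).isOpen)
      (fun x _ => Set.mem_iUnion.mpr ⟨x, hxV x⟩)
    obtain ⟨g, hg, hgP⟩ := H t
    exact ⟨g, hg, fun x => hgP x (ht (Set.mem_univ x))⟩
  intro t
  induction t using Finset.induction_on with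
  | empty => exact ⟨fun _ => s x₀, IsLocallyConstant.const _, by simp⟩
  | insert y t _ ih =>
    obtain ⟨g, hg, hgP⟩ := ih
    refine ⟨fun x => if x ∈ V y then s y else g x, ?_, ?_⟩
    · rw [IsLocallyConstant.iff_eventually_eq]
      intro x
      by_cases hx : x ∈ V y
      · filter_upwards [(hV y).isOpen.mem_nhds hx] with x' hx'
        simp [hx, hx']
      · filter_upwards [(hV y).compl.isOpen.mem_nhds hx,
          (IsLocallyConstant.iff_eventually_eq g).mp hg x] with x' hx' hgx
        have : x' ∉ V y := hx'
        simp [hx, this, hgx]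
    · intro x hx
      by_cases hxy : x ∈ V y
      · simpa [hxy] using hVP y x hxy
      · simp only [Finset.set_biUnion_insert, Set.mem_union, hxy, false_or] at hx
        simpa [hxy] using hgP x hx

/-! ### Products of rings over a field, without fixed algebra structures -/

section KProduct

open TensorProduct

variable {K : Type u} [Field K]

/-- Linear independence over `K` of a finite family in a ring `S`, for the vector space structure
defined by a homomorphism `K →+* S`. -/
def IndepOver {S : Type u} [CommRing S] (s : K →+* S) {J : Type*} [Fintype J] (a : J → S) : Prop :=
  ∀ x : J → K, ∑ l, s (x l) * a l = 0 → x = 0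

lemma indepOver_iff {S : Type u} [CommRing S] (s : K →+* S) {J : Type*} [Fintype J] (a : J → S) :
    letI := s.toAlgebra
    IndepOver s a ↔ LinearIndependent K a := by
  let := s.toAlgebra
  rw [Fintype.linearIndependent_iff]
  simp only [Algebra.smul_def]
  exact ⟨fun h g hg i => congrFun (h g hg) i, fun h x hx => funext (h x hx)⟩

/-- The tensor product of two rings over `K`, for given homomorphisms from `K`. -/
structure KProduct {S T : Type u} [CommRing S] [CommRing T] (s : K →+* S) (t : K →+* T) where
  /-- the underlying ring -/
  P : Type u
  [ring : CommRing P]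
  /-- the first coprojection -/
  i : S →+* P
  /-- the second coprojection -/
  j : T →+* P
  comm : i.comp s = j.comp t
  exists_lift : ∀ {U : Type u} [CommRing U] (f : S →+* U) (g : T →+* U), f.comp s = g.comp t →
    ∃ φ : P →+* U, φ.comp i = f ∧ φ.comp j = g
  indep_left : ∀ {J : Type u} [Fintype J] (a : J → S) (q : J → T), IndepOver s a →
    ∑ l, i (a l) * j (q l) = 0 → q = 0
  indep_right : ∀ {J : Type u} [Fintype J] (p : J → S) (e : J → T), IndepOver t e →
    ∑ l, i (p l) * j (e l) = 0 → p = 0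
  decomp : ∀ z : P, ∃ (J : Type u) (_ : Fintype J) (a : J → S) (e : J → T),
    IndepOver s a ∧ IndepOver t e ∧ z = ∑ l, i (a l) * j (e l)

attribute [instance] KProduct.ring

/-- Linear independence over a field is preserved by the base change to `M`. -/
lemma tmul_sum_eq_zero_right {M N : Type u} [CommRing M] [CommRing N] [Algebra K M] [Algebra K N]
    {J : Type u} [Fintype J] (p : J → M) (e : J → N) (he : LinearIndependent K e)
    (h : ∑ l, p l ⊗ₜ[K] e l = 0) : p = 0 := by
  have hb : LinearIndependent M (fun l => (1 : M) ⊗ₜ[K] e l) :=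
    Module.Flat.linearIndependent_one_tmul he
  rw [Fintype.linearIndependent_iff] at hb
  refine funext (hb p ?_)
  simpa [TensorProduct.smul_tmul'] using h

lemma tmul_sum_eq_zero_left {M N : Type u} [CommRing M] [CommRing N] [Algebra K M] [Algebra K N]
    {J : Type u} [Fintype J] (a : J → M) (q : J → N) (ha : LinearIndependent K a)
    (h : ∑ l, a l ⊗ₜ[K] q l = 0) : q = 0 := by
  apply tmul_sum_eq_zero_right q a ha
  have := congrArg (TensorProduct.comm K M N) h
  simpa [map_sum] using this

/-- A decomposition of minimal rank. Expand `z` along a basis of `N`, then expand its coefficients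
along a basis of the space `V` that they span and regroup. -/
lemma exists_tmul_sum {M N : Type u} [CommRing M] [CommRing N] [Algebra K M] [Algebra K N]
    (z : M ⊗[K] N) : ∃ (J : Type u) (_ : Fintype J) (a : J → M) (e : J → N),
      LinearIndependent K a ∧ LinearIndependent K e ∧ z = ∑ l, a l ⊗ₜ[K] e l := by
  classical
  obtain ⟨b, hb⟩ := TensorProduct.eq_repr_basis_right (Module.Basis.ofVectorSpace K N) z
  let 𝒞 := Module.Basis.ofVectorSpace K N
  let V : Submodule K M := Submodule.span K (b '' b.support)
  have hfin : Module.Finite K V :=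
    Module.Finite.span_of_finite K (b.support.finite_toSet.image b)
  let v := Module.Basis.ofVectorSpace K V
  have : Fintype (Module.Basis.ofVectorSpaceIndex K V) := FiniteDimensional.fintypeBasisIndex v
  have hmem : ∀ r : b.support, b r ∈ V := fun r =>
    Submodule.subset_span ⟨r, r.2, rfl⟩
  let x (r : b.support) (l) : K := v.repr ⟨b r, hmem r⟩ l
  have hx : ∀ r : b.support, b r = ∑ l, x r l • (v l : M) := by
    intro r
    have := congrArg Subtype.val (v.sum_repr ⟨b r, hmem r⟩)
    simp only [AddSubmonoidClass.coe_finsetSum, Submodule.coe_smul] at this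
    exact this.symm
  refine ⟨_, ‹_›, fun l => v l, fun l => ∑ r : b.support, x r l • 𝒞 r,
    v.linearIndependent.map' V.subtype (Submodule.ker_subtype V), ?_, ?_⟩
  · rw [Fintype.linearIndependent_iff]
    intro y hy
    have h1 : ∑ r : b.support, (∑ l, y l * x r l) • 𝒞 r = 0 := by
      rw [← hy]
      simp only [Finset.sum_smul, Finset.smul_sum, smul_smul]
      rw [Finset.sum_comm]
    have h2 : LinearIndependent K (fun r : b.support => 𝒞 r) :=
      𝒞.linearIndependent.comp _ Subtype.val_injective
    rw [Fintype.linearIndependent_iff] at h2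
    have h3 := h2 _ h1
    -- A linear relation `y` between the new right-hand vectors is a linear form on `V` which
    -- vanishes on the coefficients `b r`; these span `V`, so the form is zero.
    let Y : V →ₗ[K] K := v.constr K y
    have hY : ∀ m : V, Y m = ∑ l, y l * v.repr m l := by
      intro m
      change v.constr K y m = _
      rw [v.constr_apply_fintype K]
      simp [mul_comm, Module.Basis.equivFun_apply]
    have hY0 : Y = 0 := by
      apply LinearMap.ext
      rintro ⟨m, hm⟩
      induction hm using Submodule.span_induction with
      | mem m h =>
        obtain ⟨r, hr, rfl⟩ := h
        rw [hY]
        exact h3 ⟨r, hr⟩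
      | zero => exact map_zero Y
      | add m m' hm hm' h h' =>
        have := map_add Y ⟨m, hm⟩ ⟨m', hm'⟩
        rw [h, h'] at this
        simpa using this
      | smul c m hm h =>
        have := map_smul Y c ⟨m, hm⟩
        rw [h] at this
        simpa using this
    intro l
    have := LinearMap.congr_fun hY0 (v l)
    simpa [Y] using this
  · rw [← hb, Finsupp.sum, ← Finset.sum_coe_sort b.support
      (fun r => b r ⊗ₜ[K] (Module.Basis.ofVectorSpace K N) r)]
    simp only [tmul_sum]
    rw [Finset.sum_comm]
    refine Finset.sum_congr rfl fun r _ => ?_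
    conv_lhs => rw [hx r]
    simp only [sum_tmul, smul_tmul]
    rfl

/-- The tensor product of two rings over `K`. -/
def kProduct {S T : Type u} [CommRing S] [CommRing T] (s : K →+* S) (t : K →+* T) :
    KProduct s t :=
  letI := s.toAlgebra
  letI := t.toAlgebra
  { P := S ⊗[K] T
    i := Algebra.TensorProduct.includeLeftRingHom
    j := (Algebra.TensorProduct.includeRight : T →ₐ[K] S ⊗[K] T).toRingHom
    comm := by
      ext x
      exact Algebra.TensorProduct.tmul_one_eq_one_tmul x
    exists_lift := by
      intro U _ f g h
      let := (f.comp s).toAlgebra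
      let f' : S →ₐ[K] U := { f with commutes' := fun r => rfl }
      let g' : T →ₐ[K] U := { g with commutes' := fun r => (RingHom.congr_fun h r).symm }
      refine ⟨(Algebra.TensorProduct.lift f' g' fun _ _ => Commute.all _ _).toRingHom, ?_, ?_⟩
      · ext x
        simp [f']
      · ext x
        simp [g']
    indep_left := by
      intro J _ a q ha h
      refine tmul_sum_eq_zero_left a q ((indepOver_iff s a).mp ha) ?_
      simpa using h
    indep_right := by
      intro J _ p e he h
      refine tmul_sum_eq_zero_right p e ((indepOver_iff t e).mp he) ?_
      simpa using h
    decomp := by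
      intro z
      obtain ⟨J, hJ, a, e, ha, he, h⟩ := exists_tmul_sum z
      exact ⟨J, hJ, a, e, (indepOver_iff s a).mpr ha, (indepOver_iff t e).mpr he, by simpa using h⟩ }

/-- Complete `e` to a basis and retain only the finitely many added vectors that occur in the `f m`.
-/
lemma exists_indepOver_extension {T : Type u} [CommRing T] (t : K →+* T) {J κ : Type u}
    [Fintype J] [Fintype κ] (e : J → T) (he : IndepOver t e) (f : κ → T) :
    ∃ (ρ : Type u) (_ : Fintype ρ) (g : ρ → T), IndepOver t (Sum.elim e g) ∧
      ∃ (x : κ → J → K) (y : κ → ρ → K),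
        ∀ m, f m = ∑ l, t (x m l) * e l + ∑ r, t (y m r) * g r := by
  classical
  let := t.toAlgebra
  have he' : LinearIndependent K e := (indepOver_iff t e).mp he
  let b := Module.Basis.sumExtend he'
  let R : Finset (Module.Basis.sumExtendIndex he') :=
    Finset.univ.biUnion fun m => ((b.repr (f m)).support.preimage Sum.inr Sum.inr_injective.injOn)
  have hb : ∀ l, b (Sum.inl l) = e l := fun l => by
    simp [b, Module.Basis.sumExtend]
    rfl
  refine ⟨R, inferInstance, fun r => b (Sum.inr r), ?_, fun m l => b.repr (f m) (Sum.inl l),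
    fun m r => b.repr (f m) (Sum.inr r), fun m => ?_⟩
  · rw [indepOver_iff]
    have := b.linearIndependent.comp
      (Sum.map (id : J → J) (Subtype.val : R → Module.Basis.sumExtendIndex he'))
      (Sum.map_injective.mpr ⟨Function.injective_id, Subtype.val_injective⟩)
    have hfun : Sum.elim e (fun r : R => b (Sum.inr r)) = b ∘ Sum.map id Subtype.val := by
      ext (l | r)
      · simp [hb]
      · simp
    rw [hfun]
    exact this
  · have h1 := b.linearCombination_repr (f m)
    rw [Finsupp.linearCombination_apply, Finsupp.sum_of_support_subset (s := Finset.univ.disjSum R)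
      _ _ _ (by simp)] at h1
    · rw [Finset.sum_disjSum] at h1
      rw [← h1]
      congr 1
      · refine Finset.sum_congr rfl fun l _ => ?_
        rw [hb, Algebra.smul_def]
        simp
        rfl
      · rw [← Finset.sum_coe_sort R]
        refine Finset.sum_congr rfl fun r _ => ?_
        rw [Algebra.smul_def]
        simp
        rfl
    · intro l hl
      rcases l with l | r
      · simp
      · simp only [Finset.inr_mem_disjSum, R, Finset.mem_biUnion]
        exact ⟨m, Finset.mem_univ _, by simpa using hl⟩

end KProduct

/-! ### Affine groupoids in terms of ring-valued points -/

/-- The affine groupoids with objects `Spec K`, in terms of their points in rings: `A` is the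
ring of functions on the scheme of arrows. -/
structure RingGroupoid (K A : Type u) [Field K] [CommRing A] where
  /-- the target -/
  δ₀ : K →+* A
  /-- the source -/
  δ₁ : K →+* A
  /-- composition of points -/
  mul : ∀ {T : Type u} [CommRing T] (u v : A →+* T), u.comp δ₁ = v.comp δ₀ → (A →+* T)
  mul_δ₀ : ∀ {T : Type u} [CommRing T] (u v : A →+* T) (h : u.comp δ₁ = v.comp δ₀),
    (mul u v h).comp δ₀ = u.comp δ₀
  mul_δ₁ : ∀ {T : Type u} [CommRing T] (u v : A →+* T) (h : u.comp δ₁ = v.comp δ₀),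
    (mul u v h).comp δ₁ = v.comp δ₁
  comp_mul : ∀ {T T' : Type u} [CommRing T] [CommRing T'] (φ : T →+* T') (u v : A →+* T)
    (h : u.comp δ₁ = v.comp δ₀),
    φ.comp (mul u v h) = mul (φ.comp u) (φ.comp v) (by rw [RingHom.comp_assoc, h, RingHom.comp_assoc])
  assoc : ∀ {T : Type u} [CommRing T] (u v w : A →+* T) (h : u.comp δ₁ = v.comp δ₀)
    (h' : v.comp δ₁ = w.comp δ₀),
    mul (mul u v h) w (by rw [mul_δ₁, h']) = mul u (mul v w h') (by rw [mul_δ₀, h])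
  /-- the identities -/
  ε : A →+* K
  ε_δ₀ : ε.comp δ₀ = RingHom.id K
  ε_δ₁ : ε.comp δ₁ = RingHom.id K
  one_mul : ∀ {T : Type u} [CommRing T] (u : A →+* T),
    mul ((u.comp δ₀).comp ε) u (by rw [RingHom.comp_assoc, ε_δ₁, RingHom.comp_id]) = u
  mul_one : ∀ {T : Type u} [CommRing T] (u : A →+* T),
    mul u ((u.comp δ₁).comp ε)
      (by rw [RingHom.comp_assoc _ ε, ε_δ₀, RingHom.comp_id]) = u
  /-- the inverse -/
  inv : A →+* A
  inv_δ₀ : inv.comp δ₀ = δ₁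
  inv_δ₁ : inv.comp δ₁ = δ₀
  mul_inv : ∀ {T : Type u} [CommRing T] (u : A →+* T),
    mul u (u.comp inv) (by rw [RingHom.comp_assoc, inv_δ₀]) = (u.comp δ₀).comp ε
  inv_mul : ∀ {T : Type u} [CommRing T] (u : A →+* T),
    mul (u.comp inv) u (by rw [RingHom.comp_assoc, inv_δ₁]) = (u.comp δ₁).comp ε

namespace RingGroupoid

variable {K A : Type u} [Field K] [CommRing A] (G : RingGroupoid K A)

/-- A representation of the groupoid: a multiplicative matrix of functions. -/
structure IsRep {J : Type*} [Fintype J] [DecidableEq J] (c : Matrix J J A) : Prop where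
  map_mul : ∀ {T : Type u} [CommRing T] (u v : A →+* T) (h : u.comp G.δ₁ = v.comp G.δ₀),
    c.map (G.mul u v h) = c.map u * c.map v
  map_one : c.map G.ε = 1

/-- The function `a` is evaluated on the composite of the universal composable pair, with values in
the tensor product; every other pair is a specialization of this one. -/
lemma exists_coefficients (a : A) : ∃ (J : Type u) (_ : Fintype J) (a' e : J → A),
    IndepOver G.δ₁ a' ∧ IndepOver G.δ₀ e ∧
    ∀ {T : Type u} [CommRing T] (u v : A →+* T) (h : u.comp G.δ₁ = v.comp G.δ₀),
      G.mul u v h a = ∑ l, u (a' l) * v (e l) := by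
  let P := kProduct G.δ₁ G.δ₀
  obtain ⟨J, hJ, a', e, ha, he, hz⟩ := P.decomp (G.mul P.i P.j P.comm a)
  refine ⟨J, hJ, a', e, ha, he, fun {T} _ u v h => ?_⟩
  obtain ⟨φ, rfl, rfl⟩ := P.exists_lift u v h
  have := congrArg φ hz
  rw [← RingHom.comp_apply, G.comp_mul] at this
  simpa [map_sum] using this

/-- Every function on an affine groupoid is a linear combination of the entries of a
representation. -/
lemma exists_rep (a : A) : ∃ (J : Type u) (_ : Fintype J) (_ : DecidableEq J) (c : Matrix J J A),
    G.IsRep c ∧ ∃ x y : J → K, a = ∑ l, ∑ m, G.δ₁ (x l) * G.δ₀ (y m) * c m l := by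
  classical
  obtain ⟨J, _, a', e, ha', he, hae⟩ := G.exists_coefficients a
  choose Q hQ p f hp hf hpf using fun m : J => G.exists_coefficients (e m)
  -- The right coefficients `f` of the `e m` need not lie in the span of `e`; the vectors `g` absorb
  -- the excess.
  obtain ⟨R, hR, g, hg, x, y, hxy⟩ := exists_indepOver_extension G.δ₀ e he
    (fun r : Σ m, Q m => f r.1 r.2)
  -- `c m l` is the coefficient of `e l` in the expansion of `e m` on a composite. The scalars move
  -- from the target of the second arrow to the source of the first.
  let c : Matrix J J A := fun m l => ∑ r : Q m, p m r * G.δ₁ (x ⟨m, r⟩ l)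
  -- Evaluate `a` on `(u v) w = u (v w)`, where `w` is the universal third arrow `P.j`, and compare
  -- the coefficients of the independent elements `e l`.
  have key : ∀ {T : Type u} [CommRing T] (u v : A →+* T) (h : u.comp G.δ₁ = v.comp G.δ₀) (l : J),
      G.mul u v h (a' l) = ∑ m, u (a' m) * v (c m l) := by
    intro T _ u v h
    let P := kProduct (v.comp G.δ₁) G.δ₀
    have hc : (P.i.comp v).comp G.δ₁ = P.j.comp G.δ₀ := by
      rw [RingHom.comp_assoc, P.comm]
    have hs : ∀ k : K, P.i (v (G.δ₁ k)) = P.j (G.δ₀ k) := fun k => RingHom.congr_fun hc k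
    have h0 : (P.i.comp u).comp G.δ₁ = (P.i.comp v).comp G.δ₀ := by
      rw [RingHom.comp_assoc, h, RingHom.comp_assoc]
    have e1 : G.mul (P.i.comp (G.mul u v h)) P.j
        (by rw [RingHom.comp_assoc, G.mul_δ₁, P.comm]) a =
        ∑ l, P.i (G.mul u v h (a' l)) * P.j (e l) := hae _ _ _
    have e2 : G.mul (P.i.comp u) (G.mul (P.i.comp v) P.j hc) (by rw [G.mul_δ₀, h0]) a =
        ∑ m, P.i (u (a' m)) * (G.mul (P.i.comp v) P.j hc (e m)) := hae _ _ _
    have e3 : ∀ m, G.mul (P.i.comp v) P.j hc (e m) =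
        ∑ r : Q m, P.i (v (p m r)) * P.j (f m r) := fun m => hpf m _ _ _
    have e4 : G.mul (P.i.comp (G.mul u v h)) P.j (by rw [RingHom.comp_assoc, G.mul_δ₁, P.comm]) =
        G.mul (P.i.comp u) (G.mul (P.i.comp v) P.j hc) (by rw [G.mul_δ₀, h0]) := by
      rw [← G.assoc _ _ _ h0 hc]
      congr 1
      exact G.comp_mul _ _ _ _
    rw [e4, e2] at e1
    have e5 : ∑ z : J ⊕ R, P.i (Sum.elim
          (fun l => G.mul u v h (a' l) - ∑ m, u (a' m) * v (c m l))
          (fun r => - ∑ m, u (a' m) * ∑ q : Q m, v (p m q) * v (G.δ₁ (y ⟨m, q⟩ r))) z) *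
        P.j (Sum.elim e g z) = 0 := by
      rw [Fintype.sum_sum_type]
      simp only [Sum.elim_inl, Sum.elim_inr, map_sub, map_neg, sub_mul, neg_mul,
        Finset.sum_sub_distrib, Finset.sum_neg_distrib]
      rw [← e1, sub_add, sub_eq_zero, sub_neg_eq_add]
      have e6 : ∀ m, P.i (u (a' m)) * G.mul (P.i.comp v) P.j hc (e m) =
          (∑ l, P.i (u (a' m) * v (c m l)) * P.j (e l)) +
          ∑ r, P.i (u (a' m) * ∑ q : Q m, v (p m q) * v (G.δ₁ (y ⟨m, q⟩ r))) * P.j (g r) := by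
        intro m
        rw [e3 m]
        have : ∀ q : Q m, P.j (f m q) = ∑ l, P.i (v (G.δ₁ (x ⟨m, q⟩ l))) * P.j (e l) +
            ∑ r, P.i (v (G.δ₁ (y ⟨m, q⟩ r))) * P.j (g r) := by
          intro q
          rw [hxy ⟨m, q⟩]
          simp only [map_add, map_sum, _root_.map_mul, hs]
        simp only [this, c, map_sum, _root_.map_mul, Finset.mul_sum, Finset.sum_mul, mul_add,
          Finset.sum_add_distrib, mul_assoc]
        congr 1
        · exact Finset.sum_comm
        · exact Finset.sum_comm
      simp only [e6, Finset.sum_add_distrib, map_sum, Finset.sum_mul]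
      congr 1
      · exact Finset.sum_comm
      · exact Finset.sum_comm
    have e7 := P.indep_right _ _ hg e5
    intro l
    exact sub_eq_zero.mp (congrFun e7 (Sum.inl l))
  -- The same comparison on the other side: in the associativity law, now evaluated on `a'`, the
  -- first arrow is universal and the `a' m` are independent.
  have hmul : ∀ {T : Type u} [CommRing T] (u v : A →+* T) (h : u.comp G.δ₁ = v.comp G.δ₀),
      c.map (G.mul u v h) = c.map u * c.map v := by
    intro T _ v w h
    let P := kProduct G.δ₁ (v.comp G.δ₀)
    have hc : P.i.comp G.δ₁ = (P.j.comp v).comp G.δ₀ := P.comm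
    have h0 : (P.j.comp v).comp G.δ₁ = (P.j.comp w).comp G.δ₀ := by
      rw [RingHom.comp_assoc, h, RingHom.comp_assoc]
    have e1 := G.assoc P.i (P.j.comp v) (P.j.comp w) hc h0
    ext j l
    have e2 := RingHom.congr_fun e1 (a' l)
    rw [key, key] at e2
    simp only [key] at e2
    have e3 : ∑ m, P.i (a' m) * P.j (G.mul v w h (c m l) - ∑ r, v (c m r) * w (c r l)) = 0 := by
      simp only [map_sub, mul_sub, Finset.sum_sub_distrib]
      rw [sub_eq_zero]
      have e4 : ∀ m, P.j (G.mul v w h (c m l)) =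
          G.mul (P.j.comp v) (P.j.comp w) h0 (c m l) := fun m =>
        RingHom.congr_fun (G.comp_mul P.j v w h) (c m l)
      simp only [e4]
      rw [← e2]
      simp only [Finset.sum_mul, Finset.mul_sum, map_sum, RingHom.comp_apply, _root_.map_mul,
        mul_assoc]
      exact Finset.sum_comm
    have e4 := P.indep_left a' (fun m => G.mul v w h (c m l) - ∑ r, v (c m r) * w (c r l)) ha' e3
    exact sub_eq_zero.mp (congrFun e4 j)
  have hone : c.map G.ε = 1 := by
    ext j l
    have e1 : a' l = ∑ m, a' m * G.δ₁ (G.ε (c m l)) := by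
      have := key (RingHom.id A) ((RingHom.id A |>.comp G.δ₁).comp G.ε)
        (by rw [RingHom.comp_assoc _ G.ε, G.ε_δ₀, RingHom.comp_id]) l
      rw [G.mul_one] at this
      simpa using this
    have e2 : ∑ m, G.δ₁ (G.ε (c m l) - if m = l then 1 else 0) * a' m = 0 := by
      simp only [map_sub, sub_mul, Finset.sum_sub_distrib]
      rw [sub_eq_zero]
      have e3 : ∑ m, G.δ₁ (if m = l then 1 else 0) * a' m = a' l := by simp
      rw [e3]
      conv_rhs => rw [e1]
      exact Finset.sum_congr rfl fun m _ => mul_comm _ _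
    have := congrFun (ha' _ e2) j
    rw [Matrix.map_apply, sub_eq_zero.mp this, Matrix.one_apply]
  -- The right unit law writes `a` in terms of the `a' l`, and the left unit law writes each `a' l`
  -- in terms of the entries of `c`. This explains the values at identities as coefficients.
  refine ⟨J, ‹_›, inferInstance, c, ⟨hmul, hone⟩, fun l => G.ε (e l), fun m => G.ε (a' m), ?_⟩
  have e1 : a = ∑ l, a' l * G.δ₁ (G.ε (e l)) := by
    have := hae (RingHom.id A) ((RingHom.id A |>.comp G.δ₁).comp G.ε)
        (by rw [RingHom.comp_assoc _ G.ε, G.ε_δ₀, RingHom.comp_id])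
    rw [G.mul_one] at this
    simpa using this
  have e2 : ∀ l, a' l = ∑ m, G.δ₀ (G.ε (a' m)) * c m l := by
    intro l
    have := key ((RingHom.id A |>.comp G.δ₀).comp G.ε) (RingHom.id A)
        (by rw [RingHom.comp_assoc, G.ε_δ₁, RingHom.comp_id]) l
    rw [G.one_mul] at this
    simpa using this
  conv_lhs => rw [e1]
  refine Finset.sum_congr rfl fun l _ => ?_
  conv_lhs => rw [e2 l]
  rw [Finset.sum_mul]
  exact Finset.sum_congr rfl fun m _ => by ring

lemma IsRep.reindex {J J' : Type*} [Fintype J] [DecidableEq J] [Fintype J'] [DecidableEq J']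
    {c : Matrix J J A} (hc : G.IsRep c) (e : J' ≃ J) : G.IsRep (c.submatrix e e) where
  map_mul u v h := by
    have := congrArg (fun M => M.submatrix e e) (hc.map_mul u v h)
    simpa [← Matrix.submatrix_map, Matrix.submatrix_mul_equiv] using this
  map_one := by
    have := congrArg (fun M => M.submatrix e e) hc.map_one
    simpa [← Matrix.submatrix_map] using this

/-- The representations by matrices with rows indexed by `Fin n`. -/
structure Rep where
  /-- the dimension -/
  n : ℕ
  /-- the matrix -/
  c : Matrix (Fin n) (Fin n) A
  isRep : G.IsRep c

lemma exists_rep_fin (a : A) : ∃ (c : G.Rep) (x y : Fin c.n → K),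
    a = ∑ l, ∑ m, G.δ₁ (x l) * G.δ₀ (y m) * c.c m l := by
  classical
  obtain ⟨J, _, _, c, hc, x, y, h⟩ := G.exists_rep a
  let e : Fin (Fintype.card J) ≃ J := (Fintype.equivFin J).symm
  refine ⟨⟨_, _, hc.reindex G e⟩, x ∘ e, y ∘ e, ?_⟩
  rw [h, ← e.sum_comp]
  refine Finset.sum_congr rfl fun l _ => ?_
  rw [← e.sum_comp]
  rfl

end RingGroupoid

/-! ### Closed images of groups and torsors in products of general linear groups -/

section MatrixGroups

variable {K : Type u} [Field K] {S : Type u} {n : S → ℕ}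

/-- The points in a ring of a product of general linear groups. -/
abbrev GLs (n : S → ℕ) (Q : Type u) [CommRing Q] : Type u :=
  ∀ s, (Matrix (Fin (n s)) (Fin (n s)) Q)ˣ

/-- The indices of the entries of a family of matrices and of their inverses. -/
abbrev EntryIndex (n : S → ℕ) : Type u :=
  Σ s, (Fin (n s) × Fin (n s)) ⊕ (Fin (n s) × Fin (n s))

variable {Q Q' Q'' : Type u} [CommRing Q] [CommRing Q'] [CommRing Q'']

/-- Functoriality in the ring of the points of a product of general linear groups. -/
def mapGLs (φ : Q →+* Q') : GLs n Q →* GLs n Q' where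
  toFun g s := Units.map φ.mapMatrix.toMonoidHom (g s)
  map_one' := by ext; simp
  map_mul' g g' := by ext; simp

lemma mapGLs_comp (φ : Q →+* Q') (ψ : Q' →+* Q'') (g : GLs n Q) :
    mapGLs ψ (mapGLs φ g) = mapGLs (ψ.comp φ) g := by
  ext s i j
  rfl

lemma mapGLs_id (g : GLs n Q) : mapGLs (RingHom.id Q) g = g := by
  ext s i j
  rfl

/-- The entries of a family of matrices and of their inverses. -/
def entries (g : GLs n Q) : EntryIndex n → Q
  | ⟨s, Sum.inl p⟩ => (g s).val p.1 p.2
  | ⟨s, Sum.inr p⟩ => (g s).inv p.1 p.2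

lemma entries_map (φ : Q →+* Q') (g : GLs n Q) (p : EntryIndex n) :
    entries (mapGLs φ g) p = φ (entries g p) := by
  rcases p with ⟨s, p | p⟩ <;> rfl

/-- The value of a polynomial in the entries of a family of matrices and of their inverses. -/
def evGL (t : K →+* Q) (g : GLs n Q) : MvPolynomial (EntryIndex n) K →+* Q :=
  MvPolynomial.eval₂Hom t (entries g)

lemma evGL_comp (φ : Q →+* Q') (t : K →+* Q) (g : GLs n Q) (f : MvPolynomial (EntryIndex n) K) :
    φ (evGL t g f) = evGL (φ.comp t) (mapGLs φ g) f := by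
  rw [evGL, evGL, MvPolynomial.coe_eval₂Hom, MvPolynomial.coe_eval₂Hom, MvPolynomial.eval₂_comp_left]
  congr 1
  ext p
  exact (entries_map φ g p).symm

lemma evGL_X (t : K →+* Q) (g : GLs n Q) (p : EntryIndex n) :
    evGL t g (MvPolynomial.X p) = entries g p := by
  simp [evGL]

lemma evGL_C (t : K →+* Q) (g : GLs n Q) (x : K) : evGL t g (MvPolynomial.C x) = t x := by
  simp [evGL]

/-- Exchange of the entries of matrices and of their inverses. -/
def swapPoly : MvPolynomial (EntryIndex n) K →+* MvPolynomial (EntryIndex n) K :=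
  (MvPolynomial.rename fun p : EntryIndex n => ⟨p.1, p.2.swap⟩).toRingHom

lemma evGL_swap (t : K →+* Q) (g : GLs n Q) (f : MvPolynomial (EntryIndex n) K) :
    evGL t g (swapPoly f) = evGL t g⁻¹ f := by
  simp only [evGL, swapPoly, MvPolynomial.coe_eval₂Hom, AlgHom.toRingHom_eq_coe, RingHom.coe_coe,
    MvPolynomial.eval₂_rename]
  congr 1
  ext p
  rcases p with ⟨s, p | p⟩ <;> rfl

variable {H : Type u} [CommRing H]

/-- A point `g` of a product of general linear groups lies in the closed image of the point `w`:
the polynomials vanishing at `w` vanish at `g`. -/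
def InClosure (h : K →+* H) (w : GLs n H) (t : K →+* Q) (g : GLs n Q) : Prop :=
  ∀ f, evGL h w f = 0 → evGL t g f = 0

lemma InClosure.map {h : K →+* H} {w : GLs n H} {t : K →+* Q} {g : GLs n Q}
    (hg : InClosure h w t g) (φ : Q →+* Q') : InClosure h w (φ.comp t) (mapGLs φ g) := by
  intro f hf
  rw [← evGL_comp, hg f hf, map_zero]

lemma inClosure_self (h : K →+* H) (w : GLs n H) : InClosure h w h w := fun _ hf => hf

lemma InClosure.of_map {h : K →+* H} {w : GLs n H} {t : K →+* Q} {g : GLs n Q}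
    (φ : Q →+* Q') (hφ : Function.Injective φ) (hg : InClosure h w (φ.comp t) (mapGLs φ g)) :
    InClosure h w t g := by
  intro f hf
  apply hφ
  rw [evGL_comp, hg f hf, map_zero]

/-- The coordinate ring of the closed image of a point. -/
abbrev ClosureRing (h : K →+* H) (w : GLs n H) : Type u :=
  MvPolynomial (EntryIndex n) K ⧸ RingHom.ker (evGL h w)

/-- The inclusion of the coordinate ring of the closed image. -/
def closureIncl (h : K →+* H) (w : GLs n H) : ClosureRing h w →+* H :=
  RingHom.kerLift (evGL h w)

lemma closureIncl_injective (h : K →+* H) (w : GLs n H) :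
    Function.Injective (closureIncl h w) := RingHom.kerLift_injective _

lemma closureIncl_algebraMap (h : K →+* H) (w : GLs n H) :
    (closureIncl h w).comp (algebraMap K (ClosureRing h w)) = h := by
  ext x
  exact evGL_C h w x

/-- The universal point of the closed image. -/
def closurePoint (h : K →+* H) (w : GLs n H) : GLs n (ClosureRing h w) := fun s =>
  { val := Matrix.of fun i j => Ideal.Quotient.mk _ (MvPolynomial.X ⟨s, Sum.inl (i, j)⟩)
    inv := Matrix.of fun i j => Ideal.Quotient.mk _ (MvPolynomial.X ⟨s, Sum.inr (i, j)⟩)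
    val_inv := by
      apply Matrix.map_injective (closureIncl_injective h w)
      beta_reduce
      rw [Matrix.map_mul]
      refine Eq.trans ?_ ((w s).val_inv.trans (Matrix.map_one _ (map_zero _) (map_one _)).symm)
      congr 1 <;> ext i j <;> exact evGL_X h w _
    inv_val := by
      apply Matrix.map_injective (closureIncl_injective h w)
      beta_reduce
      rw [Matrix.map_mul]
      refine Eq.trans ?_ ((w s).inv_val.trans (Matrix.map_one _ (map_zero _) (map_one _)).symm)
      congr 1 <;> ext i j <;> exact evGL_X h w _ }

lemma entries_injective : Function.Injective (entries : GLs n Q → EntryIndex n → Q) := by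
  intro g g' h
  ext s i j
  exact congrFun h ⟨s, Sum.inl (i, j)⟩

lemma entries_closurePoint (h : K →+* H) (w : GLs n H) (p : EntryIndex n) :
    entries (closurePoint h w) p = Ideal.Quotient.mk _ (MvPolynomial.X p) := by
  rcases p with ⟨s, p | p⟩ <;> rfl

lemma mapGLs_closureIncl (h : K →+* H) (w : GLs n H) :
    mapGLs (closureIncl h w) (closurePoint h w) = w := by
  apply entries_injective
  ext p
  rw [entries_map, entries_closurePoint]
  exact evGL_X h w p

lemma evGL_closurePoint (h : K →+* H) (w : GLs n H) (f : MvPolynomial (EntryIndex n) K) :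
    evGL (algebraMap K (ClosureRing h w)) (closurePoint h w) f = Ideal.Quotient.mk _ f := by
  apply closureIncl_injective h w
  rw [evGL_comp, closureIncl_algebraMap, mapGLs_closureIncl]
  rfl

/-- The homomorphism on coordinate rings defined by a point of the closed image. -/
def InClosure.lift {h : K →+* H} {w : GLs n H} {t : K →+* Q} {g : GLs n Q}
    (hg : InClosure h w t g) : ClosureRing h w →+* Q :=
  Ideal.Quotient.lift _ (evGL t g) hg

lemma InClosure.lift_mk {h : K →+* H} {w : GLs n H} {t : K →+* Q} {g : GLs n Q}
    (hg : InClosure h w t g) (f) : hg.lift (Ideal.Quotient.mk _ f) = evGL t g f :=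
  Ideal.Quotient.lift_mk _ _ _

lemma InClosure.lift_algebraMap {h : K →+* H} {w : GLs n H} {t : K →+* Q} {g : GLs n Q}
    (hg : InClosure h w t g) : hg.lift.comp (algebraMap K _) = t := by
  ext x
  exact evGL_C t g x

lemma InClosure.mapGLs_lift {h : K →+* H} {w : GLs n H} {t : K →+* Q} {g : GLs n Q}
    (hg : InClosure h w t g) : mapGLs hg.lift (closurePoint h w) = g := by
  apply entries_injective
  ext p
  rw [entries_map, entries_closurePoint, hg.lift_mk, evGL_X]

lemma inClosure_of_hom {h : K →+* H} {w : GLs n H} {t : K →+* Q} (x : ClosureRing h w →+* Q)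
    (hx : x.comp (algebraMap K _) = t) : InClosure h w t (mapGLs x (closurePoint h w)) := by
  intro f hf
  rw [← hx, ← evGL_comp, evGL_closurePoint, Ideal.Quotient.eq_zero_iff_mem.mpr hf, map_zero]

/-- In a decomposition with independent right-hand factors, `β` keeps these independent, so the
vanishing of the image forces the left-hand factors to vanish. -/
lemma KProduct.injective_of_injective {B : Type u} [CommRing B] {t : K →+* Q} {b : K →+* B}
    {h : K →+* H} (P : KProduct t b) (P' : KProduct t h) (β : B →+* H) (hβ : Function.Injective β)
    (hb : β.comp b = h) (ψ : P.P →+* P'.P) (hi : ψ.comp P.i = P'.i) (hj : ψ.comp P.j = P'.j.comp β) :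
    Function.Injective ψ := by
  rw [injective_iff_map_eq_zero]
  intro z hz
  obtain ⟨J, _, a, e, ha, he, rfl⟩ := P.decomp z
  have h1 : ∑ l, P'.i (a l) * P'.j (β (e l)) = 0 := by
    rw [← hz, map_sum]
    refine Finset.sum_congr rfl fun l _ => ?_
    rw [map_mul, ← RingHom.comp_apply ψ, ← RingHom.comp_apply ψ, hi, hj, RingHom.comp_apply]
  have he' : IndepOver h (fun l => β (e l)) := by
    intro x hx
    apply he x
    apply hβ
    rw [map_zero, ← hx, map_sum]
    refine Finset.sum_congr rfl fun l _ => ?_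
    rw [map_mul, ← hb, RingHom.comp_apply]
  have h2 := P'.indep_right a _ he' h1
  simp [h2]

/-- Specialization: a polynomial relation satisfied by `g₁ w g₂`, for points `g₁` and `g₂` in `Q`,
is satisfied by `g₁ g g₂` for every point `g` of the closed image of `w`. -/
lemma InClosure.specialize {h : K →+* H} {w : GLs n H} {t : K →+* Q} {g : GLs n Q}
    (hg : InClosure h w t g) (P : KProduct t h) (g₁ g₂ : GLs n Q)
    (f : MvPolynomial (EntryIndex n) K)
    (hf : evGL (P.i.comp t) (mapGLs P.i g₁ * mapGLs P.j w * mapGLs P.i g₂) f = 0) :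
    evGL t (g₁ * g * g₂) f = 0 := by
  let b := algebraMap K (ClosureRing h w)
  let PB := kProduct t b
  obtain ⟨ψ, hi, hj⟩ := PB.exists_lift P.i (P.j.comp (closureIncl h w))
    (by rw [RingHom.comp_assoc, closureIncl_algebraMap, P.comm])
  -- The relation may be tested after the injection of `Q ⊗ ClosureRing` into `Q ⊗ H`. It therefore
  -- holds at the universal point of the closed image, and specializes to `g`.
  have hψ : Function.Injective ψ :=
    PB.injective_of_injective P (closureIncl h w) (closureIncl_injective h w)
      (closureIncl_algebraMap h w) ψ hi hj
  have hz : evGL (PB.i.comp t) (mapGLs PB.i g₁ * mapGLs PB.j (closurePoint h w) * mapGLs PB.i g₂) f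
      = 0 := by
    apply hψ
    rw [evGL_comp, map_mul, map_mul, mapGLs_comp, mapGLs_comp, mapGLs_comp, hi, hj,
      ← mapGLs_comp (closureIncl h w), mapGLs_closureIncl, ← RingHom.comp_assoc, hi, hf, map_zero]
  obtain ⟨φ, hφi, hφj⟩ := PB.exists_lift (RingHom.id Q) hg.lift
    (by rw [hg.lift_algebraMap, RingHom.id_comp])
  have := congrArg φ hz
  rwa [evGL_comp, map_mul, map_mul, mapGLs_comp, mapGLs_comp, mapGLs_comp, hφi, hφj,
    hg.mapGLs_lift, mapGLs_id, mapGLs_id, ← RingHom.comp_assoc, hφi, RingHom.id_comp,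
    map_zero] at this

/-- The family of matrices `w` defines a homomorphism from a group scheme with ring of
functions `H`. -/
structure IsGroupPoint (h : K →+* H) (w : GLs n H) : Prop where
  exists_mul : ∀ {T : Type u} [CommRing T] (d₁ d₂ : H →+* T), d₁.comp h = d₂.comp h →
    ∃ d : H →+* T, d.comp h = d₁.comp h ∧ mapGLs d w = mapGLs d₁ w * mapGLs d₂ w
  exists_one : ∃ d : H →+* K, d.comp h = RingHom.id K ∧ mapGLs d w = 1
  exists_inv : ∃ d : H →+* H, d.comp h = h ∧ mapGLs d w = w⁻¹

variable {h : K →+* H} {w : GLs n H}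

lemma IsGroupPoint.inv (hw : IsGroupPoint h w) {t : K →+* Q} {g : GLs n Q}
    (hg : InClosure h w t g) : InClosure h w t g⁻¹ := by
  intro f hf
  rw [← evGL_swap]
  apply hg
  rw [evGL_swap]
  obtain ⟨d, hd, hd1⟩ := hw.exists_inv
  have := congrArg d hf
  rwa [evGL_comp, hd, hd1, map_zero] at this

/-- Relations of `w` hold for a product of two universal points. The first factor is specialized to
`g`, then the second to `g'`. -/
lemma IsGroupPoint.mul (hw : IsGroupPoint h w) {t : K →+* Q} {g g' : GLs n Q}
    (hg : InClosure h w t g) (hg' : InClosure h w t g') : InClosure h w t (g * g') := by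
  intro f hf
  let P := kProduct t h
  have h1 : evGL (P.i.comp t) (mapGLs P.i g * mapGLs P.j w) f = 0 := by
    let P' := kProduct (P.i.comp t) h
    have := (hg.map P.i).specialize P' 1 (mapGLs P.j w) f (by
      rw [map_one, one_mul, mapGLs_comp]
      obtain ⟨d, hd, hdm⟩ := hw.exists_mul P'.j (P'.i.comp P.j)
        (by rw [← P'.comm, RingHom.comp_assoc, ← P.comm])
      rw [← hdm, P'.comm, ← hd, ← evGL_comp, hf, map_zero])
    rwa [one_mul] at this
  have := hg'.specialize P g 1 f (by rwa [map_one, mul_one])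
  rwa [mul_one] at this

/-- The family of matrices `y` defines an equivariant morphism from a torsor with ring of
functions `Q`. -/
structure IsTorsorPoint (h : K →+* H) (w : GLs n H) (q : K →+* Q) (y : GLs n Q) : Prop where
  exists_act : ∀ {T : Type u} [CommRing T] (d : H →+* T) (x : Q →+* T), d.comp h = x.comp q →
    ∃ x' : Q →+* T, x'.comp q = x.comp q ∧ mapGLs x' y = mapGLs d w * mapGLs x y
  exists_div : ∀ {T : Type u} [CommRing T] (x₁ x₂ : Q →+* T), x₁.comp q = x₂.comp q →
    ∃ d : H →+* T, d.comp h = x₁.comp q ∧ mapGLs d w = mapGLs x₁ y * (mapGLs x₂ y)⁻¹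

/-- The `K`-points of the closed image of a torsor. -/
def InTorsorClosure (h : K →+* H) (w : GLs n H) (q : K →+* Q) (y : GLs n Q) (g : GLs n K) : Prop :=
  InClosure h w q (mapGLs q g * y⁻¹)

variable {q : K →+* Q} {y : GLs n Q}

/-- The closed image of `y` is non-empty and of finite type, as `S` is finite, so it has a `K`-point
`x`; and `x y⁻¹` is a specialization of quotients of two points of the torsor, which come from the
group. -/
lemma IsTorsorPoint.exists_inTorsorClosure [IsAlgClosed K] [Nontrivial Q] [Finite S]
    (hy : IsTorsorPoint h w q y) : ∃ g, InTorsorClosure h w q y g := by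
  have : Nontrivial (ClosureRing q y) := (closureIncl q y).domain_nontrivial
  have : Algebra.FiniteType K (ClosureRing q y) :=
    Algebra.FiniteType.of_surjective (Ideal.Quotient.mkₐ K _) Ideal.Quotient.mk_surjective
  obtain ⟨x⟩ := exists_algHom_of_finiteType (K := K) (ClosureRing q y)
  have hx : InClosure q y (RingHom.id K) (mapGLs x.toRingHom (closurePoint q y)) :=
    inClosure_of_hom x.toRingHom (by ext z; simp)
  refine ⟨mapGLs x.toRingHom (closurePoint q y), fun f hf => ?_⟩
  have hx' := hx.map q
  rw [RingHom.comp_id] at hx'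
  let P := kProduct q q
  have := hx'.specialize P 1 y⁻¹ f (by
    rw [map_one, one_mul, map_inv]
    obtain ⟨d, hd, hdm⟩ := hy.exists_div P.j P.i P.comm.symm
    rw [← hdm, P.comm, ← hd, ← evGL_comp, hf, map_zero])
  rwa [one_mul] at this

/-- Write `g = (g y⁻¹) y` and specialize the action `w y` of the group, which satisfies all the
relations of `y`. -/
lemma IsTorsorPoint.evGL_eq_zero [Nontrivial Q] (hy : IsTorsorPoint h w q y) {g : GLs n K}
    (hg : InTorsorClosure h w q y g) (f : MvPolynomial (EntryIndex n) K) (hf : evGL q y f = 0) :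
    evGL (RingHom.id K) g f = 0 := by
  let P := kProduct q h
  have := InClosure.specialize hg P 1 y f (by
    rw [map_one, one_mul]
    obtain ⟨x, hx, hxm⟩ := hy.exists_act P.j P.i P.comm.symm
    rw [← hxm, ← hx, ← evGL_comp, hf, map_zero])
  rw [one_mul, inv_mul_cancel_right] at this
  apply q.injective
  rw [evGL_comp, RingHom.comp_id, this, map_zero]

/-- The components of a family of matrices with indices in the image of `r`. -/
def restrGLs {S₀ : Type u} (r : S₀ → S) : GLs n Q →* GLs (n ∘ r) Q where
  toFun g s := g (r s)
  map_one' := rfl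
  map_mul' _ _ := rfl

lemma mapGLs_restrGLs {S₀ : Type u} (r : S₀ → S) (φ : Q →+* Q') (g : GLs n Q) :
    mapGLs φ (restrGLs r g) = restrGLs r (mapGLs φ g) := rfl

/-- The inclusion of the indices of the entries of the components. -/
def entryIndexMap {S₀ : Type u} (r : S₀ → S) (p : EntryIndex (n ∘ r)) : EntryIndex n := ⟨r p.1, p.2⟩

lemma entries_restrGLs {S₀ : Type u} (r : S₀ → S) (g : GLs n Q) (p : EntryIndex (n ∘ r)) :
    entries (restrGLs r g) p = entries g (entryIndexMap r p) := by
  rcases p with ⟨s, p | p⟩ <;> rfl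

lemma evGL_restrGLs {S₀ : Type u} (r : S₀ → S) (t : K →+* Q) (g : GLs n Q) (f) :
    evGL t (restrGLs r g) f = evGL t g (MvPolynomial.rename (entryIndexMap r) f) := by
  simp only [evGL, MvPolynomial.coe_eval₂Hom, MvPolynomial.eval₂_rename]
  congr 1
  ext p
  exact entries_restrGLs r g p

lemma InClosure.restr {S₀ : Type u} (r : S₀ → S) {t : K →+* Q} {g : GLs n Q}
    (hg : InClosure h w t g) : InClosure h (restrGLs r w) t (restrGLs r g) := by
  intro f hf
  rw [evGL_restrGLs] at hf ⊢
  exact hg _ hf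

lemma IsGroupPoint.restr {S₀ : Type u} (r : S₀ → S) (hw : IsGroupPoint h w) :
    IsGroupPoint h (restrGLs r w) where
  exists_mul d₁ d₂ hd := by
    obtain ⟨d, hd, hdm⟩ := hw.exists_mul d₁ d₂ hd
    exact ⟨d, hd, by simp only [mapGLs_restrGLs, hdm, map_mul]⟩
  exists_one := by
    obtain ⟨d, hd, hdm⟩ := hw.exists_one
    exact ⟨d, hd, by simp only [mapGLs_restrGLs, hdm, map_one]⟩
  exists_inv := by
    obtain ⟨d, hd, hdm⟩ := hw.exists_inv
    exact ⟨d, hd, by simp only [mapGLs_restrGLs, hdm, map_inv]⟩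

/-- A projection between closed images of a group scheme is surjective on `K`-points. -/
lemma IsGroupPoint.exists_restrGLs_eq [IsAlgClosed K] [Finite S] {S₀ : Type u} [Finite S₀]
    (r : S₀ → S) (hw : IsGroupPoint h w) (g : GLs (n ∘ r) K)
    (hg : InClosure h (restrGLs r w) (RingHom.id K) g) :
    ∃ g' : GLs n K, InClosure h w (RingHom.id K) g' ∧ restrGLs r g' = g := by
  have hw₀ := hw.restr r
  have : Nontrivial H := hw.exists_one.choose.domain_nontrivial
  let B₀ := ClosureRing h (restrGLs r w)
  let B₁ := ClosureRing h w
  have : Nontrivial B₀ := (closureIncl h (restrGLs r w)).domain_nontrivial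
  have : Algebra.FiniteType K B₀ :=
    Algebra.FiniteType.of_surjective (Ideal.Quotient.mkₐ K _) Ideal.Quotient.mk_surjective
  have : Algebra.FiniteType K B₁ :=
    Algebra.FiniteType.of_surjective (Ideal.Quotient.mkₐ K _) Ideal.Quotient.mk_surjective
  let φ : B₀ →ₐ[K] B₁ := Ideal.quotientMapₐ _ (MvPolynomial.rename (entryIndexMap r)) (by
    intro f hf
    change evGL h w _ = 0
    exact (evGL_restrGLs r h w f).symm.trans hf)
  have hφmk : ∀ f, φ (Ideal.Quotient.mk _ f) =
      Ideal.Quotient.mk _ (MvPolynomial.rename (entryIndexMap r) f) := fun f => rfl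
  -- The projection of closed images is dominant, so its image `L` on `K`-points contains all the
  -- points where some non-nilpotent `f₀` does not vanish.
  have hφ : Function.Injective φ := by
    rw [injective_iff_map_eq_zero]
    intro z hz
    obtain ⟨f, rfl⟩ := Ideal.Quotient.mk_surjective z
    rw [hφmk, Ideal.Quotient.eq_zero_iff_mem] at hz
    rw [Ideal.Quotient.eq_zero_iff_mem]
    exact (evGL_restrGLs r h w f).trans hz
  obtain ⟨b, hb, hlift⟩ := exists_forall_extend φ hφ
  obtain ⟨f₀, rfl⟩ := Ideal.Quotient.mk_surjective b
  let L : Set (GLs (n ∘ r) K) :=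
    {z | ∃ z' : GLs n K, InClosure h w (RingHom.id K) z' ∧ restrGLs r z' = z}
  have hL : ∀ z, InClosure h (restrGLs r w) (RingHom.id K) z → evGL (RingHom.id K) z f₀ ≠ 0 →
      z ∈ L := by
    intro z hz hne
    let x : B₀ →ₐ[K] K := { hz.lift with
      commutes' := fun a => RingHom.congr_fun hz.lift_algebraMap a }
    obtain ⟨y, hy⟩ := hlift x hne
    refine ⟨mapGLs y.toRingHom (closurePoint h w),
      inClosure_of_hom y.toRingHom (by ext a; simp), ?_⟩
    apply entries_injective
    ext p
    rw [entries_restrGLs, entries_map, entries_closurePoint]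
    have h1 := DFunLike.congr_fun hy (Ideal.Quotient.mk _ (MvPolynomial.X p))
    rw [AlgHom.comp_apply, hφmk, MvPolynomial.rename_X] at h1
    exact h1.trans (evGL_X (RingHom.id K) z p)
  by_contra hgL
  have hgL : g ∉ L := hgL
  -- As `L` consists of images of a group of points, a point of `g⁻¹ L` in this open subset would
  -- express `g` through points of `L`.
  have hz : ∀ z' : GLs n K, InClosure h w (RingHom.id K) z' →
      evGL (RingHom.id K) (g⁻¹ * restrGLs r z') f₀ = 0 := by
    intro z' hz'
    by_contra hne
    obtain ⟨u, hu, hur⟩ := hL _ (hw₀.mul (hw₀.inv hg) (hz'.restr r)) hne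
    exact hgL ⟨z' * u⁻¹, hw.mul hz' (hw.inv hu), by rw [map_mul, map_inv, hur]; group⟩
  let β : B₁ := evGL (algebraMap K B₁)
    (mapGLs (algebraMap K B₁) g⁻¹ * restrGLs r (closurePoint h w)) f₀
  -- `β` is the function `z' ↦ f₀ (g⁻¹ z')` on the larger closed image. It vanishes at all
  -- `K`-points, and the Nullstellensatz applies.
  have hβ : IsNilpotent β := by
    apply isNilpotent_of_forall_algHom (K := K)
    intro y
    have hy : y.toRingHom.comp (algebraMap K B₁) = RingHom.id K := by ext a; simp
    have := hz _ (inClosure_of_hom y.toRingHom hy)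
    rw [← this]
    change y.toRingHom β = _
    rw [evGL_comp, hy, map_mul, mapGLs_comp, hy, mapGLs_id]
    rfl
  obtain ⟨m, hm⟩ := hβ
  have h1 : evGL h (mapGLs h g⁻¹ * restrGLs r w) (f₀ ^ m) = 0 := by
    have := congrArg (closureIncl h w) hm
    rw [map_pow, evGL_comp, closureIncl_algebraMap, map_mul, mapGLs_comp, closureIncl_algebraMap,
      mapGLs_restrGLs, mapGLs_closureIncl, map_zero] at this
    rw [map_pow, this]
  have hgw : InClosure h (restrGLs r w) h (mapGLs h g * restrGLs r w) := by
    have := hg.map h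
    rw [RingHom.comp_id] at this
    exact hw₀.mul this (inClosure_self _ _)
  let P := kProduct h h
  -- Translation by `g`: replacing `w` by the point `g w` of the closed image turns the relation for
  -- `g⁻¹ w` into `f₀ ^ m = 0` at `w`, which contradicts the choice of `f₀`.
  have h2 := hgw.specialize P (mapGLs h g⁻¹) 1 (f₀ ^ m) (by
    have := congrArg P.j h1
    rw [evGL_comp, map_mul, mapGLs_comp, ← P.comm, map_zero] at this
    rw [map_one, mul_one, mapGLs_comp, this])
  rw [mul_one, ← mul_assoc, ← map_mul, inv_mul_cancel, map_one, one_mul] at h2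
  refine hb ⟨m, ?_⟩
  rw [← map_pow]
  exact Ideal.Quotient.eq_zero_iff_mem.mpr h2

/-- Reduction to the group: with any `K`-point `g₀` of the large closed image, `g` differs from the
image of `g₀` by a point of the closed image of the group, and this point lifts. -/
lemma IsTorsorPoint.exists_restrGLs_eq [IsAlgClosed K] [Nontrivial Q] [Finite S] {S₀ : Type u}
    [Finite S₀] (r : S₀ → S) (hw : IsGroupPoint h w) (hy : IsTorsorPoint h w q y)
    (g : GLs (n ∘ r) K) (hg : InTorsorClosure h (restrGLs r w) q (restrGLs r y) g) :
    ∃ g' : GLs n K, InTorsorClosure h w q y g' ∧ restrGLs r g' = g := by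
  have hw₀ := hw.restr r
  obtain ⟨g₀, hg₀⟩ := hy.exists_inTorsorClosure
  have h₀ := InClosure.restr r hg₀
  have h₁ : InClosure h (restrGLs r w) (RingHom.id K) (g * (restrGLs r g₀)⁻¹) := by
    apply InClosure.of_map q q.injective
    have := hw₀.mul hg (hw₀.inv h₀)
    rw [RingHom.comp_id]
    convert this using 1
    simp only [map_mul, map_inv, mapGLs_restrGLs]
    group
  obtain ⟨u, hu, hur⟩ := hw.exists_restrGLs_eq r _ h₁
  refine ⟨u * g₀, ?_, by rw [map_mul, hur, inv_mul_cancel_right]⟩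
  have := hw.mul (hu.map q) hg₀
  rw [InTorsorClosure, map_mul, mul_assoc]
  exact this

/-- The fibre of a torsor above a `K`-point of its closed image is nonempty. -/
lemma IsTorsorPoint.sum_ne_one [IsAlgClosed K] [Nontrivial Q] [Finite S] {S₀ : Type u}
    [Fintype S₀] (r : S₀ → S) (hw : IsGroupPoint h w) (hy : IsTorsorPoint h w q y)
    (g : GLs (n ∘ r) K) (hg : InTorsorClosure h (restrGLs r w) q (restrGLs r y) g)
    (F : EntryIndex (n ∘ r) → MvPolynomial (EntryIndex n) K) :
    ∑ p, (entries (restrGLs r y) p - q (entries g p)) * evGL q y (F p) ≠ 1 := by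
  intro h1
  -- The relation is polynomial in `y`, so it also holds at a lift `g'` of `g`, where every factor
  -- vanishes and it reads `0 = 1`.
  obtain ⟨g', hg', rfl⟩ := hy.exists_restrGLs_eq r hw g hg
  have h2 := hy.evGL_eq_zero hg' (1 - ∑ p : EntryIndex (n ∘ r),
    (MvPolynomial.X (entryIndexMap r p) - MvPolynomial.C (entries (restrGLs r g') p)) * F p) (by
    simp only [map_sub, map_one, map_sum, map_mul, evGL_X, evGL_C]
    rw [← h1, sub_eq_zero]
    simp only [entries_restrGLs])
  simp [map_sub, map_one, map_sum, map_mul, evGL_X, evGL_C, entries_restrGLs] at h2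

end MatrixGroups

/-! ### The Krull topology of the Galois group -/

section Gal

variable {k K : Type u} [Field k] [Field K] [Algebra k K]

/-- The finite set is a basis over `k` of a finite subextension whose fixing subgroup, translated by
`σ`, lies in `V`. -/
lemma exists_finset_of_mem_nhds [Algebra.IsAlgebraic k K] {σ : Gal(K/k)} {V : Set Gal(K/k)}
    (hV : V ∈ 𝓝 σ) : ∃ s : Finset K, ∀ σ' : Gal(K/k), (∀ x ∈ s, σ' x = σ x) → σ' ∈ V := by
  have h1 : (fun τ => σ * τ) ⁻¹' V ∈ 𝓝 (1 : Gal(K/k)) := by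
    apply (continuous_const_mul σ).continuousAt.preimage_mem_nhds
    simpa using hV
  obtain ⟨L, hL, hLV⟩ := (krullTopology_mem_nhds_one_iff k K _).mp h1
  let b := Module.finBasis k L
  classical
  refine ⟨Finset.univ.image fun i => (b i : K), fun σ' hσ' => ?_⟩
  have h2 : σ⁻¹ * σ' ∈ L.fixingSubgroup := by
    rw [IntermediateField.mem_fixingSubgroup_iff]
    intro x hx
    have h3 : σ' x = σ x := by
      have h4 := congrArg (fun z : L => (z : K)) (b.sum_repr ⟨x, hx⟩)
      simp only [AddSubmonoidClass.coe_finsetSum, IntermediateField.coe_smul] at h4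
      rw [← h4, map_sum, map_sum]
      refine Finset.sum_congr rfl fun i _ => ?_
      rw [map_smul, map_smul, hσ' _ (Finset.mem_image_of_mem _ (Finset.mem_univ i))]
    change σ⁻¹ (σ' x) = x
    rw [h3]
    exact σ.symm_apply_apply x
  have := hLV h2
  simpa using this

lemma isLocallyConstant_gal_apply [Algebra.IsAlgebraic k K] (x : K) :
    IsLocallyConstant fun σ : Gal(K/k) => σ x := by
  rw [IsLocallyConstant.iff_eventually_eq]
  intro σ
  let L : IntermediateField k K := IntermediateField.adjoin k {x}
  have hL : FiniteDimensional k L :=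
    IntermediateField.adjoin.finiteDimensional (Algebra.IsIntegral.isIntegral x)
  have h1 : (L.fixingSubgroup : Set Gal(K/k)) ∈ 𝓝 1 :=
    (krullTopology_mem_nhds_one_iff k K _).mpr ⟨L, hL, subset_rfl⟩
  have h2 : (fun τ => σ⁻¹ * τ) ⁻¹' (L.fixingSubgroup : Set Gal(K/k)) ∈ 𝓝 σ := by
    apply (continuous_const_mul σ⁻¹).continuousAt.preimage_mem_nhds
    simpa using h1
  filter_upwards [h2] with τ hτ
  have := (IntermediateField.mem_fixingSubgroup_iff L _).mp hτ x
    (IntermediateField.mem_adjoin_simple_self k x)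
  have h3 : σ (σ⁻¹ (τ x)) = σ x := congrArg σ this
  rwa [show σ (σ⁻¹ (τ x)) = τ x from σ.apply_symm_apply _] at h3

lemma eventually_forall_finset_eq [Algebra.IsAlgebraic k K] (σ : Gal(K/k)) (s : Finset K) :
    ∀ᶠ σ' in 𝓝 σ, ∀ x ∈ s, σ' x = σ x := by
  rw [Filter.eventually_all_finset]
  exact fun x _ => (IsLocallyConstant.iff_eventually_eq _).mp (isLocallyConstant_gal_apply x) σ

lemma continuous_gal_iff [Algebra.IsAlgebraic k K] {X : Type*} [TopologicalSpace X]
    (f : X → Gal(K/k)) : Continuous f ↔ ∀ x : K, IsLocallyConstant fun t => f t x := by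
  refine ⟨fun hf x => (isLocallyConstant_gal_apply x).comp_continuous hf, fun h => ?_⟩
  rw [continuous_iff_continuousAt]
  intro t V hV
  obtain ⟨s, hs⟩ := exists_finset_of_mem_nhds hV
  have h1 : ∀ᶠ t' in 𝓝 t, ∀ x ∈ s, f t' x = f t x := by
    rw [Filter.eventually_all_finset]
    exact fun x _ => (IsLocallyConstant.iff_eventually_eq _).mp (h x) t
  exact h1.mono fun t' ht' => hs _ ht'

variable {A : Type u} [CommRing A] (δ₀ δ₁ : K →+* A)

/-- The function `g` on the Galois group is induced by the element `a` of the ring generated by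
`δ₀` and `δ₁`. -/
def IsInducedBy (g : Gal(K/k) → K) (a : A) : Prop :=
  a ∈ Subring.closure (Set.range δ₀ ∪ Set.range δ₁) ∧
  ∀ {T : Type u} [CommRing T] (u : A →+* T) (σ : Gal(K/k)),
    u.comp δ₁ = (u.comp δ₀).comp (σ : K →+* K) → u a = u (δ₀ (g σ))

variable {δ₀ δ₁}

lemma isInducedBy_const (x : K) : IsInducedBy δ₀ δ₁ (fun _ : Gal(K/k) => x) (δ₀ x) :=
  ⟨Subring.subset_closure (Or.inl ⟨x, rfl⟩), fun _ _ _ => rfl⟩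

lemma isInducedBy_apply (x : K) : IsInducedBy δ₀ δ₁ (fun σ : Gal(K/k) => σ x) (δ₁ x) :=
  ⟨Subring.subset_closure (Or.inr ⟨x, rfl⟩), fun _ _ h => RingHom.congr_fun h x⟩

lemma IsInducedBy.sub {g g' : Gal(K/k) → K} {a a' : A} (h : IsInducedBy δ₀ δ₁ g a)
    (h' : IsInducedBy δ₀ δ₁ g' a') : IsInducedBy δ₀ δ₁ (g - g') (a - a') :=
  ⟨Subring.sub_mem _ h.1 h'.1, fun u σ hu => by
    simp only [map_sub, h.2 u σ hu, h'.2 u σ hu, Pi.sub_apply]⟩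

lemma IsInducedBy.add {g g' : Gal(K/k) → K} {a a' : A} (h : IsInducedBy δ₀ δ₁ g a)
    (h' : IsInducedBy δ₀ δ₁ g' a') : IsInducedBy δ₀ δ₁ (g + g') (a + a') :=
  ⟨Subring.add_mem _ h.1 h'.1, fun u σ hu => by
    simp only [map_add, h.2 u σ hu, h'.2 u σ hu, Pi.add_apply]⟩

lemma IsInducedBy.mul {g g' : Gal(K/k) → K} {a a' : A} (h : IsInducedBy δ₀ δ₁ g a)
    (h' : IsInducedBy δ₀ δ₁ g' a') : IsInducedBy δ₀ δ₁ (g * g') (a * a') :=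
  ⟨Subring.mul_mem _ h.1 h'.1, fun u σ hu => by
    simp only [map_mul, h.2 u σ hu, h'.2 u σ hu, Pi.mul_apply]⟩

lemma exists_isInducedBy_prod {X : Type*} (s : Finset X) (g : X → Gal(K/k) → K)
    (h : ∀ x ∈ s, ∃ a : A, IsInducedBy δ₀ δ₁ (g x) a) :
    ∃ a : A, IsInducedBy δ₀ δ₁ (fun σ => ∏ x ∈ s, g x σ) a := by
  classical
  induction s using Finset.induction_on with
  | empty => exact ⟨δ₀ 1, by
    simpa only [Finset.prod_empty] using isInducedBy_const (k := k) (δ₀ := δ₀) (δ₁ := δ₁) 1⟩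
  | insert x s hx ih =>
    obtain ⟨a, ha⟩ := h x (Finset.mem_insert_self x s)
    obtain ⟨b, hb⟩ := ih fun y hy => h y (Finset.mem_insert_of_mem hy)
    refine ⟨a * b, ?_⟩
    simp only [Finset.prod_insert hx]
    exact ha.mul hb

open Classical in
-- Lagrange interpolation on the conjugates of `x`: the product of `(σ' x - β) / (σ x - β)` over the
-- conjugates `β ≠ σ x`.
lemma exists_isInducedBy_indicator [Normal k K] (σ : Gal(K/k)) (x : K) :
    ∃ a : A, IsInducedBy δ₀ δ₁ (fun σ' : Gal(K/k) => if σ' x = σ x then 1 else 0) a := by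
  let R := ((minpoly k x).aroots K).toFinset.erase (σ x)
  have hroot : ∀ σ' : Gal(K/k), σ' x ∈ ((minpoly k x).aroots K).toFinset := by
    intro σ'
    rw [Multiset.mem_toFinset, Polynomial.mem_aroots]
    refine ⟨minpoly.ne_zero (Normal.isIntegral ‹_› x), ?_⟩
    have := congrArg σ' (minpoly.aeval k x)
    rw [map_zero] at this
    rw [← this]
    exact (Polynomial.aeval_algHom_apply (σ' : K →ₐ[k] K) x _)
  obtain ⟨a, ha⟩ := exists_isInducedBy_prod (δ₀ := δ₀) (δ₁ := δ₁) R
    (fun β => fun σ' : Gal(K/k) => (σ' x - β) * (σ x - β)⁻¹)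
    (fun β _ => ⟨_, ((isInducedBy_apply x).sub (isInducedBy_const β)).mul
      (isInducedBy_const (σ x - β)⁻¹)⟩)
  refine ⟨a, ?_⟩
  convert ha using 2 with σ'
  split_ifs with h
  · rw [h]
    refine (Finset.prod_eq_one fun β hβ => mul_inv_cancel₀ ?_).symm
    exact sub_ne_zero.mpr (Finset.ne_of_mem_erase hβ).symm
  · refine (Finset.prod_eq_zero (Finset.mem_erase.mpr ⟨h, hroot σ'⟩) ?_).symm
    rw [sub_self, zero_mul]

/-- Locally constant functions on the Galois group are induced by elements of the tensor product
`K ⊗ K`. -/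
lemma exists_isInducedBy [IsGalois k K] (g : Gal(K/k) → K) (hg : IsLocallyConstant g) :
    ∃ a : A, IsInducedBy δ₀ δ₁ g a := by
  classical
  have hU : ∀ σ : Gal(K/k), ∃ s : Finset K, ∀ σ' : Gal(K/k), (∀ x ∈ s, σ' x = σ x) →
      g σ' = g σ := fun σ =>
    exists_finset_of_mem_nhds ((IsLocallyConstant.iff_eventually_eq g).mp hg σ)
  choose s hs using hU
  let U (σ : Gal(K/k)) : Set Gal(K/k) := {σ' | ∀ x ∈ s σ, σ' x = σ x}
  have hUo : ∀ σ, IsOpen (U σ) := by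
    intro σ
    rw [isOpen_iff_mem_nhds]
    intro σ' hσ'
    filter_upwards [eventually_forall_finset_eq σ' (s σ)] with τ hτ x hx
    rw [hτ x hx, hσ' x hx]
  have hind : ∀ σ, ∃ a : A, IsInducedBy δ₀ δ₁ (fun σ' : Gal(K/k) => if σ' ∈ U σ then 1 else 0)
      a := by
    intro σ
    obtain ⟨a, ha⟩ := exists_isInducedBy_prod (δ₀ := δ₀) (δ₁ := δ₁) (s σ)
      (fun x => fun σ' : Gal(K/k) => if σ' x = σ x then 1 else 0)
      (fun x _ => exists_isInducedBy_indicator σ x)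
    refine ⟨a, ?_⟩
    convert ha using 2 with σ'
    rw [Finset.prod_ite_zero]
    simp [U]
  suffices H : ∀ t : Finset Gal(K/k), ∃ (g' : Gal(K/k) → K) (a : A), IsInducedBy δ₀ δ₁ g' a ∧
      ∀ σ' ∈ ⋃ σ ∈ t, U σ, g' σ' = g σ' by
    obtain ⟨t, ht⟩ := isCompact_univ.elim_finite_subcover U hUo
      (fun σ _ => Set.mem_iUnion.mpr ⟨σ, fun _ _ => rfl⟩)
    obtain ⟨g', a, ha, h⟩ := H t
    obtain rfl : g' = g := funext fun σ => h σ (ht (Set.mem_univ σ))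
    exact ⟨a, ha⟩
  intro t
  induction t using Finset.induction_on with
  | empty => exact ⟨_, _, isInducedBy_const 0, by simp⟩
  | insert σ t _ ih =>
    obtain ⟨g', a, ha, hg'⟩ := ih
    obtain ⟨b, hb⟩ := hind σ
    -- With `b` the indicator of `U σ`, the new function is `b · g σ + (1 - b) · g'`: the value `g
    -- σ` on `U σ` and the previous one elsewhere.
    refine ⟨_, _, (hb.mul (isInducedBy_const (g σ))).add
      (((isInducedBy_const 1).sub hb).mul ha), fun σ' hσ' => ?_⟩
    by_cases h : σ' ∈ U σ
    · simp [h, hs σ σ' h]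
    · simp only [Finset.set_biUnion_insert, Set.mem_union, h, false_or] at hσ'
      simp [h, hg' σ' hσ']

end Gal

namespace RingGroupoid

variable {K A : Type u} [Field K] [CommRing A] (G : RingGroupoid K A)

/-! ### Existence of sections -/

section RepPoint

variable {G} {S : Type u} (c : S → G.Rep) {T T' : Type u} [CommRing T] [CommRing T']

/-- The dimensions of a family of representations. -/
abbrev repDim (c : S → G.Rep) : S → ℕ := fun s => (c s).n

/-- The value at a point of a family of representations. -/
def repPoint (u : A →+* T) : GLs (repDim c) T := fun s =>
  { val := (c s).c.map u
    inv := (c s).c.map (u.comp G.inv)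
    val_inv := by
      rw [← (c s).isRep.map_mul u (u.comp G.inv) (by rw [RingHom.comp_assoc, G.inv_δ₀]), G.mul_inv]
      have := congrArg (fun M => M.map (u.comp G.δ₀)) (c s).isRep.map_one
      simpa [Matrix.map_map, Matrix.map_one] using this
    inv_val := by
      rw [← (c s).isRep.map_mul (u.comp G.inv) u (by rw [RingHom.comp_assoc, G.inv_δ₁]), G.inv_mul]
      have := congrArg (fun M => M.map (u.comp G.δ₁)) (c s).isRep.map_one
      simpa [Matrix.map_map, Matrix.map_one] using this }

lemma repPoint_mul (u v : A →+* T) (h : u.comp G.δ₁ = v.comp G.δ₀) :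
    repPoint c (G.mul u v h) = repPoint c u * repPoint c v := by
  ext s : 2
  exact (c s).isRep.map_mul u v h

lemma repPoint_inv (u : A →+* T) : repPoint c (u.comp G.inv) = (repPoint c u)⁻¹ := by
  ext s : 2
  rfl

lemma repPoint_ε (t : K →+* T) : repPoint c (t.comp G.ε) = 1 := by
  ext s : 2
  have := congrArg (fun M => M.map t) (c s).isRep.map_one
  simpa [Matrix.map_map, Matrix.map_one, repPoint] using this

lemma mapGLs_repPoint (φ : T →+* T') (u : A →+* T) :
    mapGLs φ (repPoint c u) = repPoint c (φ.comp u) := by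
  ext s : 2
  rfl

end RepPoint

/-- The points of the subgroup of the diagonal defined by the ideal `I`. -/
def IsSubPoint (I : Ideal A) {T : Type u} [CommRing T] (d : A →+* T) : Prop :=
  d.comp G.δ₀ = d.comp G.δ₁ ∧ ∀ a ∈ I, d a = 0

variable {k : Type u} [Field k] [Algebra k K]

/-- The ideal of the fibre above an element of the Galois group. -/
def fibreIdeal (σ : Gal(K/k)) : Ideal A :=
  Ideal.span (Set.range fun x => G.δ₁ x - G.δ₀ (σ x))

variable (k) in
/-- The ideals `I` and `J` define a closed subgroup `D` of the diagonal and a closed subscheme of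
the groupoid which is a torsor under `D` above each element of the Galois group. -/
structure IsReduction (I J : Ideal A) : Prop where
  one : ∀ a ∈ I, G.ε a = 0
  mul : ∀ {T : Type u} [CommRing T] (d d' : A →+* T) (h : d.comp G.δ₁ = d'.comp G.δ₀),
    G.IsSubPoint I d → G.IsSubPoint I d' → G.IsSubPoint I (G.mul d d' h)
  inv : ∀ {T : Type u} [CommRing T] (d : A →+* T),
    G.IsSubPoint I d → G.IsSubPoint I (d.comp G.inv)
  act : ∀ {T : Type u} [CommRing T] (d y : A →+* T) (h : d.comp G.δ₁ = y.comp G.δ₀),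
    G.IsSubPoint I d → (∀ a ∈ J, y a = 0) → ∀ a ∈ J, G.mul d y h a = 0
  div : ∀ {T : Type u} [CommRing T] (y y' : A →+* T), y.comp G.δ₀ = y'.comp G.δ₀ →
    ∀ h : y.comp G.δ₁ = y'.comp G.δ₁, (∀ a ∈ J, y a = 0) → (∀ a ∈ J, y' a = 0) →
    G.IsSubPoint I (G.mul y (y'.comp G.inv) (by rw [RingHom.comp_assoc, G.inv_δ₀, h]))
  ne_top : ∀ σ : Gal(K/k), J ⊔ G.fibreIdeal σ ≠ ⊤

lemma mul_comp_δ₀_eq {T : Type u} [CommRing T] (u v : A →+* T) (h : u.comp G.δ₁ = v.comp G.δ₀)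
    (hu : u.comp G.δ₀ = u.comp G.δ₁) : (G.mul u v h).comp G.δ₀ = v.comp G.δ₀ := by
  rw [G.mul_δ₀, hu, h]

/-- The whole diagonal and the whole groupoid, from which Zorn's lemma starts. -/
lemma isReduction_bot (hne : ∀ σ : Gal(K/k), G.fibreIdeal σ ≠ ⊤) : G.IsReduction k ⊥ ⊥ where
  one a ha := by rw [Ideal.mem_bot.mp ha, map_zero]
  mul d d' h hd hd' := ⟨by rw [G.mul_δ₀, G.mul_δ₁, hd.1, h, hd'.1],
    fun a ha => by rw [Ideal.mem_bot.mp ha, map_zero]⟩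
  inv d hd := ⟨by rw [RingHom.comp_assoc, RingHom.comp_assoc, G.inv_δ₀, G.inv_δ₁, hd.1],
    fun a ha => by rw [Ideal.mem_bot.mp ha, map_zero]⟩
  act d y h _ _ a ha := by rw [Ideal.mem_bot.mp ha, map_zero]
  div y y' h₀ h _ _ := ⟨by
      rw [G.mul_δ₀, G.mul_δ₁, RingHom.comp_assoc, G.inv_δ₁, h₀],
    fun a ha => by rw [Ideal.mem_bot.mp ha, map_zero]⟩
  ne_top σ := by rw [bot_sup_eq]; exact hne σ

lemma exists_maximal_isReduction (hne : ∀ σ : Gal(K/k), G.fibreIdeal σ ≠ ⊤) :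
    ∃ I J : Ideal A, G.IsReduction k I J ∧
      ∀ I' J' : Ideal A, G.IsReduction k I' J' → I ≤ I' → J ≤ J' → J' = J := by
  obtain ⟨m, -, hm⟩ := zorn_le_nonempty₀ {p : Ideal A × Ideal A | G.IsReduction k p.1 p.2}
    (fun C hC hchain p₀ hp₀ => by
      have hdir : DirectedOn (· ≤ ·) (Prod.fst '' C) := by
        rintro _ ⟨p, hp, rfl⟩ _ ⟨p', hp', rfl⟩
        rcases hchain.total hp hp' with h | h
        · exact ⟨_, ⟨p', hp', rfl⟩, h.1, le_rfl⟩
        · exact ⟨_, ⟨p, hp, rfl⟩, le_rfl, h.1⟩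
      have hdir' : DirectedOn (· ≤ ·) (Prod.snd '' C) := by
        rintro _ ⟨p, hp, rfl⟩ _ ⟨p', hp', rfl⟩
        rcases hchain.total hp hp' with h | h
        · exact ⟨_, ⟨p', hp', rfl⟩, h.2, le_rfl⟩
        · exact ⟨_, ⟨p, hp, rfl⟩, le_rfl, h.2⟩
      have hmem : ∀ a, a ∈ sSup (Prod.fst '' C) ↔ ∃ p ∈ C, a ∈ p.1 := by
        intro a
        rw [Submodule.mem_sSup_of_directed (Set.Nonempty.image _ ⟨p₀, hp₀⟩) hdir]
        simp only [Set.exists_mem_image]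
      have hmem' : ∀ a, a ∈ sSup (Prod.snd '' C) ↔ ∃ p ∈ C, a ∈ p.2 := by
        intro a
        rw [Submodule.mem_sSup_of_directed (Set.Nonempty.image _ ⟨p₀, hp₀⟩) hdir']
        simp only [Set.exists_mem_image]
      have hsub : ∀ {T : Type u} [CommRing T] (d : A →+* T),
          G.IsSubPoint (sSup (Prod.fst '' C)) d ↔ ∀ p ∈ C, G.IsSubPoint p.1 d := by
        intro T _ d
        refine ⟨fun h p hp => ⟨h.1, fun a ha => h.2 a ((hmem a).mpr ⟨p, hp, ha⟩)⟩,
          fun h => ⟨(h p₀ hp₀).1, fun a ha => ?_⟩⟩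
        obtain ⟨p, hp, hap⟩ := (hmem a).mp ha
        exact (h p hp).2 a hap
      have hsub' : ∀ {T : Type u} [CommRing T] (y : A →+* T),
          (∀ a ∈ sSup (Prod.snd '' C), y a = 0) ↔ ∀ p ∈ C, ∀ a ∈ p.2, y a = 0 := by
        intro T _ y
        refine ⟨fun h p hp a ha => h a ((hmem' a).mpr ⟨p, hp, ha⟩), fun h a ha => ?_⟩
        obtain ⟨p, hp, hap⟩ := (hmem' a).mp ha
        exact h p hp a hap
      refine ⟨(sSup (Prod.fst '' C), sSup (Prod.snd '' C)), ?_, fun p hp =>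
        ⟨le_sSup ⟨p, hp, rfl⟩, le_sSup ⟨p, hp, rfl⟩⟩⟩
      exact
      { one := fun a ha => by
          obtain ⟨p, hp, hap⟩ := (hmem a).mp ha
          exact (hC hp).one a hap
        mul := fun d d' h hd hd' => by
          rw [hsub] at hd hd' ⊢
          exact fun p hp => (hC hp).mul d d' h (hd p hp) (hd' p hp)
        inv := fun d hd => by
          rw [hsub] at hd ⊢
          exact fun p hp => (hC hp).inv d (hd p hp)
        act := fun d y h hd hy => by
          rw [hsub] at hd
          rw [hsub'] at hy ⊢
          exact fun p hp => (hC hp).act d y h (hd p hp) (hy p hp)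
        div := fun y y' h₀ h hy hy' => by
          rw [hsub'] at hy hy'
          rw [hsub]
          exact fun p hp => (hC hp).div y y' h₀ h (hy p hp) (hy' p hp)
        -- An equality `1 = a + b` uses a single `a` in the union of the ideals, which already lies
        -- in one member of the chain.
        ne_top := fun σ htop => by
          rw [Ideal.eq_top_iff_one, Submodule.mem_sup] at htop
          obtain ⟨a, ha, b, hb, hab⟩ := htop
          obtain ⟨p, hp, hap⟩ := (hmem' a).mp ha
          refine (hC hp).ne_top σ ?_
          rw [Ideal.eq_top_iff_one, Submodule.mem_sup]
          exact ⟨a, hap, b, hb, hab⟩ }) (⊥, ⊥) (G.isReduction_bot hne)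
  refine ⟨m.1, m.2, hm.1, fun I' J' h hI hJ => ?_⟩
  exact le_antisymm (hm.2 (y := (I', J')) h ⟨hI, hJ⟩).2 hJ

section Reduction

variable {G} {I J : Ideal A}

/-- The ideal of the diagonal and of `I`. -/
def subIdeal (G : RingGroupoid K A) (I : Ideal A) : Ideal A :=
  I ⊔ Ideal.span (Set.range fun x => G.δ₀ x - G.δ₁ x)

lemma isSubPoint_mk (I : Ideal A) {T : Type u} [CommRing T] (d : A ⧸ G.subIdeal I →+* T) :
    G.IsSubPoint I (d.comp (Ideal.Quotient.mk _)) := by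
  constructor
  · ext x
    change d (Ideal.Quotient.mk _ (G.δ₀ x)) = d (Ideal.Quotient.mk _ (G.δ₁ x))
    congr 1
    rw [Ideal.Quotient.eq]
    exact Ideal.mem_sup_right (Ideal.subset_span ⟨x, rfl⟩)
  · intro a ha
    rw [RingHom.comp_apply, Ideal.Quotient.eq_zero_iff_mem.mpr
      (show a ∈ G.subIdeal I from Ideal.mem_sup_left ha), map_zero]

lemma IsSubPoint.exists_lift {T : Type u} [CommRing T] {d : A →+* T} (hd : G.IsSubPoint I d) :
    ∃ d' : A ⧸ G.subIdeal I →+* T, d'.comp (Ideal.Quotient.mk _) = d := by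
  have hle : G.subIdeal I ≤ RingHom.ker d := by
    apply sup_le
    · exact fun a ha => hd.2 a ha
    · rw [Ideal.span_le]
      rintro _ ⟨x, rfl⟩
      change d (G.δ₀ x - G.δ₁ x) = 0
      rw [map_sub, sub_eq_zero]
      exact RingHom.congr_fun hd.1 x
  exact ⟨Ideal.Quotient.lift _ d hle, Ideal.Quotient.lift_comp_mk _ _ _⟩

lemma isGroupPoint_repPoint (hIJ : G.IsReduction k I J) {S : Type u} (c : S → G.Rep) :
    IsGroupPoint ((Ideal.Quotient.mk (G.subIdeal I)).comp G.δ₀)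
      (repPoint c (Ideal.Quotient.mk (G.subIdeal I))) where
  exists_mul d₁ d₂ h := by
    have h₁ := isSubPoint_mk I d₁
    have h₂ := isSubPoint_mk I d₂
    have hc : (d₁.comp (Ideal.Quotient.mk _)).comp G.δ₁ =
        (d₂.comp (Ideal.Quotient.mk _)).comp G.δ₀ := by rw [← h₁.1]; exact h
    obtain ⟨d, hd⟩ := (hIJ.mul _ _ hc h₁ h₂).exists_lift
    refine ⟨d, ?_, ?_⟩
    · rw [← RingHom.comp_assoc, hd, G.mul_δ₀, RingHom.comp_assoc]
    · rw [mapGLs_repPoint, mapGLs_repPoint, mapGLs_repPoint, hd, repPoint_mul]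
  exists_one := by
    obtain ⟨d, hd⟩ := IsSubPoint.exists_lift (G := G) (I := I) (d := G.ε)
      ⟨by rw [G.ε_δ₀, G.ε_δ₁], hIJ.one⟩
    refine ⟨d, ?_, ?_⟩
    · rw [← RingHom.comp_assoc, hd, G.ε_δ₀]
    · rw [mapGLs_repPoint, hd]
      exact repPoint_ε c (RingHom.id K)
  exists_inv := by
    have h₁ := isSubPoint_mk I (RingHom.id (A ⧸ G.subIdeal I))
    rw [RingHom.id_comp] at h₁
    obtain ⟨d, hd⟩ := (hIJ.inv _ h₁).exists_lift
    refine ⟨d, ?_, ?_⟩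
    · rw [← RingHom.comp_assoc, hd, RingHom.comp_assoc, G.inv_δ₀, h₁.1]
    · rw [mapGLs_repPoint, hd, repPoint_inv]

lemma fibre_mk_comp (J : Ideal A) (σ : Gal(K/k)) :
    (Ideal.Quotient.mk (J ⊔ G.fibreIdeal σ)).comp G.δ₁ =
      ((Ideal.Quotient.mk (J ⊔ G.fibreIdeal σ)).comp G.δ₀).comp (σ : K →+* K) := by
  ext x
  change Ideal.Quotient.mk _ (G.δ₁ x) = Ideal.Quotient.mk _ (G.δ₀ (σ x))
  rw [Ideal.Quotient.eq]
  exact Ideal.mem_sup_right (Ideal.subset_span ⟨x, rfl⟩)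

lemma exists_fibre_lift {J : Ideal A} {σ : Gal(K/k)} {T : Type u} [CommRing T] (y : A →+* T)
    (hJ : ∀ a ∈ J, y a = 0) (hσ : y.comp G.δ₁ = (y.comp G.δ₀).comp (σ : K →+* K)) :
    ∃ y' : A ⧸ J ⊔ G.fibreIdeal σ →+* T, y'.comp (Ideal.Quotient.mk _) = y := by
  have hle : J ⊔ G.fibreIdeal σ ≤ RingHom.ker y := by
    apply sup_le
    · exact fun a ha => hJ a ha
    · rw [fibreIdeal, Ideal.span_le]
      rintro _ ⟨x, rfl⟩
      change y (G.δ₁ x - G.δ₀ (σ x)) = 0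
      rw [map_sub, sub_eq_zero]
      exact RingHom.congr_fun hσ x
  exact ⟨Ideal.Quotient.lift _ y hle, Ideal.Quotient.lift_comp_mk _ _ _⟩

/-- Two points of the fibre above `σ` with the same target also have the same source, so `div`
provides their quotient; composing with a diagonal point on the left leaves the fibre stable. -/
lemma isTorsorPoint_repPoint (hIJ : G.IsReduction k I J) {S : Type u} (c : S → G.Rep) (σ : Gal(K/k)) :
    IsTorsorPoint ((Ideal.Quotient.mk (G.subIdeal I)).comp G.δ₀)
      (repPoint c (Ideal.Quotient.mk (G.subIdeal I)))
      ((Ideal.Quotient.mk (J ⊔ G.fibreIdeal σ)).comp G.δ₀)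
      (repPoint c (Ideal.Quotient.mk (J ⊔ G.fibreIdeal σ))) where
  exists_act d x h := by
    have h₁ := isSubPoint_mk I d
    have hx : ∀ a ∈ J, (x.comp (Ideal.Quotient.mk _)) a = 0 := fun a ha => by
      rw [RingHom.comp_apply, Ideal.Quotient.eq_zero_iff_mem.mpr (Ideal.mem_sup_left ha), map_zero]
    have hc : (d.comp (Ideal.Quotient.mk _)).comp G.δ₁ =
        (x.comp (Ideal.Quotient.mk _)).comp G.δ₀ := by rw [← h₁.1]; exact h
    obtain ⟨x', hx'⟩ := exists_fibre_lift (σ := σ) _ (hIJ.act _ _ hc h₁ hx) (by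
      rw [G.mul_δ₁, G.mul_comp_δ₀_eq _ _ hc h₁.1, RingHom.comp_assoc, fibre_mk_comp,
        RingHom.comp_assoc, RingHom.comp_assoc, RingHom.comp_assoc])
    refine ⟨x', ?_, ?_⟩
    · rw [← RingHom.comp_assoc, hx', G.mul_comp_δ₀_eq _ _ hc h₁.1, RingHom.comp_assoc]
    · rw [mapGLs_repPoint, mapGLs_repPoint, mapGLs_repPoint, hx', repPoint_mul]
  exists_div {T} _ x₁ x₂ h := by
    have hx : ∀ (x : A ⧸ J ⊔ G.fibreIdeal σ →+* T), ∀ a ∈ J,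
        (x.comp (Ideal.Quotient.mk _)) a = 0 := fun x a ha => by
      rw [RingHom.comp_apply, Ideal.Quotient.eq_zero_iff_mem.mpr (Ideal.mem_sup_left ha), map_zero]
    have h₁ : (x₁.comp (Ideal.Quotient.mk _)).comp G.δ₁ =
        (x₂.comp (Ideal.Quotient.mk _)).comp G.δ₁ := by
      rw [RingHom.comp_assoc, RingHom.comp_assoc, fibre_mk_comp, ← RingHom.comp_assoc, h,
        RingHom.comp_assoc]
    obtain ⟨d, hd⟩ := (hIJ.div (x₁.comp (Ideal.Quotient.mk _)) (x₂.comp (Ideal.Quotient.mk _))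
      h h₁ (hx x₁) (hx x₂)).exists_lift
    refine ⟨d, ?_, ?_⟩
    · rw [← RingHom.comp_assoc, hd, G.mul_δ₀, RingHom.comp_assoc]
    · rw [mapGLs_repPoint, mapGLs_repPoint, mapGLs_repPoint, hd, repPoint_mul, repPoint_inv]

end Reduction

end RingGroupoid

/-! ### The reduction step and the locally constant section -/

namespace RingGroupoid

variable {K A : Type u} [Field K] [CommRing A] {G : RingGroupoid K A}
variable {k : Type u} [Field k] [Algebra k K]

/-- An element of the fibre ideal involves only finitely many generators, hence only the values of
`σ` at finitely many elements of `K`. -/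
lemma eventually_mem_sup_fibreIdeal [Algebra.IsAlgebraic k K] (J : Ideal A) {σ : Gal(K/k)} {a : A}
    (ha : a ∈ J ⊔ G.fibreIdeal σ) : ∀ᶠ σ' in 𝓝 σ, a ∈ J ⊔ G.fibreIdeal σ' := by
  obtain ⟨b, hb, b', hb', rfl⟩ := Submodule.mem_sup.mp ha
  clear ha
  suffices ∀ᶠ σ' in 𝓝 σ, b' ∈ G.fibreIdeal σ' from
    this.mono fun σ' h => Ideal.add_mem _ (Ideal.mem_sup_left hb) (Ideal.mem_sup_right h)
  induction hb' using Submodule.span_induction with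
  | mem x hx =>
    obtain ⟨x, rfl⟩ := hx
    filter_upwards [eventually_forall_finset_eq σ {x}] with σ' hσ'
    exact Ideal.subset_span ⟨x, by simp [hσ' x]⟩
  | zero => exact Filter.Eventually.of_forall fun _ => Ideal.zero_mem _
  | add x y _ _ hx hy =>
    filter_upwards [hx, hy] with σ' h h' using Ideal.add_mem _ h h'
  | smul a x _ hx => filter_upwards [hx] with σ' h using Ideal.mul_mem_left _ a h

/-- By Hilbert's basis theorem the closed image of the group has finitely many equations, and each
one is a membership in `J ⊔ fibreIdeal σ`, an open condition on `σ`. -/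
lemma eventually_inTorsorClosure [Algebra.IsAlgebraic k K] {S : Type u} [Finite S] (I J : Ideal A)
    (c : S → G.Rep) {σ : Gal(K/k)} {g : GLs (repDim c) K}
    (hg : InTorsorClosure ((Ideal.Quotient.mk (G.subIdeal I)).comp G.δ₀)
      (repPoint c (Ideal.Quotient.mk (G.subIdeal I)))
      ((Ideal.Quotient.mk (J ⊔ G.fibreIdeal σ)).comp G.δ₀)
      (repPoint c (Ideal.Quotient.mk (J ⊔ G.fibreIdeal σ))) g) :
    ∀ᶠ σ' in 𝓝 σ, InTorsorClosure ((Ideal.Quotient.mk (G.subIdeal I)).comp G.δ₀)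
      (repPoint c (Ideal.Quotient.mk (G.subIdeal I)))
      ((Ideal.Quotient.mk (J ⊔ G.fibreIdeal σ')).comp G.δ₀)
      (repPoint c (Ideal.Quotient.mk (J ⊔ G.fibreIdeal σ'))) g := by
  have hev : ∀ (J' : Ideal A) (f : MvPolynomial (EntryIndex (repDim c)) K),
      evGL ((Ideal.Quotient.mk J').comp G.δ₀)
        (mapGLs ((Ideal.Quotient.mk J').comp G.δ₀) g * (repPoint c (Ideal.Quotient.mk J'))⁻¹) f =
      Ideal.Quotient.mk J' (evGL G.δ₀ (mapGLs G.δ₀ g * (repPoint c (RingHom.id A))⁻¹) f) := by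
    intro J' f
    rw [evGL_comp, map_mul, map_inv, mapGLs_comp, mapGLs_repPoint, RingHom.comp_id]
  obtain ⟨s, hs⟩ := (IsNoetherian.noetherian (RingHom.ker
    (evGL ((Ideal.Quotient.mk (G.subIdeal I)).comp G.δ₀)
      (repPoint c (Ideal.Quotient.mk (G.subIdeal I))))) :
        (RingHom.ker (evGL ((Ideal.Quotient.mk (G.subIdeal I)).comp G.δ₀)
      (repPoint c (Ideal.Quotient.mk (G.subIdeal I))))).FG)
  have h1 : ∀ᶠ σ' in 𝓝 σ, ∀ f ∈ s,
      evGL G.δ₀ (mapGLs G.δ₀ g * (repPoint c (RingHom.id A))⁻¹) f ∈ J ⊔ G.fibreIdeal σ' := by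
    rw [Filter.eventually_all_finset]
    intro f hf
    apply eventually_mem_sup_fibreIdeal
    rw [← Ideal.Quotient.eq_zero_iff_mem, ← hev]
    apply hg
    rw [← RingHom.mem_ker, ← hs]
    exact Submodule.subset_span hf
  filter_upwards [h1] with σ' h
  intro f hf
  rw [← RingHom.mem_ker, ← hs] at hf
  rw [← RingHom.mem_ker]
  refine Ideal.span_le.mpr (fun f hf => ?_) hf
  rw [SetLike.mem_coe, RingHom.mem_ker, hev, Ideal.Quotient.eq_zero_iff_mem]
  exact h f hf

lemma forall_mem_sup_span {T : Type u} [CommRing T] (u : A →+* T) (I : Ideal A) {X : Type*}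
    (f : X → A) : (∀ a ∈ I ⊔ Ideal.span (Set.range f), u a = 0) ↔
      (∀ a ∈ I, u a = 0) ∧ ∀ p, u (f p) = 0 := by
  refine ⟨fun h => ⟨fun a ha => h a (Ideal.mem_sup_left ha),
    fun p => h _ (Ideal.mem_sup_right (Ideal.subset_span ⟨p, rfl⟩))⟩, fun h => ?_⟩
  change I ⊔ Ideal.span (Set.range f) ≤ RingHom.ker u
  refine sup_le h.1 (Ideal.span_le.mpr ?_)
  rintro _ ⟨p, rfl⟩
  exact h.2 p

lemma isSubPoint_sup_iff {T : Type u} [CommRing T] {I : Ideal A} {S : Type u} (c : S → G.Rep)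
    (d : A →+* T) : G.IsSubPoint (I ⊔ Ideal.span (Set.range fun p =>
        entries (repPoint c (RingHom.id A)) p - entries (1 : GLs (repDim c) A) p)) d ↔
      G.IsSubPoint I d ∧ repPoint c d = 1 := by
  have h : (∀ p, d (entries (repPoint c (RingHom.id A)) p - entries (1 : GLs (repDim c) A) p) = 0) ↔
      repPoint c d = 1 := by
    rw [← entries_injective.eq_iff, funext_iff]
    refine forall_congr' fun p => ?_
    rw [map_sub, sub_eq_zero, ← entries_map, ← entries_map, mapGLs_repPoint, RingHom.comp_id,
      map_one]
  rw [IsSubPoint, IsSubPoint, forall_mem_sup_span, h, and_assoc]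

/-- The subgroup is cut down to the kernel of `c`, and the torsor above `σ` to the locus where `c`
takes the value `g σ`. The elements `a p` make this a single system of equations for all `σ`. -/
lemma isReduction_sup [IsAlgClosed K] {I J : Ideal A} (hIJ : G.IsReduction k I J) (c : PUnit.{u + 1} → G.Rep)
    (g : Gal(K/k) → GLs (repDim c) K)
    (hg : ∀ σ, InTorsorClosure ((Ideal.Quotient.mk (G.subIdeal I)).comp G.δ₀)
      (repPoint c (Ideal.Quotient.mk (G.subIdeal I)))
      ((Ideal.Quotient.mk (J ⊔ G.fibreIdeal σ)).comp G.δ₀)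
      (repPoint c (Ideal.Quotient.mk (J ⊔ G.fibreIdeal σ))) (g σ))
    (a : EntryIndex (repDim c) → A)
    (ha : ∀ p, IsInducedBy G.δ₀ G.δ₁ (fun σ => entries (g σ) p) (a p)) :
    G.IsReduction k
      (I ⊔ Ideal.span (Set.range fun p => entries (repPoint c (RingHom.id A)) p -
        entries (1 : GLs (repDim c) A) p))
      (J ⊔ Ideal.span (Set.range fun p =>
        entries (repPoint c (RingHom.id A)) p - a p)) := by
  have hY : ∀ {T : Type u} [CommRing T] (y : A →+* T),
      (∀ b ∈ J ⊔ Ideal.span (Set.range fun p => entries (repPoint c (RingHom.id A)) p - a p),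
        y b = 0) ↔ (∀ b ∈ J, y b = 0) ∧ ∀ p, entries (repPoint c y) p = y (a p) := by
    intro T _ y
    rw [forall_mem_sup_span]
    refine and_congr_right fun _ => forall_congr' fun p => ?_
    rw [map_sub, sub_eq_zero, ← entries_map, mapGLs_repPoint, RingHom.comp_id]
  -- The `a p` lie in the subring generated by source and target, so they do not separate arrows
  -- with the same ends. This gives stability under the action, and quotients in the kernel.
  have heq : ∀ {T : Type u} [CommRing T] (y y' : A →+* T), y.comp G.δ₀ = y'.comp G.δ₀ →
      y.comp G.δ₁ = y'.comp G.δ₁ → ∀ p, y (a p) = y' (a p) := by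
    intro T _ y y' h₀ h₁ p
    have hle : Subring.closure (Set.range G.δ₀ ∪ Set.range G.δ₁) ≤ y.eqLocus y' := by
      rw [Subring.closure_le]
      rintro _ (⟨x, rfl⟩ | ⟨x, rfl⟩)
      · exact RingHom.congr_fun h₀ x
      · exact RingHom.congr_fun h₁ x
    exact hle (ha p).1
  refine
  { one := fun b hb => ?_
    mul := fun d d' h hd hd' => ?_
    inv := fun d hd => ?_
    act := fun d y h hd hy => ?_
    div := fun y y' h₀ h hy hy' => ?_
    ne_top := fun σ htop => ?_ }
  · have h1 := (isSubPoint_sup_iff (I := I) c G.ε).mpr ⟨⟨by rw [G.ε_δ₀, G.ε_δ₁], hIJ.one⟩,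
      repPoint_ε c (RingHom.id K)⟩
    exact h1.2 b hb
  · rw [isSubPoint_sup_iff] at hd hd' ⊢
    exact ⟨hIJ.mul d d' h hd.1 hd'.1, by rw [repPoint_mul, hd.2, hd'.2, _root_.one_mul]⟩
  · rw [isSubPoint_sup_iff] at hd ⊢
    exact ⟨hIJ.inv d hd.1, by rw [repPoint_inv, hd.2, inv_one]⟩
  · rw [isSubPoint_sup_iff] at hd
    rw [hY] at hy ⊢
    refine ⟨hIJ.act d y h hd.1 hy.1, fun p => ?_⟩
    rw [repPoint_mul, hd.2, _root_.one_mul, hy.2 p]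
    exact heq _ _ (G.mul_comp_δ₀_eq d y h hd.1.1).symm (G.mul_δ₁ d y h).symm p
  · rw [hY] at hy hy'
    rw [isSubPoint_sup_iff]
    refine ⟨hIJ.div y y' h₀ h hy.1 hy'.1, ?_⟩
    rw [repPoint_mul, repPoint_inv, mul_inv_eq_one]
    apply entries_injective
    ext p
    rw [hy.2, hy'.2, heq y y' h₀ h]
  -- Non-emptiness of the fibres. If `1` were a combination of the new equations above `σ`, its
  -- coefficients `f p` would be combinations of entries of finitely many further representations,
  -- and the relation would be polynomial in this finite family; `IsTorsorPoint.sum_ne_one` excludes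
  -- it.
  · have hne := hIJ.ne_top σ
    have : Nontrivial (A ⧸ J ⊔ G.fibreIdeal σ) := Ideal.Quotient.nontrivial_iff.mpr hne
    have h1 : (1 : A) ∈ Ideal.span (Set.range fun p =>
        entries (repPoint c (RingHom.id A)) p - a p) ⊔ (J ⊔ G.fibreIdeal σ) := by
      have : (1 : A) ∈ J ⊔ Ideal.span (Set.range fun p =>
          entries (repPoint c (RingHom.id A)) p - a p) ⊔ G.fibreIdeal σ := by
        rw [htop]; trivial
      rwa [sup_comm J, sup_assoc] at this
    obtain ⟨b, hb, b', hb', hbb⟩ := Submodule.mem_sup.mp h1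
    obtain ⟨f, rfl⟩ := (Submodule.mem_span_range_iff_exists_fun A).mp hb
    choose c' x y hcxy using fun p => G.exists_rep_fin (f p)
    let cc : Option (EntryIndex (repDim c)) → G.Rep := fun o => o.elim (c PUnit.unit) c'
    let r : PUnit.{u + 1} → Option (EntryIndex (repDim c)) := fun _ => none
    -- Above `σ` the scalars of the source become `σ` of the scalars of the target, so `f p` is
    -- there a polynomial with coefficients in `K`.
    let F : EntryIndex (repDim cc ∘ r) → MvPolynomial (EntryIndex (repDim cc)) K := fun p =>
      ∑ l, ∑ m, MvPolynomial.C (σ (x p l)) * MvPolynomial.C (y p m) *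
        MvPolynomial.X ⟨some p, Sum.inl (m, l)⟩
    refine IsTorsorPoint.sum_ne_one r (isGroupPoint_repPoint hIJ cc)
      (isTorsorPoint_repPoint hIJ cc σ) (g σ) (hg σ) F ?_
    have h2 := congrArg (Ideal.Quotient.mk (J ⊔ G.fibreIdeal σ)) hbb
    rw [map_add, Ideal.Quotient.eq_zero_iff_mem.mpr hb', add_zero, map_one, map_sum] at h2
    rw [← h2]
    refine Finset.sum_congr rfl fun p _ => ?_
    have h3 : entries (restrGLs r (repPoint cc (Ideal.Quotient.mk (J ⊔ G.fibreIdeal σ)))) p =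
        Ideal.Quotient.mk (J ⊔ G.fibreIdeal σ) (entries (repPoint c (RingHom.id A)) p) := by
      rcases p with ⟨s, p | p⟩ <;> rfl
    have h4 : Ideal.Quotient.mk (J ⊔ G.fibreIdeal σ) (G.δ₀ (entries (g σ) p)) =
        Ideal.Quotient.mk (J ⊔ G.fibreIdeal σ) (a p) :=
      ((ha p).2 _ σ (fibre_mk_comp J σ)).symm
    have h5 : evGL ((Ideal.Quotient.mk (J ⊔ G.fibreIdeal σ)).comp G.δ₀)
        (repPoint cc (Ideal.Quotient.mk (J ⊔ G.fibreIdeal σ))) (F p) =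
        Ideal.Quotient.mk (J ⊔ G.fibreIdeal σ) (f p) := by
      rw [hcxy p]
      simp only [F, map_sum, map_mul, evGL_C, evGL_X, entries]
      refine Finset.sum_congr rfl fun l _ => Finset.sum_congr rfl fun m _ => ?_
      congr 2
      exact (RingHom.congr_fun (fibre_mk_comp J σ) (x p l)).symm
    rw [smul_eq_mul, map_mul, mul_comm (Ideal.Quotient.mk _ (f p)), map_sub]
    exact congrArg₂ (· * ·) (congrArg₂ (· - ·) h3 h4) h5

variable [PerfectField k] [IsAlgClosure k K]

/-- A groupoid whose fibres above the elements of the Galois group are non-empty has a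
locally constant section above the Galois group. -/
theorem exists_section (G : RingGroupoid K A) (hne : ∀ σ : Gal(K/k), G.fibreIdeal σ ≠ ⊤) :
    ∃ s : Gal(K/k) → (A →+* K), (∀ σ, (s σ).comp G.δ₀ = RingHom.id K) ∧
      (∀ σ, (s σ).comp G.δ₁ = (σ : K →+* K)) ∧ ∀ a, IsLocallyConstant fun σ => s σ a := by
  have : IsAlgClosed K := IsAlgClosure.isAlgClosed k
  have : Algebra.IsAlgebraic k K := IsAlgClosure.isAlgebraic
  obtain ⟨I, J, hIJ, hmax⟩ := G.exists_maximal_isReduction hne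
  have hnt : ∀ σ : Gal(K/k), Nontrivial (A ⧸ J ⊔ G.fibreIdeal σ) := fun σ =>
    Ideal.Quotient.nontrivial_iff.mpr (hIJ.ne_top σ)
  have hrep : ∀ c : G.Rep, ∃ g : Gal(K/k) → GLs (repDim fun _ : PUnit.{u + 1} => c) K,
      IsLocallyConstant g ∧ ∀ σ p, Ideal.Quotient.mk (J ⊔ G.fibreIdeal σ)
        (entries (repPoint (fun _ : PUnit => c) (RingHom.id A)) p) =
        Ideal.Quotient.mk (J ⊔ G.fibreIdeal σ) (G.δ₀ (entries (g σ) p)) := by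
    intro c
    obtain ⟨g, hg, hgσ⟩ := exists_isLocallyConstant_choice
      (fun (σ : Gal(K/k)) (g : GLs (repDim fun _ : PUnit.{u + 1} => c) K) =>
        InTorsorClosure ((Ideal.Quotient.mk (G.subIdeal I)).comp G.δ₀)
          (repPoint (fun _ : PUnit => c) (Ideal.Quotient.mk (G.subIdeal I)))
          ((Ideal.Quotient.mk (J ⊔ G.fibreIdeal σ)).comp G.δ₀)
          (repPoint (fun _ : PUnit => c) (Ideal.Quotient.mk (J ⊔ G.fibreIdeal σ))) g)
      (fun σ => by
        obtain ⟨g, hg⟩ :=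
          (isTorsorPoint_repPoint hIJ (fun _ : PUnit => c) σ).exists_inTorsorClosure
        exact ⟨g, eventually_inTorsorClosure I J _ hg⟩)
    choose a ha using fun p => exists_isInducedBy (δ₀ := G.δ₀) (δ₁ := G.δ₁)
      (fun σ => entries (g σ) p) (hg.comp fun g => entries g p)
    -- By maximality of `J` the equations which express `c` through source and target belong to `J`
    -- already.
    have hJ := hmax _ _ (isReduction_sup hIJ _ g hgσ a ha) le_sup_left le_sup_left
    refine ⟨g, hg, fun σ p => ?_⟩
    have hp : entries (repPoint (fun _ : PUnit => c) (RingHom.id A)) p - a p ∈ J := by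
      rw [← hJ]
      exact Ideal.mem_sup_right (Ideal.subset_span ⟨p, rfl⟩)
    have h1 := Ideal.Quotient.eq.mpr (Ideal.mem_sup_left (T := G.fibreIdeal σ) hp)
    rw [h1]
    exact (ha p).2 _ σ (fibre_mk_comp J σ)
  have hval : ∀ a : A, ∃ φ : Gal(K/k) → K, IsLocallyConstant φ ∧ ∀ σ,
      Ideal.Quotient.mk (J ⊔ G.fibreIdeal σ) a =
        Ideal.Quotient.mk (J ⊔ G.fibreIdeal σ) (G.δ₀ (φ σ)) := by
    intro a
    obtain ⟨c, x, y, rfl⟩ := G.exists_rep_fin a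
    obtain ⟨g, hg, hgσ⟩ := hrep c
    refine ⟨fun σ => ∑ l, ∑ m, σ (x l) * y m * entries (g σ) ⟨PUnit.unit, Sum.inl (m, l)⟩,
      ?_, fun σ => ?_⟩
    · rw [IsLocallyConstant.iff_eventually_eq]
      intro σ
      classical
      filter_upwards [(IsLocallyConstant.iff_eventually_eq _).mp hg σ,
        eventually_forall_finset_eq σ (Finset.univ.image x)] with σ' h1 h2
      refine Finset.sum_congr rfl fun l _ => Finset.sum_congr rfl fun m _ => ?_
      rw [h1, h2 _ (Finset.mem_image_of_mem _ (Finset.mem_univ l))]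
    · simp only [map_sum, map_mul]
      refine Finset.sum_congr rfl fun l _ => Finset.sum_congr rfl fun m _ => ?_
      have h1 := hgσ σ ⟨PUnit.unit, Sum.inl (m, l)⟩
      have h2 := RingHom.congr_fun (fibre_mk_comp (G := G) J σ) (x l)
      simp only [RingHom.comp_apply] at h2
      rw [h2, ← h1]
      rfl
  choose φ hφ hφσ using hval
  -- Every function is a scalar modulo the ideal of the fibre, which is therefore one `K`-rational
  -- point; this point is the value of the section at `σ`.
  have hbij : ∀ σ : Gal(K/k),
      Function.Bijective ((Ideal.Quotient.mk (J ⊔ G.fibreIdeal σ)).comp G.δ₀) := by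
    intro σ
    refine ⟨RingHom.injective _, fun q => ?_⟩
    obtain ⟨a, rfl⟩ := Ideal.Quotient.mk_surjective q
    exact ⟨φ a σ, (hφσ a σ).symm⟩
  let e : ∀ σ : Gal(K/k), K ≃+* A ⧸ J ⊔ G.fibreIdeal σ := fun σ => RingEquiv.ofBijective _ (hbij σ)
  have he : ∀ σ x, (e σ).symm (Ideal.Quotient.mk _ (G.δ₀ x)) = x := fun σ x =>
    (e σ).symm_apply_apply x
  refine ⟨fun σ => (e σ).symm.toRingHom.comp (Ideal.Quotient.mk _), fun σ => ?_, fun σ => ?_,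
    fun a => ?_⟩
  · ext x
    exact he σ x
  · ext x
    have h2 := RingHom.congr_fun (fibre_mk_comp (G := G) J σ) x
    simp only [RingHom.comp_apply] at h2
    change (e σ).symm (Ideal.Quotient.mk _ (G.δ₁ x)) = σ x
    rw [h2]
    exact he σ _
  · convert hφ a using 1
    ext σ
    change (e σ).symm (Ideal.Quotient.mk _ a) = φ a σ
    rw [hφσ, he]

end RingGroupoid

/-! ### Locally constant families of morphisms -/

section Affine

variable {T T' Z Z' : Scheme.{u}}

lemma appTop_comp_apply (f : T ⟶ Z) (g : Z ⟶ Z') (a : Γ(Z', ⊤)) :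
    (f ≫ g).appTop a = f.appTop (g.appTop a) := by
  rw [Scheme.Hom.comp_appTop]
  rfl

lemma hom_ext_of_affine [IsAffine Z] {f g : T ⟶ Z} (h : ∀ a, f.appTop a = g.appTop a) : f = g :=
  ext_of_isAffine (CommRingCat.hom_ext (RingHom.ext h))

/-- The morphism to an affine scheme defined by a homomorphism of rings. -/
def affineHom [IsAffine Z] (φ : Γ(Z, ⊤) ⟶ Γ(T, ⊤)) : T ⟶ Z :=
  T.toSpecΓ ≫ Spec.map φ ≫ Z.isoSpec.inv

lemma affineHom_appTop [IsAffine Z] (φ : Γ(Z, ⊤) ⟶ Γ(T, ⊤)) : (affineHom φ).appTop = φ := by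
  have h : affineHom φ ≫ Z.toSpecΓ = T.toSpecΓ ≫ Spec.map φ := by
    rw [affineHom, Category.assoc, Category.assoc, Scheme.isoSpec_inv_toSpecΓ, Category.comp_id]
  have h1 := congrArg Scheme.Hom.appTop h
  rw [Scheme.Hom.comp_appTop, Scheme.Hom.comp_appTop, Scheme.toSpecΓ_appTop,
    Scheme.toSpecΓ_appTop, Scheme.ΓSpecIso_naturality] at h1
  exact (cancel_epi _).mp h1

lemma fromSpecStalk_appTop_apply (t : T) (a : Γ(T, ⊤)) : (T.fromSpecStalk t).appTop a =
    (Scheme.ΓSpecIso (T.presheaf.stalk t)).inv (T.presheaf.germ ⊤ t trivial a) := by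
  have h : (T.fromSpecStalk t).appTop = T.presheaf.germ ⊤ t trivial ≫
      (Scheme.ΓSpecIso (T.presheaf.stalk t)).inv := by
    rw [Scheme.fromSpecStalk_appTop]
    congr 1
  rw [h]
  rfl

lemma ΓSpecIso_inv_injective (R : CommRingCat.{u}) :
    Function.Injective (Scheme.ΓSpecIso R).inv := by
  intro a b h
  simpa using congrArg (Scheme.ΓSpecIso R).hom h

lemma fromSpecStalk_comp_eq_iff [IsAffine Z] {f g : T ⟶ Z} (t : T) :
    T.fromSpecStalk t ≫ f = T.fromSpecStalk t ≫ g ↔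
      ∀ a, T.presheaf.germ ⊤ t trivial (f.appTop a) = T.presheaf.germ ⊤ t trivial (g.appTop a) := by
  refine ⟨fun h a => ?_, fun h => hom_ext_of_affine fun a => ?_⟩
  · apply ΓSpecIso_inv_injective
    rw [← fromSpecStalk_appTop_apply, ← fromSpecStalk_appTop_apply, ← appTop_comp_apply, h,
      appTop_comp_apply]
  · rw [appTop_comp_apply, appTop_comp_apply, fromSpecStalk_appTop_apply,
      fromSpecStalk_appTop_apply, h]

/-- Morphisms to an affine scheme which coincide on the spectra of the local rings are equal. -/
lemma hom_ext_of_fromSpecStalk [IsAffine Z] {f g : T ⟶ Z}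
    (h : ∀ t, T.fromSpecStalk t ≫ f = T.fromSpecStalk t ≫ g) : f = g := by
  refine hom_ext_of_affine fun a => ?_
  exact TopCat.Presheaf.section_ext T.sheaf ⊤ _ _ fun t _ =>
    (fromSpecStalk_comp_eq_iff t).mp (h t) a

/-- The fibres of `ψ` are open and disjoint, so the restrictions of the values of `ψ` to them glue.
-/
lemma exists_section_of_isLocallyConstant (ψ : T → Γ(T, ⊤)) (hψ : IsLocallyConstant ψ) :
    ∃ s : Γ(T, ⊤), ∀ t, T.presheaf.germ ⊤ t trivial s = T.presheaf.germ ⊤ t trivial (ψ t) := by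
  let U : Γ(T, ⊤) → T.Opens := fun r => ⟨ψ ⁻¹' {r}, hψ {r}⟩
  obtain ⟨s, hs, -⟩ := T.sheaf.existsUnique_gluing' U ⊤ (fun r => homOfLE le_top)
    (fun t _ => TopologicalSpace.Opens.mem_iSup.mpr ⟨ψ t, rfl⟩)
    (fun r => T.presheaf.map (homOfLE (le_top : U r ≤ ⊤)).op r) (by
      intro r r'
      apply TopCat.Presheaf.section_ext T.sheaf
      rintro t ⟨h, h'⟩
      have hr : r = r' := (show ψ t = r from h).symm.trans h'
      subst hr
      rfl)
  refine ⟨s, fun t => ?_⟩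
  have h1 := congrArg (T.presheaf.germ (U (ψ t)) t rfl) (hs (ψ t))
  erw [TopCat.Presheaf.germ_res_apply, TopCat.Presheaf.germ_res_apply] at h1
  exact h1

variable {M M' : Type*} [TopologicalSpace M] [TopologicalSpace M']

/-- A family of morphisms to `Z` such that the inverse image of each global function on `Z` is
locally constant. -/
def LocConst (f : M → (T ⟶ Z)) : Prop :=
  ∀ a : Γ(Z, ⊤), IsLocallyConstant fun m => (f m).appTop a

lemma LocConst.comp {f : M → (T ⟶ Z)} (hf : LocConst f) (g : Z ⟶ Z') :
    LocConst fun m => f m ≫ g := fun a => by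
  simpa only [appTop_comp_apply] using hf (g.appTop a)

lemma LocConst.precomp {f : M → (T ⟶ Z)} (hf : LocConst f) (g : T' ⟶ T) :
    LocConst fun m => g ≫ f m := fun a => by
  simp only [appTop_comp_apply]
  exact (hf a).comp g.appTop

lemma LocConst.comp_continuous {f : M → (T ⟶ Z)} (hf : LocConst f) {j : M' → M}
    (hj : Continuous j) : LocConst fun m => f (j m) := fun a => (hf a).comp_continuous hj

lemma locConst_const (f : T ⟶ Z) : LocConst fun _ : M => f := fun _ => IsLocallyConstant.const _

lemma LocConst.comp_family {f : M → (T ⟶ Z)} (hf : LocConst f) {g : M → (Z ⟶ Z')}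
    (hg : LocConst g) : LocConst fun m => f m ≫ g m := fun a => by
  rw [IsLocallyConstant.iff_eventually_eq]
  intro m
  filter_upwards [(IsLocallyConstant.iff_eventually_eq _).mp (hg a) m,
    (IsLocallyConstant.iff_eventually_eq _).mp (hf ((g m).appTop a)) m] with m' h h'
  rw [appTop_comp_apply, appTop_comp_apply, h, h']

/-- A subring of the ring of functions on a fibre product of affine schemes which contains the
functions on the factors is the whole ring. -/
lemma subring_pullback_eq_top {X Y S : Scheme.{u}} [IsAffine X] [IsAffine Y] [IsAffine S]
    (p : X ⟶ S) (q : Y ⟶ S) (W : Subring Γ(pullback p q, ⊤))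
    (hX : ∀ a, (pullback.fst p q).appTop a ∈ W) (hY : ∀ b, (pullback.snd p q).appTop b ∈ W) :
    W = ⊤ := by
  let w : CommRingCat.of W ⟶ Γ(pullback p q, ⊤) := CommRingCat.ofHom W.subtype
  have hw : Mono w := ConcreteCategory.mono_of_injective w Subtype.val_injective
  let φX : Γ(X, ⊤) ⟶ CommRingCat.of W :=
    CommRingCat.ofHom ((pullback.fst p q).appTop.hom.codRestrict W hX)
  let φY : Γ(Y, ⊤) ⟶ CommRingCat.of W :=
    CommRingCat.ofHom ((pullback.snd p q).appTop.hom.codRestrict W hY)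
  have hφX : φX ≫ w = (pullback.fst p q).appTop := rfl
  have hφY : φY ≫ w = (pullback.snd p q).appTop := rfl
  let i : Spec (CommRingCat.of W) ⟶ pullback p q :=
    pullback.lift (Spec.map φX ≫ X.isoSpec.inv) (Spec.map φY ≫ Y.isoSpec.inv) (by
      rw [Category.assoc, Category.assoc, ← Scheme.isoSpec_inv_naturality,
        ← Scheme.isoSpec_inv_naturality, ← Category.assoc, ← Category.assoc, ← Spec.map_comp,
        ← Spec.map_comp]
      congr 2
      rw [← cancel_mono w, Category.assoc, Category.assoc, hφX, hφY, ← Scheme.Hom.comp_appTop,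
        ← Scheme.Hom.comp_appTop, pullback.condition])
  -- Both projections factor through `Spec W`, and so does the identity; on functions this makes the
  -- inclusion of `W` surjective.
  have hi : (pullback p q).toSpecΓ ≫ Spec.map w ≫ i = 𝟙 _ := by
    apply pullback.hom_ext
    · rw [Category.assoc, Category.assoc, pullback.lift_fst, Category.id_comp,
        ← Category.assoc (Spec.map w), ← Spec.map_comp, hφX, ← Scheme.toSpecΓ_naturality_assoc,
        Scheme.toSpecΓ_isoSpec_inv, Category.comp_id]
    · rw [Category.assoc, Category.assoc, pullback.lift_snd, Category.id_comp,
        ← Category.assoc (Spec.map w), ← Spec.map_comp, hφY, ← Scheme.toSpecΓ_naturality_assoc,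
        Scheme.toSpecΓ_isoSpec_inv, Category.comp_id]
  have h1 := congrArg Scheme.Hom.appTop hi
  rw [Scheme.Hom.comp_appTop, Scheme.Hom.comp_appTop, Scheme.toSpecΓ_appTop, Category.assoc,
    Scheme.ΓSpecIso_naturality, Scheme.Hom.id_appTop] at h1
  rw [eq_top_iff]
  intro a _
  have h2 := ConcreteCategory.congr_hom h1 a
  change w _ = a at h2
  rw [← h2]
  exact Subtype.property _

/-- The functions whose inverse image is locally constant form a subring, and it contains the
functions on both factors. -/
lemma LocConst.of_pullback {X Y S : Scheme.{u}} [IsAffine X] [IsAffine Y] [IsAffine S]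
    {p : X ⟶ S} {q : Y ⟶ S} {f : M → (T ⟶ pullback p q)}
    (hX : LocConst fun m => f m ≫ pullback.fst p q)
    (hY : LocConst fun m => f m ≫ pullback.snd p q) : LocConst f := by
  let W : Subring Γ(pullback p q, ⊤) :=
    { carrier := {a | IsLocallyConstant fun m => (f m).appTop a}
      mul_mem' := fun {a b} ha hb => by
        simp only [Set.mem_ofPred_eq, map_mul] at *
        exact ha.mul hb
      one_mem' := by
        simp only [Set.mem_ofPred_eq, map_one] at *
        exact IsLocallyConstant.const _
      add_mem' := fun {a b} ha hb => by
        simp only [Set.mem_ofPred_eq, map_add] at *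
        exact ha.add hb
      zero_mem' := by
        simp only [Set.mem_ofPred_eq, map_zero] at *
        exact IsLocallyConstant.const _
      neg_mem' := fun {a} ha => by
        simp only [Set.mem_ofPred_eq, map_neg] at *
        exact ha.neg }
  have hW : W = ⊤ := subring_pullback_eq_top p q W
    (fun a => by
      change IsLocallyConstant _
      simpa only [appTop_comp_apply] using hX a)
    (fun a => by
      change IsLocallyConstant _
      simpa only [appTop_comp_apply] using hY a)
  intro a
  have : a ∈ W := by rw [hW]; trivial
  exact this

/-- Gluing of a locally constant family along a continuous map to the space of parameters. -/
lemma LocConst.exists_glue [IsAffine Z] {f : M → (T ⟶ Z)} (hf : LocConst f) (e : T → M)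
    (he : Continuous e) :
    ∃ g : T ⟶ Z, ∀ t, T.fromSpecStalk t ≫ g = T.fromSpecStalk t ≫ f (e t) := by
  choose s hs using fun a : Γ(Z, ⊤) =>
    exists_section_of_isLocallyConstant (fun t => (f (e t)).appTop a) ((hf a).comp_continuous he)
  have hext : ∀ x y : Γ(T, ⊤), (∀ t, T.presheaf.germ ⊤ t trivial x =
      T.presheaf.germ ⊤ t trivial y) → x = y := fun x y h =>
    TopCat.Presheaf.section_ext T.sheaf ⊤ _ _ fun t _ => h t
  let φ : Γ(Z, ⊤) →+* Γ(T, ⊤) :=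
    { toFun := s
      map_one' := hext _ _ fun t => by rw [hs, map_one]
      map_mul' := fun a b => hext _ _ fun t => by rw [hs, map_mul, map_mul, map_mul, hs, hs]
      map_zero' := hext _ _ fun t => by rw [hs, map_zero]
      map_add' := fun a b => hext _ _ fun t => by rw [hs, map_add, map_add, map_add, hs, hs] }
  refine ⟨affineHom (CommRingCat.ofHom φ), fun t => ?_⟩
  rw [fromSpecStalk_comp_eq_iff]
  intro a
  rw [affineHom_appTop]
  exact hs a t

end Affine

/-! ### Locally constant families, continuous actions and the Krull topology -/

section Krull

variable {T Z : Scheme.{u}} {M : Type*} [TopologicalSpace M]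

lemma appTop_res (f : T ⟶ Z) {U : Z.Opens} {V : T.Opens} (e : V ≤ f ⁻¹ᵁ U) (a : Γ(Z, ⊤)) :
    f.appLE U V e (Z.presheaf.map (homOfLE (le_top : U ≤ ⊤)).op a) =
      T.presheaf.map (homOfLE (le_top : V ≤ ⊤)).op (f.appTop a) := by
  have h1 : Z.presheaf.map (homOfLE (le_top : U ≤ ⊤)).op ≫ f.appLE U V e =
      f.appTop ≫ T.presheaf.map (homOfLE (le_top : V ≤ ⊤)).op := by
    rw [Scheme.Hom.map_appLE]
    rfl
  exact ConcreteCategory.congr_hom h1 a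

/-- The inverse images of a section over an open subset along a locally constant family. -/
lemma LocConst.exists_appLE_eq [IsAffine Z] {f : M → (T ⟶ Z)} (hf : LocConst f) (U : Z.Opens)
    (a : Γ(Z, U)) (m : M) (t : T) (ht : f m t ∈ U) :
    ∃ N ∈ 𝓝 m, ∃ V : T.Opens, t ∈ V ∧ ∃ g : Γ(T, V),
      ∀ m' ∈ N, ∃ h : V ≤ f m' ⁻¹ᵁ U, (f m').appLE U V h a = g := by
  -- On a smaller principal open subset `a = c / b ^ n` with global functions `b` and `c`; when the
  -- inverse images of `b` and `c` do not vary, neither does that of `a`.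
  obtain ⟨b, hbU, hb⟩ := (isAffineOpen_top Z).exists_basicOpen_le ⟨f m t, ht⟩ trivial
  have := (isAffineOpen_top Z).isLocalization_basicOpen b
  obtain ⟨n, c, hc⟩ := IsLocalization.Away.surj b (Z.presheaf.map (homOfLE hbU).op a)
  rw [RingHom.algebraMap_toAlgebra] at hc
  have hV : ∀ m', (f m').appTop b = (f m).appTop b →
      T.basicOpen ((f m).appTop b) ≤ f m' ⁻¹ᵁ Z.basicOpen b := by
    intro m' h
    rw [Scheme.preimage_basicOpen_top, h]
  have key : ∀ m' (h : (f m').appTop b = (f m).appTop b),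
      (f m').appLE U (T.basicOpen ((f m).appTop b)) ((hV m' h).trans fun x hx => hbU hx) a *
        (T.presheaf.map (homOfLE (le_top : T.basicOpen ((f m).appTop b) ≤ ⊤)).op
          ((f m').appTop b)) ^ n =
      T.presheaf.map (homOfLE (le_top : T.basicOpen ((f m).appTop b) ≤ ⊤)).op
          ((f m').appTop c) := by
    intro m' h
    have h1 := congrArg ((f m').appLE (Z.basicOpen b) _ (hV m' h)) hc
    rw [map_mul, map_pow] at h1
    have h2 : (f m').appLE (Z.basicOpen b) _ (hV m' h) (Z.presheaf.map (homOfLE hbU).op a) =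
        (f m').appLE U (T.basicOpen ((f m).appTop b)) ((hV m' h).trans fun x hx => hbU hx) a :=
      ConcreteCategory.congr_hom (Scheme.Hom.map_appLE (f m') (hV m' h) (homOfLE hbU).op) a
    rw [h2] at h1
    rw [← appTop_res (f m') (hV m' h), ← appTop_res (f m') (hV m' h)]
    exact h1
  have hbm : T.basicOpen ((f m).appTop b) ≤ f m ⁻¹ᵁ Z.basicOpen b := hV m rfl
  refine ⟨{m' | (f m').appTop b = (f m).appTop b ∧ (f m').appTop c = (f m).appTop c},
    Filter.inter_mem ((IsLocallyConstant.iff_eventually_eq _).mp (hf b) m)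
      ((IsLocallyConstant.iff_eventually_eq _).mp (hf c) m),
    T.basicOpen ((f m).appTop b), ?_, (f m).appLE U _ (hbm.trans fun x hx => hbU hx) a,
    fun m' hm' => ⟨(hV m' hm'.1).trans fun x hx => hbU hx, ?_⟩⟩
  · rw [← Scheme.preimage_basicOpen_top]
    exact hb
  · have h1 := key m' hm'.1
    have h2 := key m rfl
    have e1 := hm'.1
    have e2 := hm'.2
    generalize_proofs at h1 h2 ⊢
    rw [e2, ← h2, congrArg (T.presheaf.map _) e1] at h1
    have hu : IsUnit (T.presheaf.map (homOfLE (le_top : T.basicOpen ((f m).appTop b) ≤ ⊤)).op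
          ((f m).appTop b)) := RingedSpace.isUnit_res_basicOpen _ _
    exact (hu.pow n).mul_left_injective h1

lemma LocConst.isContinuousAction {M : Type u} [Group M] [TopologicalSpace M] [IsAffine Z]
    {a : M →* Aut Z} (ha : LocConst fun m => (a m).hom) : IsContinuousAction a :=
  fun U f m z hz => ha.exists_appLE_eq U f m z hz

/-- Quasi-compactness: finitely many of the open sets `V z` cover `Z`, and the intersection of the
corresponding `N z` is a neighbourhood on which the inverse image of `f` is constant. -/
lemma IsContinuousAction.locConst {M : Type u} [Group M] [TopologicalSpace M]
    [IsAffine Z] {a : M →* Aut Z} (ha : IsContinuousAction a) : LocConst fun m => (a m).hom := by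
  intro f
  rw [IsLocallyConstant.iff_eventually_eq]
  intro m
  choose N hN V hV g hg using fun z => ha ⊤ f m z trivial
  obtain ⟨s, hs⟩ := (isCompact_univ (X := Z)).elim_finite_subcover (fun z => (V z : Set Z))
    (fun z => (V z).isOpen) (fun z _ => Set.mem_iUnion.mpr ⟨z, hV z⟩)
  have h1 : ∀ᶠ m' in 𝓝 m, ∀ z ∈ s, m' ∈ N z := by
    rw [Filter.eventually_all_finset]
    exact fun z _ => hN z
  filter_upwards [h1] with m' hm'
  refine TopCat.Presheaf.section_ext Z.sheaf ⊤ _ _ fun x _ => ?_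
  obtain ⟨z, hz⟩ := Set.mem_iUnion.mp (hs (Set.mem_univ x))
  obtain ⟨hzs, hxz⟩ := Set.mem_iUnion.mp hz
  obtain ⟨e', h'⟩ := hg z m' (hm' z hzs)
  obtain ⟨e, h⟩ := hg z m (mem_of_mem_nhds (hN z))
  have h2 : Z.presheaf.map (homOfLE (le_top : V z ≤ ⊤)).op ((a m').hom.appTop f) =
      Z.presheaf.map (homOfLE (le_top : V z ≤ ⊤)).op ((a m).hom.appTop f) := by
    rw [← appTop_res _ e', ← appTop_res _ e]
    refine Eq.trans ?_ ((h'.trans h.symm).trans ?_)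
    · congr 1
      exact ConcreteCategory.congr_hom (Z.presheaf.map_id _) f
    · congr 1
      exact (ConcreteCategory.congr_hom (Z.presheaf.map_id _) f).symm
  have h3 := congrArg (Z.presheaf.germ (V z) x hxz) h2
  erw [TopCat.Presheaf.germ_res_apply, TopCat.Presheaf.germ_res_apply] at h3
  exact h3

/-- Global functions suffice to define the Krull topology when `Z` is affine: the neighbourhood in
`LocConst.exists_appLE_eq` is everything, as `Spec K` is a point. -/
lemma continuous_krullTop_iff {K : Type u} [Field K] [IsAffine Z] (j : M → (SpecF K ⟶ Z)) :
    @Continuous _ _ _ (krullTop K Z) j ↔ LocConst j := by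
  let := krullTop K Z
  constructor
  · intro hj a
    rw [IsLocallyConstant.iff_isOpen_fiber]
    intro β
    have h1 : IsOpen {w : SpecF K ⟶ Z | ∃ h : ⊤ ≤ w ⁻¹ᵁ (⊤ : Z.Opens),
        (Scheme.ΓSpecIso (CommRingCat.of K)).hom (w.appLE ⊤ ⊤ h a) =
          (Scheme.ΓSpecIso (CommRingCat.of K)).hom β} :=
      TopologicalSpace.isOpen_generateFrom_of_mem ⟨⊤, a, _, rfl⟩
    convert h1.preimage hj using 1
    ext m
    have h2 : ∀ w : SpecF K ⟶ Z, ∀ h, w.appLE ⊤ ⊤ h = w.appTop := fun w h =>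
      Scheme.Hom.appLE_eq_app w
    simp only [Set.mem_preimage, Set.mem_singleton_iff, Set.mem_ofPred_eq, h2]
    refine ⟨fun h => ⟨le_rfl, by rw [h]⟩, fun ⟨_, h⟩ => ?_⟩
    simpa using congrArg (Scheme.ΓSpecIso (CommRingCat.of K)).inv h
  · intro hj
    refine continuous_generateFrom_iff.mpr ?_
    rintro _ ⟨U, f, α, rfl⟩
    rw [isOpen_iff_mem_nhds]
    rintro m ⟨hm, hα⟩
    let t : SpecF K := IsLocalRing.closedPoint K
    obtain ⟨N, hN, V, htV, g, hg⟩ := hj.exists_appLE_eq U f m t (hm trivial)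
    have hV : V = ⊤ := by
      rw [eq_top_iff]
      intro x _
      have : x = t := Subsingleton.elim (α := PrimeSpectrum K) x t
      rwa [this]
    subst hV
    filter_upwards [hN] with m' hm'
    obtain ⟨h', e'⟩ := hg m' hm'
    obtain ⟨h, e⟩ := hg m (mem_of_mem_nhds hN)
    exact ⟨h', by rw [e', ← e]; exact hα⟩

end Krull

/-! ### Embeddings of a Galois extension in a local ring -/

section LocalRing

variable {k K : Type u} [Field k] [Field K] [Algebra k K]

/-- Two embeddings of a normal separable extension in a local ring differ by an automorphism. -/
lemma exists_gal_of_isLocalRing [IsGalois k K] {O : Type u} [CommRing O] [IsLocalRing O]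
    (φ₀ φ₁ : K →+* O) (h : φ₀.comp (algebraMap k K) = φ₁.comp (algebraMap k K)) :
    ∃ σ : Gal(K/k), φ₁ = φ₀.comp (σ : K →+* K) := by
  have h1 : ∀ x : K, ∃ y : K, φ₁ x = φ₀ y := by
    classical
    intro x
    have hx : IsIntegral k x := Algebra.IsIntegral.isIntegral x
    have hsep : ((minpoly k x).map (algebraMap k K)).Separable :=
      Polynomial.Separable.map (IsGalois.separable k x)
    have hprod : (((minpoly k x).map (algebraMap k K)).roots.map
        fun a => Polynomial.X - Polynomial.C a).prod = (minpoly k x).map (algebraMap k K) :=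
      ((Normal.splits inferInstance x).eq_prod_roots_of_monic ((minpoly.monic hx).map _)).symm
    -- `φ₁ x` is a root of the minimal polynomial of `x`, which `φ₀` splits into distinct linear
    -- factors.
    have h0 : ∏ y ∈ ((minpoly k x).map (algebraMap k K)).roots.toFinset, (φ₁ x - φ₀ y) = 0 := by
      have h2 := congrArg (Polynomial.eval₂ φ₀ (φ₁ x)) hprod
      rw [Polynomial.eval₂_map, h, ← Polynomial.hom_eval₂] at h2
      have h3 : Polynomial.eval₂ (algebraMap k K) x (minpoly k x) = 0 := minpoly.aeval k x
      rw [h3, map_zero, Polynomial.eval₂_multiset_prod, Multiset.map_map] at h2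
      rw [Finset.prod_eq_multiset_prod, Multiset.toFinset_val,
        Multiset.dedup_eq_self.mpr (Polynomial.nodup_roots hsep), ← h2]
      congr 1
      refine Multiset.map_congr rfl fun y _ => ?_
      simp
    generalize ((minpoly k x).map (algebraMap k K)).roots.toFinset = R at h0
    -- Two factors differ by a unit `φ₀ (y - z)`, so at most one of them lies in the maximal ideal.
    -- The others are units and the product is zero, so that one vanishes.
    by_cases hu : ∀ y ∈ R, IsUnit (φ₁ x - φ₀ y)
    · have : IsUnit (∏ y ∈ R, (φ₁ x - φ₀ y)) := by
        rw [IsUnit.prod_iff]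
        exact hu
      rw [h0] at this
      exact absurd this not_isUnit_zero
    · push Not at hu
      obtain ⟨y, hy, hyu⟩ := hu
      refine ⟨y, ?_⟩
      rw [← Finset.mul_prod_erase R _ hy] at h0
      have hu' : IsUnit (∏ z ∈ R.erase y, (φ₁ x - φ₀ z)) := by
        rw [IsUnit.prod_iff]
        intro z hz
        have hne : y - z ≠ 0 := sub_ne_zero.mpr (Finset.ne_of_mem_erase hz).symm
        by_contra hzu
        have h4 := IsLocalRing.nonunits_add (a := φ₁ x - φ₀ z) (b := -(φ₁ x - φ₀ y)) hzu
          (by rwa [mem_nonunits_iff, IsUnit.neg_iff])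
        apply h4
        have h5 : φ₁ x - φ₀ z + -(φ₁ x - φ₀ y) = φ₀ (y - z) := by rw [map_sub]; ring
        rw [h5]
        exact (isUnit_iff_ne_zero.mpr hne).map φ₀
      exact sub_eq_zero.mp ((hu'.mul_left_eq_zero).mp h0)
  choose f hf using h1
  have hinj : Function.Injective φ₀ := φ₀.injective
  let ψ : K →ₐ[k] K :=
    { toFun := f
      map_one' := hinj (by rw [← hf, map_one, map_one])
      map_mul' := fun a b => hinj (by rw [← hf, map_mul, map_mul, hf, hf])
      map_zero' := hinj (by rw [← hf, map_zero, map_zero])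
      map_add' := fun a b => hinj (by rw [← hf, map_add, map_add, hf, hf])
      commutes' := fun r => hinj (by
        rw [← hf]; exact (RingHom.congr_fun h r).symm) }
  exact ⟨AlgEquiv.ofBijective ψ (Algebra.IsAlgebraic.algHom_bijective ψ), RingHom.ext hf⟩

end LocalRing

/-! ### The continuous function to the Galois group defined by two points of `Spec K` -/

section GalAt

variable {k K : Type u} [Field k] [Field K] [Algebra k K]

lemma specGal_appTop (σ : Gal(K/k)) (x : K) :
    (specGal σ).appTop ((Scheme.ΓSpecIso (CommRingCat.of K)).inv x) =
      (Scheme.ΓSpecIso (CommRingCat.of K)).inv (σ x) :=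
  (ConcreteCategory.congr_hom (Scheme.ΓSpecIso_inv_naturality
    (CommRingCat.ofHom (σ : K →+* K))) x).symm

lemma comp_specGal_injective {O : CommRingCat.{u}} [Nontrivial O] (t : Spec O ⟶ SpecF K)
    {σ σ' : Gal(K/k)} (h : t ≫ specGal σ = t ≫ specGal σ') : σ = σ' := by
  obtain ⟨φ, rfl⟩ := Spec.map_surjective t
  rw [specGal, specGal, ← Spec.map_comp, ← Spec.map_comp] at h
  have h1 := Spec.map_injective h
  ext x
  exact φ.hom.injective (ConcreteCategory.congr_hom h1 x)

variable [IsGalois k K]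

lemma exists_eq_comp_specGal {O : CommRingCat.{u}} [IsLocalRing O] (t₀ t₁ : Spec O ⟶ SpecF K)
    (h : t₀ ≫ structureMap k K = t₁ ≫ structureMap k K) :
    ∃ σ : Gal(K/k), t₁ = t₀ ≫ specGal σ := by
  obtain ⟨φ₀, rfl⟩ := Spec.map_surjective t₀
  obtain ⟨φ₁, rfl⟩ := Spec.map_surjective t₁
  rw [← Spec.map_comp, ← Spec.map_comp] at h
  obtain ⟨σ, hσ⟩ := exists_gal_of_isLocalRing (k := k) φ₀.hom φ₁.hom
    (congrArg CommRingCat.Hom.hom (Spec.map_injective h))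
  refine ⟨σ, ?_⟩
  rw [specGal, ← Spec.map_comp]
  congr 1
  exact CommRingCat.hom_ext hσ

variable {T : Scheme.{u}} (t₀ t₁ : T ⟶ SpecF K)

lemma exists_galAt (h : t₀ ≫ structureMap k K = t₁ ≫ structureMap k K) (t : T) :
    ∃ σ : Gal(K/k), T.fromSpecStalk t ≫ t₁ = T.fromSpecStalk t ≫ t₀ ≫ specGal σ := by
  obtain ⟨σ, hσ⟩ := exists_eq_comp_specGal (k := k) (T.fromSpecStalk t ≫ t₀)
    (T.fromSpecStalk t ≫ t₁) (by rw [Category.assoc, h, Category.assoc])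
  exact ⟨σ, by rw [hσ, Category.assoc]⟩

/-- The element of the Galois group by which `t₀` and `t₁` differ at a point. -/
def galAt (h : t₀ ≫ structureMap k K = t₁ ≫ structureMap k K) (t : T) : Gal(K/k) :=
  Classical.choose (exists_galAt t₀ t₁ h t)

lemma galAt_spec (h : t₀ ≫ structureMap k K = t₁ ≫ structureMap k K) (t : T) :
    T.fromSpecStalk t ≫ t₁ = T.fromSpecStalk t ≫ t₀ ≫ specGal (galAt t₀ t₁ h t) :=
  Classical.choose_spec (exists_galAt t₀ t₁ h t)

/-- For fixed `x`, an equality of germs extends to a neighbourhood; there the injectivity of `K`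
into the local rings forces the value at `x` of the automorphism to be constant. -/
lemma continuous_galAt (h : t₀ ≫ structureMap k K = t₁ ≫ structureMap k K) :
    Continuous (galAt t₀ t₁ h) := by
  have hg : ∀ t (x : K), T.presheaf.germ ⊤ t trivial
      (t₁.appTop ((Scheme.ΓSpecIso (CommRingCat.of K)).inv x)) = T.presheaf.germ ⊤ t trivial
        (t₀.appTop ((Scheme.ΓSpecIso (CommRingCat.of K)).inv (galAt t₀ t₁ h t x))) := by
    intro t x
    have h1 := (fromSpecStalk_comp_eq_iff t).mp (galAt_spec t₀ t₁ h t)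
      ((Scheme.ΓSpecIso (CommRingCat.of K)).inv x)
    rw [appTop_comp_apply, specGal_appTop] at h1
    exact h1
  rw [continuous_gal_iff]
  intro x
  rw [IsLocallyConstant.iff_eventually_eq]
  intro t
  obtain ⟨W, htW, i, i', hW⟩ := T.presheaf.germ_eq (U := ⊤) (V := ⊤) t trivial trivial _ _ (hg t x)
  filter_upwards [W.isOpen.mem_nhds htW] with t' ht'
  have h1 := congrArg (T.presheaf.germ W t' ht') hW
  erw [TopCat.Presheaf.germ_res_apply, TopCat.Presheaf.germ_res_apply] at h1
  let φ : K →+* T.presheaf.stalk t' := (T.presheaf.germ ⊤ t' trivial).hom.comp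
    (t₀.appTop.hom.comp (Scheme.ΓSpecIso (CommRingCat.of K)).inv.hom)
  exact φ.injective ((hg t' x).symm.trans h1)

end GalAt

/-! ### Comparison of morphisms on points in local rings -/

section LocalPoints

variable {T Z : Scheme.{u}}

/-- The reduction used for all later identities: over a local ring an arrow lies above a single
element of the Galois group, so explicit formulas are available. -/
lemma hom_ext_of_local [IsAffine Z] {f g : T ⟶ Z}
    (h : ∀ (O : CommRingCat.{u}) [IsLocalRing O] (u : Spec O ⟶ T), u ≫ f = u ≫ g) : f = g :=
  hom_ext_of_fromSpecStalk fun t => h _ (T.fromSpecStalk t)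

/-- A point in a local ring factors through the spectrum of the local ring at the image of the
closed point. -/
lemma comp_eq_of_fromSpecStalk {f g : T ⟶ Z} {O : CommRingCat.{u}} [IsLocalRing O]
    (u : Spec O ⟶ T)
    (h : T.fromSpecStalk (u (IsLocalRing.closedPoint O)) ≫ f =
      T.fromSpecStalk (u (IsLocalRing.closedPoint O)) ≫ g) : u ≫ f = u ≫ g := by
  rw [← Scheme.Spec_stalkClosedPointTo_fromSpecStalk u, Category.assoc, h, Category.assoc]

/-- The gluing of a locally constant family along a continuous map to the space of parameters. -/
def LocConst.glue {M : Type*} [TopologicalSpace M] [IsAffine Z] {f : M → (T ⟶ Z)}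
    (hf : LocConst f) (e : T → M) (he : Continuous e) : T ⟶ Z :=
  Classical.choose (hf.exists_glue e he)

lemma LocConst.comp_glue {M : Type*} [TopologicalSpace M] [IsAffine Z] {f : M → (T ⟶ Z)}
    (hf : LocConst f) (e : T → M) (he : Continuous e) {O : CommRingCat.{u}} [IsLocalRing O]
    (u : Spec O ⟶ T) : u ≫ hf.glue e he = u ≫ f (e (u (IsLocalRing.closedPoint O))) :=
  comp_eq_of_fromSpecStalk u (Classical.choose_spec (hf.exists_glue e he) _)

lemma comp_galAt {k K : Type u} [Field k] [Field K] [Algebra k K] [IsGalois k K]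
    (t₀ t₁ : T ⟶ SpecF K) (h : t₀ ≫ structureMap k K = t₁ ≫ structureMap k K)
    {O : CommRingCat.{u}} [IsLocalRing O] (u : Spec O ⟶ T) :
    u ≫ t₁ = u ≫ t₀ ≫ specGal (galAt t₀ t₁ h (u (IsLocalRing.closedPoint O))) :=
  comp_eq_of_fromSpecStalk u (galAt_spec t₀ t₁ h _)

end LocalPoints

/-! ### Points in rings of affine schemes -/

section RingPoints

variable {Z Z' : Scheme.{u}} [IsAffine Z] [IsAffine Z']

/-- The point in a ring of an affine scheme defined by a homomorphism. -/
def toPt {R : Type u} [CommRing R] (φ : Γ(Z, ⊤) →+* R) : Spec (CommRingCat.of R) ⟶ Z :=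
  Spec.map (CommRingCat.ofHom φ) ≫ Z.isoSpec.inv

/-- The homomorphism defined by a point in a ring of a scheme. -/
def ofPt {Z : Scheme.{u}} {R : Type u} [CommRing R] (u : Spec (CommRingCat.of R) ⟶ Z) :
    Γ(Z, ⊤) →+* R :=
  (u.appTop ≫ (Scheme.ΓSpecIso (CommRingCat.of R)).hom).hom

lemma toPt_appTop {R : Type u} [CommRing R] (φ : Γ(Z, ⊤) →+* R) (a : Γ(Z, ⊤)) :
    (toPt φ).appTop a = (Scheme.ΓSpecIso (CommRingCat.of R)).inv (φ a) := by
  have h : toPt φ ≫ Z.toSpecΓ = Spec.map (CommRingCat.ofHom φ) := by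
    rw [toPt, Category.assoc, Scheme.isoSpec_inv_toSpecΓ]
    exact Category.comp_id _
  have h1 := congrArg Scheme.Hom.appTop h
  rw [Scheme.Hom.comp_appTop, Scheme.toSpecΓ_appTop] at h1
  have h2 : (toPt φ).appTop = CommRingCat.ofHom φ ≫ (Scheme.ΓSpecIso (CommRingCat.of R)).inv := by
    rw [Scheme.ΓSpecIso_inv_naturality, ← h1]
    exact (Iso.inv_hom_id_assoc (Scheme.ΓSpecIso Γ(Z, ⊤)) _).symm
  rw [h2]
  rfl

lemma ofPt_toPt {R : Type u} [CommRing R] (φ : Γ(Z, ⊤) →+* R) : ofPt (toPt φ) = φ := by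
  ext a
  change (Scheme.ΓSpecIso (CommRingCat.of R)).hom ((toPt φ).appTop a) = φ a
  rw [toPt_appTop]
  exact ConcreteCategory.congr_hom (Scheme.ΓSpecIso (CommRingCat.of R)).inv_hom_id (φ a)

lemma toPt_ofPt {R : Type u} [CommRing R] (u : Spec (CommRingCat.of R) ⟶ Z) :
    toPt (ofPt u) = u := by
  refine hom_ext_of_affine fun a => ?_
  rw [toPt_appTop]
  exact ConcreteCategory.congr_hom (Scheme.ΓSpecIso (CommRingCat.of R)).hom_inv_id (u.appTop a)

lemma toPt_injective {R : Type u} [CommRing R] :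
    Function.Injective (toPt : (Γ(Z, ⊤) →+* R) → (Spec (CommRingCat.of R) ⟶ Z)) :=
  Function.LeftInverse.injective ofPt_toPt

lemma toPt_comp {R : Type u} [CommRing R] (φ : Γ(Z', ⊤) →+* R) (g : Z' ⟶ Z) :
    toPt (φ.comp g.appTop.hom) = toPt φ ≫ g := by
  refine hom_ext_of_affine fun a => ?_
  rw [toPt_appTop, appTop_comp_apply, toPt_appTop]
  rfl

lemma toPt_ringHom_comp {R R' : Type u} [CommRing R] [CommRing R'] (ψ : R →+* R')
    (φ : Γ(Z, ⊤) →+* R) : toPt (ψ.comp φ) = Spec.map (CommRingCat.ofHom ψ) ≫ toPt φ := by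
  rw [toPt, CommRingCat.ofHom_comp, Spec.map_comp, Category.assoc]
  rfl

lemma toPt_comp_specF {K : Type u} [Field K] {R : Type u} [CommRing R] (φ : Γ(Z, ⊤) →+* R)
    (g : Z ⟶ SpecF K) : toPt φ ≫ g = Spec.map (CommRingCat.ofHom
      (φ.comp (g.appTop.hom.comp (Scheme.ΓSpecIso (CommRingCat.of K)).inv.hom))) := by
  refine hom_ext_of_affine fun a => ?_
  obtain ⟨x, rfl⟩ : ∃ x, (Scheme.ΓSpecIso (CommRingCat.of K)).inv x = a :=
    ⟨(Scheme.ΓSpecIso (CommRingCat.of K)).hom a,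
      ConcreteCategory.congr_hom (Scheme.ΓSpecIso (CommRingCat.of K)).hom_inv_id a⟩
  rw [appTop_comp_apply, toPt_appTop]
  exact ConcreteCategory.congr_hom (Scheme.ΓSpecIso_inv_naturality (CommRingCat.ofHom
    (φ.comp (g.appTop.hom.comp (Scheme.ΓSpecIso (CommRingCat.of K)).inv.hom)))) x

end RingPoints

/-! ### From transitive affine groupoids to groupoids of ring-valued points -/

namespace GroupoidOver

variable {k K : Type u} [Field k] [Field K] [Algebra k K] {F : GroupoidOver k K}

lemma IsTransitiveAffine.isAffine (hF : IsTransitiveAffine F) : IsAffine F.arr := by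
  have := hF.1
  exact isAffine_of_isAffineHom F.d₀d₁

lemma mul_congr {T : Scheme.{u}} {x x' y y' : T ⟶ F.arr} {h : x ≫ F.d₁ = y ≫ F.d₀} (hx : x = x')
    (hy : y = y') : F.mul x y h = F.mul x' y' (by rw [← hx, h, hy]) := by
  subst hx hy
  rfl

lemma locConst_mul {M : Type*} [TopologicalSpace M] [IsAffine F.arr] {T : Scheme.{u}}
    {x y : M → (T ⟶ F.arr)} (hx : LocConst x) (hy : LocConst y)
    (h : ∀ m, x m ≫ F.d₁ = y m ≫ F.d₀) : LocConst fun m => F.mul (x m) (y m) (h m) := by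
  refine LocConst.comp (f := fun m => pullback.lift (x m) (y m) (h m)) (LocConst.of_pullback ?_ ?_)
    F.comp
  · simpa only [pullback.lift_fst] using hx
  · simpa only [pullback.lift_snd] using hy

section

variable (F) [IsAffine F.arr]

/-- The homomorphism from `K` to the functions on `F` defined by the target. -/
def target : K →+* Γ(F.arr, ⊤) :=
  F.d₀.appTop.hom.comp (Scheme.ΓSpecIso (CommRingCat.of K)).inv.hom

/-- The homomorphism from `K` to the functions on `F` defined by the source. -/
def source : K →+* Γ(F.arr, ⊤) :=
  F.d₁.appTop.hom.comp (Scheme.ΓSpecIso (CommRingCat.of K)).inv.hom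

variable {F}

lemma toPt_d₀ {R : Type u} [CommRing R] (φ : Γ(F.arr, ⊤) →+* R) :
    toPt φ ≫ F.d₀ = Spec.map (CommRingCat.ofHom (φ.comp F.target)) := toPt_comp_specF _ _

lemma toPt_d₁ {R : Type u} [CommRing R] (φ : Γ(F.arr, ⊤) →+* R) :
    toPt φ ≫ F.d₁ = Spec.map (CommRingCat.ofHom (φ.comp F.source)) := toPt_comp_specF _ _

lemma specMap_ofHom_injective {R S : Type u} [CommRing R] [CommRing S] {φ ψ : R →+* S}
    (h : Spec.map (CommRingCat.ofHom φ) = Spec.map (CommRingCat.ofHom ψ)) : φ = ψ :=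
  congrArg CommRingCat.Hom.hom (Spec.map_injective h)

lemma toPt_composable {R : Type u} [CommRing R] {φ ψ : Γ(F.arr, ⊤) →+* R}
    (h : φ.comp F.source = ψ.comp F.target) : toPt φ ≫ F.d₁ = toPt ψ ≫ F.d₀ := by
  rw [toPt_d₁, h, toPt_d₀]

variable (F)

/-- The groupoid of points in rings of a groupoid with affine scheme of arrows. -/
def ringGroupoid : RingGroupoid K Γ(F.arr, ⊤) where
  δ₀ := F.target
  δ₁ := F.source
  mul φ ψ h := ofPt (F.mul (toPt φ) (toPt ψ) (toPt_composable h))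
  mul_δ₀ φ ψ h := specMap_ofHom_injective (by
    rw [← toPt_d₀, toPt_ofPt, CompGraph.mul_d₀, toPt_d₀])
  mul_δ₁ φ ψ h := specMap_ofHom_injective (by
    rw [← toPt_d₁, toPt_ofPt, CompGraph.mul_d₁, toPt_d₁])
  comp_mul χ φ ψ h := toPt_injective (by
    rw [toPt_ringHom_comp, toPt_ofPt, toPt_ofPt, CompGraph.comp_mul]
    exact mul_congr (toPt_ringHom_comp _ _).symm (toPt_ringHom_comp _ _).symm)
  assoc φ ψ χ h h' := by
    congr 1
    rw [mul_congr (toPt_ofPt _) rfl, F.assoc _ _ _ _ (toPt_composable h')]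
    exact mul_congr rfl (toPt_ofPt _).symm
  ε := ofPt F.ident
  ε_δ₀ := specMap_ofHom_injective (by
    rw [← toPt_d₀, toPt_ofPt, F.ident_d₀]; exact (Spec.map_id _).symm)
  ε_δ₁ := specMap_ofHom_injective (by
    rw [← toPt_d₁, toPt_ofPt, F.ident_d₁]; exact (Spec.map_id _).symm)
  one_mul φ := toPt_injective (by
    rw [toPt_ofPt]
    refine Eq.trans (mul_congr ?_ rfl) (F.ident_mul (toPt φ))
    rw [toPt_ringHom_comp, toPt_ofPt, ← toPt_d₀, Category.assoc])
  mul_one φ := toPt_injective (by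
    rw [toPt_ofPt]
    refine Eq.trans (mul_congr rfl ?_) (F.mul_ident (toPt φ))
    rw [toPt_ringHom_comp, toPt_ofPt, ← toPt_d₁, Category.assoc])
  inv := F.inv.appTop.hom
  inv_δ₀ := by
    have h := congrArg Scheme.Hom.appTop F.inv_d₀
    rw [Scheme.Hom.comp_appTop] at h
    rw [target, ← RingHom.comp_assoc, ← CommRingCat.hom_comp, h]
    rfl
  inv_δ₁ := by
    have h := congrArg Scheme.Hom.appTop F.inv_d₁
    rw [Scheme.Hom.comp_appTop] at h
    rw [source, ← RingHom.comp_assoc, ← CommRingCat.hom_comp, h]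
    rfl
  mul_inv φ := toPt_injective (by
    rw [toPt_ofPt, mul_congr rfl (toPt_comp φ F.inv), F.mul_inv, toPt_ringHom_comp, toPt_ofPt,
      ← toPt_d₀, Category.assoc])
  inv_mul φ := toPt_injective (by
    rw [toPt_ofPt, mul_congr (toPt_comp φ F.inv) rfl, F.inv_mul, toPt_ringHom_comp, toPt_ofPt,
      ← toPt_d₁, Category.assoc])

end

/-- Surjectivity of `(d₀, d₁)` gives a point of `F` above the graph `x` of `σ`; the fibre ideal is
killed by the homomorphism to the corresponding local ring, which is not zero. -/
lemma IsTransitiveAffine.fibreIdeal_ne_top (hF : IsTransitiveAffine F) [IsAffine F.arr]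
    (σ : Gal(K/k)) : F.ringGroupoid.fibreIdeal σ ≠ ⊤ := by
  have := hF.2.2
  have hσ : specGal σ ≫ structureMap k K = structureMap k K := by
    rw [specGal, ← Spec.map_comp]
    congr 1
    ext x
    exact σ.commutes x
  let x : SpecF K ⟶ pullback (structureMap k K) (structureMap k K) :=
    pullback.lift (𝟙 _) (specGal σ) (by rw [hσ, Category.id_comp])
  obtain ⟨p, -⟩ := (pullback.snd F.d₀d₁ x).surjective (IsLocalRing.closedPoint K : SpecF K)
  let q : Spec ((pullback F.d₀d₁ x).presheaf.stalk p) ⟶ F.arr :=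
    (pullback F.d₀d₁ x).fromSpecStalk p ≫ pullback.fst F.d₀d₁ x
  have hq : q ≫ F.d₁ = (q ≫ F.d₀) ≫ specGal σ := by
    have h0 : pullback.fst F.d₀d₁ x ≫ F.d₀ = pullback.snd F.d₀d₁ x := by
      have := congrArg (· ≫ pullback.fst _ _) (pullback.condition (f := F.d₀d₁) (g := x))
      simpa [d₀d₁, x, pullback.lift_fst] using this
    have h1 : pullback.fst F.d₀d₁ x ≫ F.d₁ = pullback.snd F.d₀d₁ x ≫ specGal σ := by
      have := congrArg (· ≫ pullback.snd _ _) (pullback.condition (f := F.d₀d₁) (g := x))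
      simpa [d₀d₁, x, pullback.lift_snd] using this
    simp only [q, Category.assoc, h1, ← h0]
  let φ : Γ(F.arr, ⊤) →+* (pullback F.d₀d₁ x).presheaf.stalk p := ofPt q
  have hφ : φ.comp F.source = (φ.comp F.target).comp (σ : K →+* K) := by
    apply specMap_ofHom_injective
    rw [← toPt_d₁, toPt_ofPt]
    refine hq.trans ?_
    rw [CommRingCat.ofHom_comp, Spec.map_comp, ← toPt_d₀, toPt_ofPt]
    rfl
  have hle : F.ringGroupoid.fibreIdeal σ ≤ RingHom.ker φ := by
    rw [RingGroupoid.fibreIdeal, Ideal.span_le]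
    rintro _ ⟨y, rfl⟩
    change φ (F.source y - F.target (σ y)) = 0
    rw [map_sub, sub_eq_zero]
    exact RingHom.congr_fun hφ y
  intro htop
  rw [htop, top_le_iff] at hle
  exact RingHom.ker_ne_top φ hle

variable [PerfectField k] [IsAlgClosure k K]

/-- The projection of the points of a transitive affine groupoid to the Galois group has a
continuous section. -/
theorem IsTransitiveAffine.exists_section (hF : IsTransitiveAffine F) :
    ∃ s : Gal(K/k) → F.KPoints, Continuous s ∧ ∀ σ, gal (s σ) = σ := by
  have := hF.isAffine
  obtain ⟨s, hs₀, hs₁, hs⟩ := F.ringGroupoid.exists_section hF.fibreIdeal_ne_top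
  refine ⟨fun σ => ⟨toPt (s σ), ?_⟩, ?_, fun σ => ?_⟩
  · rw [toPt_d₀]
    exact (congrArg (fun φ => Spec.map (CommRingCat.ofHom φ)) (hs₀ σ)).trans (Spec.map_id _)
  · apply continuous_induced_rng.mpr
    rw [continuous_krullTop_iff]
    intro a
    simp only [Function.comp_def, toPt_appTop]
    exact (hs a).comp _
  · apply specGal_injective
    rw [specGal_gal, toPt_d₁]
    exact congrArg (fun φ => Spec.map (CommRingCat.ofHom φ)) (hs₁ σ)

end GroupoidOver

/-! ### Points of group schemes and of groupoids in a scheme -/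

section GroupPoints

variable {k K : Type u} [Field k] [Field K] [Algebra k K] {D D' : Grp (Over (SpecF K))}
variable {T T' : Scheme.{u}}

lemma mul_left_eq {X : Over (SpecF K)} (x y : X ⟶ D.X) :
    (x * y).left = pullback.lift x.left y.left (by rw [Over.w, Over.w]) ≫ (μ[D.X]).left := rfl

/-- Inverse image of the points over `K` of a group scheme. -/
def preHom (D : Grp (Over (SpecF K))) {t : T ⟶ SpecF K} {t' : T' ⟶ SpecF K} (v : T' ⟶ T)
    (h : v ≫ t = t') : (Over.mk t ⟶ D.X) →* (Over.mk t' ⟶ D.X) where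
  toFun x := (Over.homMk v h : Over.mk t' ⟶ Over.mk t) ≫ x
  map_one' := MonObj.comp_one _
  map_mul' _ _ := MonObj.comp_mul _ _ _

lemma preHom_left {t : T ⟶ SpecF K} {t' : T' ⟶ SpecF K} (v : T' ⟶ T)
    (h : v ≫ t = t') (x : Over.mk t ⟶ D.X) : (preHom D v h x).left = v ≫ x.left := rfl

/-- The homomorphism induced by a homomorphism of group schemes on the points over `K`. -/
def mapHom (h : D ⟶ D') (X : Over (SpecF K)) : (X ⟶ D.X) →* (X ⟶ D'.X) where
  toFun x := x ≫ h.hom.hom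
  map_one' := MonObj.one_comp _
  map_mul' _ _ := MonObj.mul_comp _ _ _

lemma mapHom_left (h : D ⟶ D') {X : Over (SpecF K)} (x : X ⟶ D.X) :
    (mapHom h X x).left = x.left ≫ h.hom.hom.left := rfl

lemma IsSemilinearHom.mul_left {σ : Gal(K/k)} {f : D.X.left ⟶ D'.X.left}
    (hf : IsSemilinearHom σ f) {t t' : T ⟶ SpecF K} (h : t ≫ specGal σ⁻¹ = t')
    (x y : Over.mk t ⟶ D.X) : (x * y).left ≫ f =
      (Over.homMk (U := Over.mk t') (V := D'.X) (x.left ≫ f)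
          (by rw [Category.assoc, hf.over_specGal, Over.w_assoc]; exact h) *
        Over.homMk (U := Over.mk t') (V := D'.X) (y.left ≫ f)
          (by rw [Category.assoc, hf.over_specGal, Over.w_assoc]; exact h)).left := by
  rw [mul_left_eq, mul_left_eq, Category.assoc, hf.mul_comp, ← Category.assoc]
  congr 1
  apply pullback.hom_ext
  · simp [pullback.lift_fst, pullback.lift_fst_assoc]
  · simp [pullback.lift_snd, pullback.lift_snd_assoc]

/-- The homomorphism induced on points by a semilinear homomorphism. -/
def IsSemilinearHom.semiHom {σ : Gal(K/k)} {f : D.X.left ⟶ D'.X.left}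
    (hf : IsSemilinearHom σ f) {t t' : T ⟶ SpecF K} (h : t ≫ specGal σ⁻¹ = t') :
    (Over.mk t ⟶ D.X) →* (Over.mk t' ⟶ D'.X) :=
  MonoidHom.mk' (fun x => Over.homMk (U := Over.mk t') (V := D'.X) (x.left ≫ f)
      (by rw [Category.assoc, hf.over_specGal, Over.w_assoc]; exact h)) (fun x y => by
    apply Over.OverMorphism.ext
    exact hf.mul_left h x y)

lemma IsSemilinearHom.semiHom_left {σ : Gal(K/k)} {f : D.X.left ⟶ D'.X.left}
    (hf : IsSemilinearHom σ f) {t t' : T ⟶ SpecF K} (h : t ≫ specGal σ⁻¹ = t')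
    (x : Over.mk t ⟶ D.X) : (hf.semiHom h x).left = x.left ≫ f := rfl

/-- Compatibility with the product follows from the universal pair of points; compatibility with the
unit then holds because its image is idempotent in a group. -/
lemma isSemilinearHom_of_mul {σ : Gal(K/k)} {f : D.X.left ⟶ D'.X.left}
    (h : f ≫ D'.X.hom = D.X.hom ≫ specGal σ⁻¹)
    (hf : ∀ {T : Scheme.{u}} (t t' : T ⟶ SpecF K) (ht : t ≫ specGal σ⁻¹ = t')
      (x y : Over.mk t ⟶ D.X), (x * y).left ≫ f =
      (Over.homMk (U := Over.mk t') (V := D'.X) (x.left ≫ f)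
          (by rw [Category.assoc, h, Over.w_assoc]; exact ht) *
        Over.homMk (U := Over.mk t') (V := D'.X) (y.left ≫ f)
          (by rw [Category.assoc, h, Over.w_assoc]; exact ht)).left) :
    IsSemilinearHom σ f where
  over_specGal := h
  mul_comp := by
    have h1 := hf (D.X ⊗ D.X).hom _ rfl (CartesianMonoidalCategory.fst D.X D.X)
      (CartesianMonoidalCategory.snd D.X D.X)
    have h2 : (CartesianMonoidalCategory.fst D.X D.X * CartesianMonoidalCategory.snd D.X D.X) =
        μ[D.X] := by
      rw [Hom.mul_def, CartesianMonoidalCategory.lift_fst_snd, Category.id_comp]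
    have h3 := (congrArg (fun z => Over.Hom.left z ≫ f) h2).symm.trans h1
    refine h3.trans ?_
    rw [mul_left_eq]
    congr 1
  one_comp := by
    let x : Over.mk (specGal σ⁻¹) ⟶ D'.X := Over.homMk (U := Over.mk (specGal σ⁻¹)) (V := D'.X)
      ((η[D.X]).left ≫ f) (by
        rw [Category.assoc, h, Over.w_assoc]
        exact Category.id_comp _)
    have h1 := hf (T := SpecF K) (𝟙 _) (specGal σ⁻¹) (Category.id_comp _) (η[D.X]) (η[D.X])
    have h2 : (η[D.X] * η[D.X] : 𝟙_ (Over (SpecF K)) ⟶ D.X) = η[D.X] := by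
      rw [MonObj.one_eq_one, mul_one]
    have h3 : x * x = x := by
      apply Over.OverMorphism.ext
      exact h1.symm.trans (congrArg (fun z => Over.Hom.left z ≫ f) h2)
    have h4 : x = 1 := mul_eq_left.mp h3
    exact congrArg Over.Hom.left h4

end GroupPoints

/-! ### The groupoid of points of `F` in a scheme -/

namespace GroupoidOver

variable {k K : Type u} [Field k] [Field K] [Algebra k K] {F : GroupoidOver k K}
variable {T T' : Scheme.{u}}

/-- The objects of the groupoid of points of `F` in a scheme. -/
structure PtObj (F : GroupoidOver k K) (T : Scheme.{u}) where
  /-- the underlying point of `Spec K` -/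
  t : T ⟶ SpecF K

/-- The arrows of the groupoid of points of `F` in a scheme. -/
@[ext]
structure PtHom (a b : PtObj F T) where
  /-- the underlying point of `F` -/
  val : T ⟶ F.arr
  val_d₀ : val ≫ F.d₀ = a.t
  val_d₁ : val ≫ F.d₁ = b.t

instance : Category (PtObj F T) where
  Hom := PtHom
  id a := ⟨a.t ≫ F.ident, by simp [F.ident_d₀], by simp [F.ident_d₁]⟩
  comp x y := ⟨F.mul x.val y.val (x.val_d₁.trans y.val_d₀.symm),
    (F.mul_d₀ _ _ _).trans x.val_d₀, (F.mul_d₁ _ _ _).trans y.val_d₁⟩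
  id_comp x := PtHom.ext (by
    refine Eq.trans ?_ (F.ident_mul x.val)
    exact mul_congr ((congrArg (· ≫ F.ident) x.val_d₀.symm).trans (Category.assoc _ _ _)) rfl)
  comp_id x := PtHom.ext (by
    refine Eq.trans ?_ (F.mul_ident x.val)
    exact mul_congr rfl ((congrArg (· ≫ F.ident) x.val_d₁.symm).trans (Category.assoc _ _ _)))
  assoc x y z := PtHom.ext (F.assoc _ _ _ _ _)

instance : CategoryTheory.Groupoid (PtObj F T) where
  inv x := ⟨x.val ≫ F.inv, by rw [Category.assoc, F.inv_d₀, x.val_d₁],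
    by rw [Category.assoc, F.inv_d₁, x.val_d₀]⟩
  inv_comp x := PtHom.ext (by
    refine (F.inv_mul x.val).trans ?_
    rw [← Category.assoc, x.val_d₁]
    rfl)
  comp_inv x := PtHom.ext (by
    refine (F.mul_inv x.val).trans ?_
    rw [← Category.assoc, x.val_d₀]
    rfl)

lemma ptHom_comp_val {a b c : PtObj F T} (x : a ⟶ b) (y : b ⟶ c) :
    (x ≫ y).val = F.mul x.val y.val (x.val_d₁.trans y.val_d₀.symm) := rfl

lemma ptHom_inv_val {a b : PtObj F T} (x : a ⟶ b) :
    PtHom.val (CategoryTheory.inv x) = x.val ≫ F.inv := by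
  rw [← Groupoid.inv_eq_inv]
  rfl

/-- The arrow defined by a point of the diagonal. -/
def diagHom {t : T ⟶ SpecF K} (x : Over.mk t ⟶ F.diag) : (⟨t⟩ : PtObj F T) ⟶ ⟨t⟩ :=
  PtHom.mk (x.left ≫ F.diagι) (by rw [Category.assoc, diagι_d₀]; exact Over.w x)
    (by rw [Category.assoc, diagι_d₁]; exact Over.w x)

lemma diagHom_val {t : T ⟶ SpecF K} (x : Over.mk t ⟶ F.diag) :
    (diagHom x).val = x.left ≫ F.diagι := rfl

lemma diagHom_mul {t : T ⟶ SpecF K} (x y : Over.mk t ⟶ F.diag) :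
    diagHom (x * y) = diagHom x ≫ diagHom y := PtHom.ext (F.diag_mul_left x y)

lemma diagHom_injective {t : T ⟶ SpecF K} :
    Function.Injective (diagHom : (Over.mk t ⟶ F.diag) → _) := by
  intro x y h
  apply Over.OverMorphism.ext
  exact diag_hom_ext (congrArg PtHom.val h)

lemma diagHom_one (t : T ⟶ SpecF K) : diagHom (1 : Over.mk t ⟶ F.diag) = 𝟙 _ := by
  have h := diagHom_mul (1 : Over.mk t ⟶ F.diag) 1
  rw [mul_one] at h
  rw [← cancel_epi (diagHom (1 : Over.mk t ⟶ F.diag)), ← h, Category.comp_id]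

lemma diagHom_inv {t : T ⟶ SpecF K} (x : Over.mk t ⟶ F.diag) :
    diagHom x⁻¹ = CategoryTheory.inv (diagHom x) := by
  rw [← cancel_epi (diagHom x), ← diagHom_mul, mul_inv_cancel, diagHom_one, IsIso.hom_inv_id]

lemma exists_diagHom {t : T ⟶ SpecF K} (x : (⟨t⟩ : PtObj F T) ⟶ ⟨t⟩) :
    ∃ y : Over.mk t ⟶ F.diag, diagHom y = x :=
  ⟨Over.homMk (diagLift x.val t x.val_d₀ x.val_d₁) (diagLift_hom _ _ x.val_d₀ x.val_d₁),
    PtHom.ext (diagLift_ι x.val t x.val_d₀ x.val_d₁)⟩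

variable [IsAlgClosure k K]

/-- The arrow defined by a point of `F(K)_K`. -/
def kHom (v : F.KPoints) {t t' : T ⟶ SpecF K} (h : t ≫ specGal (gal v) = t') :
    (⟨t⟩ : PtObj F T) ⟶ ⟨t'⟩ :=
  PtHom.mk (t ≫ v.val) (by rw [Category.assoc, v.val_d₀, Category.comp_id])
    (by rw [Category.assoc, ← specGal_gal, h])

lemma kHom_val (v : F.KPoints) {t t' : T ⟶ SpecF K} (h : t ≫ specGal (gal v) = t') :
    (kHom v h).val = t ≫ v.val := rfl

lemma kHom_mul (v w : F.KPoints) {t t' t'' : T ⟶ SpecF K} (h : t ≫ specGal (gal v) = t')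
    (h' : t' ≫ specGal (gal w) = t'') :
    kHom (v * w) (by rw [gal_mul, specGal_mul, ← Category.assoc, h, h']) =
      kHom v h ≫ kHom w h' := PtHom.ext (by
  rw [kHom_val, KPoints.mul_val, CompGraph.comp_mul, ptHom_comp_val]
  exact mul_congr rfl (by rw [kHom_val, ← h, Category.assoc]))

lemma kHom_one (t : T ⟶ SpecF K) :
    kHom (1 : F.KPoints) (t := t) (by rw [gal_one, specGal_one, Category.comp_id]) = 𝟙 _ := rfl

/-- This expresses the action as a conjugation in the category of points, where later identities
follow by cancelling isomorphisms. -/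
lemma diagHom_actHom (v : F.KPoints) {t t' : T ⟶ SpecF K} (h : t' ≫ specGal (gal v) = t)
    (x : Over.mk t ⟶ F.diag) :
    x.left ≫ actHom v ≫ F.diagι =
      (kHom v h ≫ diagHom x ≫ CategoryTheory.inv (kHom v h)).val := by
  have h1 : x.left ≫ actPoint v = t' ≫ v.val := by
    have h2 : x.left ≫ F.diag.hom = t := Over.w x
    rw [actPoint, ← Category.assoc, h2, ← h, Category.assoc, ← Category.assoc (specGal (gal v)),
      specGal_comp_inv, Category.id_comp]
  rw [actHom_ι, comp_conjPoint, ← Category.assoc (kHom v h), ptHom_comp_val]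
  refine mul_congr ?_ ?_
  · rw [ptHom_comp_val]
    exact mul_congr h1 rfl
  · rw [h1, ptHom_inv_val]
    rfl

end GroupoidOver

/-! ### Continuity in terms of locally constant families -/

lemma locConst_specGal_iff {k K : Type u} [Field k] [Field K] [Algebra k K]
    [Algebra.IsAlgebraic k K] {M : Type*} [TopologicalSpace M] (g : M → Gal(K/k)) :
    LocConst (fun m => specGal (g m)) ↔ Continuous g := by
  rw [continuous_gal_iff]
  have h0 : ∀ x : K, (fun m => (specGal (g m)).appTop
      ((Scheme.ΓSpecIso (CommRingCat.of K)).inv x)) =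
      fun m => (Scheme.ΓSpecIso (CommRingCat.of K)).inv (g m x) :=
    fun x => funext fun m => specGal_appTop (g m) x
  constructor
  · intro h x
    have h1 := h ((Scheme.ΓSpecIso (CommRingCat.of K)).inv x)
    rw [h0] at h1
    convert h1.comp (Scheme.ΓSpecIso (CommRingCat.of K)).hom using 1
    ext m
    exact (ConcreteCategory.congr_hom (Scheme.ΓSpecIso (CommRingCat.of K)).inv_hom_id (g m x)).symm
  · intro h a
    obtain ⟨x, rfl⟩ : ∃ x, (Scheme.ΓSpecIso (CommRingCat.of K)).inv x = a :=
      ⟨(Scheme.ΓSpecIso (CommRingCat.of K)).hom a,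
        ConcreteCategory.congr_hom (Scheme.ΓSpecIso (CommRingCat.of K)).hom_inv_id a⟩
    rw [h0]
    exact (h x).comp _

lemma locConst_of_surjective {M : Type*} [TopologicalSpace M] {T Z Z' : Scheme.{u}}
    {f : M → (T ⟶ Z)} (j : Z ⟶ Z') (hj : Function.Surjective j.appTop)
    (hf : LocConst fun m => f m ≫ j) : LocConst f := by
  intro a
  obtain ⟨b, rfl⟩ := hj a
  simpa only [appTop_comp_apply] using hf b

lemma continuous_points_iff {K : Type u} [Field K] {D : Grp (Over (SpecF K))} [IsAffine D.X.left]
    {M : Type*} [TopologicalSpace M] (f : M → Points D) :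
    Continuous f ↔ LocConst fun m => (f m).left := by
  rw [← continuous_krullTop_iff]
  let := krullTop K D.X.left
  exact continuous_induced_rng

/-! ### The Galois extended group of a transitive affine groupoid -/

namespace GroupoidOver

variable {k K : Type u} [Field k] [Field K] [Algebra k K] {F : GroupoidOver k K}

lemma continuous_kPoints_iff [IsAffine F.arr] {M : Type*} [TopologicalSpace M]
    (f : M → F.KPoints) : Continuous f ↔ LocConst fun m => (f m).val := by
  rw [← continuous_krullTop_iff]
  let := krullTop K F.arr
  exact continuous_induced_rng

instance : IsClosedImmersion F.diagι :=
  inferInstanceAs (IsClosedImmersion (pullback.fst F.d₀d₁ (pullback.diagonal (structureMap k K))))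

instance [IsAffine F.arr] : IsAffine F.diag.left :=
  (IsClosedImmersion.isAffine_surjective_of_isAffine F.diagι).1

lemma diagι_appTop_surjective [IsAffine F.arr] : Function.Surjective F.diagι.appTop :=
  (IsClosedImmersion.isAffine_surjective_of_isAffine F.diagι).2

lemma locConst_val [IsAffine F.arr] : LocConst fun e : F.KPoints => e.val :=
  (continuous_kPoints_iff _).mp continuous_id

variable [IsAlgClosure k K]

lemma continuous_gal [IsAffine F.arr] : Continuous (gal : F.KPoints → Gal(K/k)) := by
  have : Algebra.IsAlgebraic k K := IsAlgClosure.isAlgebraic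
  rw [← locConst_specGal_iff]
  simp only [specGal_gal]
  exact locConst_val.comp F.d₁

lemma locConst_specGal_gal [IsAffine F.arr] : LocConst fun e : F.KPoints => specGal (gal e) := by
  have : Algebra.IsAlgebraic k K := IsAlgClosure.isAlgebraic
  exact (locConst_specGal_iff _).mpr continuous_gal

lemma locConst_specGal_gal_inv [IsAffine F.arr] : LocConst fun e : F.KPoints => specGal (gal e)⁻¹ := by
  have : Algebra.IsAlgebraic k K := IsAlgClosure.isAlgebraic
  exact (locConst_specGal_iff _).mpr continuous_gal.inv

instance [IsAffine F.arr] : IsTopologicalGroup F.KPoints where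
  continuous_mul := by
    rw [continuous_kPoints_iff]
    exact locConst_mul (locConst_val.comp_continuous continuous_fst)
      ((locConst_specGal_gal.comp_continuous continuous_fst).comp_family
        (locConst_val.comp_continuous continuous_snd)) _
  continuous_inv := by
    rw [continuous_kPoints_iff]
    exact locConst_specGal_gal_inv.comp_family (locConst_val.comp F.inv)

/-- Functions on the closed subscheme `F^diag` lift to `F`, so it suffices to consider the conjugate
as a point of `F`, a product of locally constant families. -/
lemma locConst_actHom [IsAffine F.arr] : LocConst fun e : F.KPoints => actHom e := by
  apply locConst_of_surjective F.diagι diagι_appTop_surjective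
  simp only [actHom_ι]
  have h : LocConst fun e : F.KPoints => actPoint e :=
    (locConst_specGal_gal_inv.comp_family locConst_val).precomp F.diag.hom
  exact locConst_mul (locConst_mul h (locConst_const _) _) (h.comp F.inv) _

lemma range_diagPoints : F.diagPoints.range = F.galHom.ker := by
  ext v
  constructor
  · rintro ⟨d, rfl⟩
    exact gal_diagPoint d
  · intro hv
    have hv : gal v = 1 := hv
    have h1 : v.val ≫ F.d₁ = 𝟙 _ := by rw [← specGal_gal, hv, specGal_one]
    refine ⟨(Over.homMk (diagLift v.val (𝟙 _) v.val_d₀ h1) (diagLift_hom _ _ _ _) :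
      𝟙_ (Over (SpecF K)) ⟶ F.diag), KPoints.ext ?_⟩
    exact diagLift_ι v.val (𝟙 _) v.val_d₀ h1

lemma diagPoints_val (d : Points F.diagGrp) : (F.diagPoints d).val = d.left ≫ F.diagι := rfl

lemma continuous_diagPoints [IsAffine F.arr] : Continuous F.diagPoints := by
  refine (continuous_kPoints_iff (M := Points F.diagGrp) _).mpr ?_
  have h : LocConst fun d : Points F.diagGrp => d.left :=
    (continuous_points_iff (D := F.diagGrp) _).mp continuous_id
  exact h.comp F.diagι

lemma continuous_of_continuous_diagPoints [IsAffine F.arr] {M : Type u} [TopologicalSpace M]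
    (f : M → Points F.diagGrp) (hf : Continuous fun m => F.diagPoints (f m)) : Continuous f := by
  refine (continuous_points_iff (D := F.diagGrp) _).mpr ?_
  refine locConst_of_surjective F.diagι diagι_appTop_surjective ?_
  have h := (continuous_kPoints_iff _).mp hf
  simp only [diagPoints_val] at h
  exact h

/-- Since all functions on `F^diag` are restrictions of functions on `F`, the two topologies on its
points coincide. -/
lemma isEmbedding_diagPoints [IsAffine F.arr] : Topology.IsEmbedding F.diagPoints := by
  have hinj : Function.Injective F.diagPoints := by
    intro d d' h
    apply Over.OverMorphism.ext
    exact diag_hom_ext (congrArg KPoints.val h)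
  refine ⟨⟨le_antisymm continuous_diagPoints.le_induced ?_⟩, hinj⟩
  rw [← continuous_id_iff_le]
  exact @continuous_of_continuous_diagPoints _ _ _ _ _ F _ _ _
    (TopologicalSpace.induced F.diagPoints inferInstance) id continuous_induced_dom

/-- Conjugation by an arrow is multiplicative; it changes the base point by `γ v`, which is the
semilinearity. -/
lemma isSemilinearHom_actHom (v : F.KPoints) :
    IsSemilinearHom (D := F.diagGrp) (D' := F.diagGrp) (gal v) (actHom v) := by
  refine isSemilinearHom_of_mul (D := F.diagGrp) (D' := F.diagGrp) (actHom_hom v)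
    fun {T} t t' ht x y => ?_
  have ht' : t' ≫ specGal (gal v) = t := by
    rw [← ht, Category.assoc, specGal_inv_comp, Category.comp_id]
  apply diag_hom_ext
  have h1 : ∀ (x : Over.mk t ⟶ F.diag) (hx : (x.left ≫ actHom v) ≫ F.diag.hom = t'),
      diagHom (Over.homMk (U := Over.mk t') (V := F.diag) (x.left ≫ actHom v) hx) =
      kHom v ht' ≫ diagHom x ≫ CategoryTheory.inv (kHom v ht') := fun x hx =>
    PtHom.ext ((Category.assoc _ _ _).trans (diagHom_actHom v ht' x))
  refine Eq.trans ?_ (congrArg PtHom.val (diagHom_mul (F := F) _ _).symm)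
  rw [h1, h1, Category.assoc, diagHom_actHom v ht' (x * y), diagHom_mul]
  simp

lemma diagPoints_semilinearOnPoints (e : F.KPoints) (d : Points F.diagGrp) :
    F.diagPoints (semilinearOnPoints (D := F.diagGrp) (D' := F.diagGrp) (gal e) (actHom e)
      (actHom_hom e) d) = e * F.diagPoints d * e⁻¹ := by
  apply KPoints.ext
  have h : 𝟙 _ ≫ specGal (gal e) = specGal (gal e) := Category.id_comp _
  let x : Over.mk (specGal (gal e)) ⟶ F.diag := preHom F.diagGrp (specGal (gal e))
    (Category.comp_id _) (d : 𝟙_ (Over (SpecF K)) ⟶ F.diag)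
  have h1 := diagHom_actHom e (t' := 𝟙 _) h x
  change (specGal (gal e) ≫ d.left ≫ actHom e) ≫ F.diagι = _
  have h2 : (specGal (gal e) ≫ d.left ≫ actHom e) ≫ F.diagι =
      x.left ≫ actHom e ≫ F.diagι := by simp only [Category.assoc]; rfl
  have hg : gal (F.diagPoints d) = 1 := gal_diagPoint d
  rw [h2, h1, ← Category.assoc (kHom e h), KPoints.mul_val]
  refine mul_congr ?_ ?_
  · refine mul_congr (Category.id_comp _) ?_
    exact Category.assoc _ _ _
  · rw [ptHom_inv_val, kHom_val, Category.id_comp, gal_mul, hg, mul_one,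
      KPoints.inv_val, ← Category.assoc, specGal_comp_inv, Category.id_comp]

lemma actHom_diagPoints (d : Points F.diagGrp) :
    actHom (F.diagPoints d) = (conjHom (D := F.diagGrp) d).left := by
  apply diag_hom_ext
  let x : Over.mk F.diag.hom ⟶ F.diag := 𝟙 F.diag
  let y : Over.mk F.diag.hom ⟶ F.diag := CartesianMonoidalCategory.toUnit F.diag ≫ d
  have hg : gal (F.diagPoints d) = 1 := gal_diagPoint d
  have ht : F.diag.hom ≫ specGal (gal (F.diagPoints d)) = F.diag.hom := by
    rw [hg, specGal_one, Category.comp_id]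
  have h1 := diagHom_actHom (F.diagPoints d) ht x
  have h2 : kHom (F.diagPoints d) ht = diagHom y := PtHom.ext (by
    rw [kHom_val, diagHom_val]
    exact (Category.assoc _ _ _).symm)
  rw [h2, ← diagHom_inv, ← diagHom_mul, ← diagHom_mul, ← mul_assoc] at h1
  exact (Category.id_comp _).symm.trans h1

/-- The pair `(F^diag, F(K)_K)` is a Galois extended group. -/
theorem IsTransitiveAffine.isGaloisExtended [PerfectField k] [IsAffine F.arr] (hF : IsTransitiveAffine F) :
    (F.extData).IsGaloisExtended where
  affine := inferInstanceAs (IsAffine F.diag.left)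
  topologicalGroup := inferInstanceAs (IsTopologicalGroup F.KPoints)
  continuous_proj := continuous_gal
  isEmbedding_incl := isEmbedding_diagPoints
  range_incl := range_diagPoints
  local_section σ := by
    obtain ⟨s, hs, hs'⟩ := hF.exists_section
    exact ⟨Set.univ, isOpen_univ, trivial, s, hs.continuousOn, fun τ _ => hs' τ⟩
  continuous_act := locConst_actHom.isContinuousAction (a := F.diagAct)
  semilinear e := isSemilinearHom_actHom e
  act_points e d := diagPoints_semilinearOnPoints e d
  act_incl d := actHom_diagPoints d

end GroupoidOver

/-! ### Morphisms of groupoids and morphisms of Galois extended groups -/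

section ConstPt

variable {K : Type u} [Field K] {T T' : Scheme.{u}}

/-- The constant points of a group scheme over `K`. -/
def constPt (D : Grp (Over (SpecF K))) (t : T ⟶ SpecF K) : Points D →* (Over.mk t ⟶ D.X) where
  toFun d := CartesianMonoidalCategory.toUnit (Over.mk t) ≫ (d : 𝟙_ (Over (SpecF K)) ⟶ D.X)
  map_one' := MonObj.comp_one _
  map_mul' _ _ := MonObj.comp_mul _ _ _

lemma constPt_left {D : Grp (Over (SpecF K))} (t : T ⟶ SpecF K) (d : Points D) :
    (constPt D t d).left = t ≫ d.left := rfl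

lemma mapHom_constPt {D D' : Grp (Over (SpecF K))} (h : D ⟶ D') (t : T ⟶ SpecF K)
    (d : Points D) : mapHom h _ (constPt D t d) = constPt D' t (Points.map h d) := by
  apply Over.OverMorphism.ext
  exact Category.assoc _ _ _

end ConstPt

namespace GroupoidOver

variable {k K : Type u} [Field k] [Field K] [Algebra k K] {F F' : GroupoidOver k K}
variable {T T' : Scheme.{u}} [IsAlgClosure k K]

lemma diagHom_semiHom (v : F.KPoints) {t t' : T ⟶ SpecF K} (ht : t ≫ specGal (gal v)⁻¹ = t')
    (ht' : t' ≫ specGal (gal v) = t) (x : Over.mk t ⟶ F.diag) :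
    diagHom ((isSemilinearHom_actHom v).semiHom ht x) =
      kHom v ht' ≫ diagHom x ≫ CategoryTheory.inv (kHom v ht') :=
  PtHom.ext ((Category.assoc _ _ _).trans (diagHom_actHom v ht' x))

lemma kHom_diagPoints (d : Points F.diagGrp) {t : T ⟶ SpecF K}
    (h : t ≫ specGal (gal (F.diagPoints d)) = t) :
    kHom (F.diagPoints d) h = diagHom (F := F) (constPt F.diagGrp t d) :=
  PtHom.ext (Category.assoc _ _ _).symm

lemma gal_diagPoints (d : Points F.diagGrp) : gal (F.diagPoints d) = 1 := gal_diagPoint d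

lemma kHom_eq_diagHom_comp {d : Points F.diagGrp} {e e' : F.KPoints} (h : e = F.diagPoints d * e')
    {t t' : T ⟶ SpecF K} (ht : t ≫ specGal (gal e) = t') (ht' : t ≫ specGal (gal e') = t') :
    kHom e ht = diagHom (F := F) (constPt F.diagGrp t d) ≫ kHom e' ht' := by
  subst h
  have h2 : t ≫ specGal (gal (F.diagPoints d)) = t := by
    rw [gal_diagPoints, specGal_one, Category.comp_id]
  rw [← kHom_diagPoints d h2, ← kHom_mul (F.diagPoints d) e' h2 ht']

/-- Every arrow above an element of the Galois group is the composite of an arrow of the diagonal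
and of a given point above this element. -/
lemma exists_eq_diagHom_comp_kHom (e : F.KPoints) {t t' : T ⟶ SpecF K}
    (h : t ≫ specGal (gal e) = t') (x : (⟨t⟩ : PtObj F T) ⟶ ⟨t'⟩) :
    ∃ y : Over.mk t ⟶ F.diag, x = diagHom y ≫ kHom e h := by
  obtain ⟨y, hy⟩ := exists_diagHom (x ≫ CategoryTheory.inv (kHom e h))
  exact ⟨y, by rw [hy, Category.assoc, IsIso.inv_hom_id, Category.comp_id]⟩

lemma exists_kPoint_of_local [PerfectField k] (hF : IsTransitiveAffine F) {O : CommRingCat.{u}}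
    [IsLocalRing O] (x : Spec O ⟶ F.arr) :
    ∃ e : F.KPoints, (x ≫ F.d₀) ≫ specGal (gal e) = x ≫ F.d₁ := by
  obtain ⟨σ, hσ⟩ := exists_eq_comp_specGal (k := k) (x ≫ F.d₀) (x ≫ F.d₁)
    (by rw [Category.assoc, F.d_over, Category.assoc])
  obtain ⟨s, -, hs⟩ := hF.exists_section
  exact ⟨s σ, by rw [hs, hσ]⟩

/-- A point in a local ring is a composite of a point of the diagonal and a point of `F(K)_K`, and
both images are prescribed. -/
lemma Hom.faithful_of_transitiveAffine [PerfectField k] (hF : IsTransitiveAffine F)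
    [IsAffine F'.arr] {f g : F ⟶ F'} (hd : diagMapOver f = diagMapOver g)
    (hp : ∀ e, pointsMap f e = pointsMap g e) : f = g := by
  apply Hom.ext
  refine hom_ext_of_local fun O _ x => ?_
  obtain ⟨e, he⟩ := exists_kPoint_of_local hF x
  obtain ⟨y, hy⟩ := exists_eq_diagHom_comp_kHom e he (PtHom.mk x rfl rfl)
  have hx : x = (diagHom y ≫ kHom e he).val := congrArg PtHom.val hy
  have h1 : ∀ f : F ⟶ F', x ≫ f.left = F'.mul (y.left ≫ (diagMapOver f).left ≫ F'.diagι)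
      ((x ≫ F.d₀) ≫ (pointsMap f e).val) (by
        have h2 : y.left ≫ F.diag.hom = x ≫ F.d₀ := Over.w y
        simp only [Category.assoc, diagι_d₁, (pointsMap f e).val_d₀, Category.comp_id, Over.w, h2]) := by
    intro f
    refine (congrArg (· ≫ Hom.left f) hx).trans ((Hom.map_mul f _ _ _).trans (mul_congr ?_ ?_))
    · rw [diagHom_val, diagMapOver_ι, Category.assoc]
    · rw [kHom_val, pointsMap, Category.assoc]
  rw [h1 f, h1 g]
  exact mul_congr (by rw [hd]) (by rw [hp])

/-- The compatibilities of the pair `(h, l)` given by a morphism of Galois extended groups. -/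
structure IsCompatible (h : F.diagGrp ⟶ F'.diagGrp) (l : F.KPoints →* F'.KPoints) : Prop where
  continuous : Continuous l
  l_incl : ∀ d, l (F.diagPoints d) = F'.diagPoints (Points.map h d)
  gal_l : ∀ e, gal (l e) = gal e
  act_h : ∀ e, actHom e ≫ h.hom.hom.left = h.hom.hom.left ≫ actHom (l e)

namespace IsCompatible

variable {h : F.diagGrp ⟶ F'.diagGrp} {l : F.KPoints →* F'.KPoints}

lemma comp_specGal (hc : IsCompatible h l) {e : F.KPoints} {t t' : T ⟶ SpecF K}
    (ht : t ≫ specGal (gal e) = t') : t ≫ specGal (gal (l e)) = t' := by rw [hc.gal_l, ht]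

/-- The image of a point depends only on the point. -/
lemma comp_kHom_eq (hc : IsCompatible h l) {e e' : F.KPoints} {t t' : T ⟶ SpecF K}
    (ht : t ≫ specGal (gal e) = t') (ht' : t ≫ specGal (gal e') = t') (hee : gal e = gal e')
    (y y' : Over.mk t ⟶ F.diag) (hy : diagHom y ≫ kHom e ht = diagHom y' ≫ kHom e' ht') :
    diagHom (F := F') (mapHom h _ y) ≫ kHom (l e) (hc.comp_specGal ht) =
      diagHom (F := F') (mapHom h _ y') ≫ kHom (l e') (hc.comp_specGal ht') := by
  -- Two elements above the same automorphism differ by a point `d` of the diagonal. Moving `d` from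
  -- the factor in `F(K)_K` to the diagonal factor commutes with `(h, l)`, by `l_incl`.
  obtain ⟨d, hd⟩ : ∃ d, F.diagPoints d = e * e'⁻¹ := by
    have : e * e'⁻¹ ∈ F.galHom.ker := by
      change gal (e * e'⁻¹) = 1
      rw [gal_mul, gal_inv, hee, mul_inv_cancel]
    rw [← range_diagPoints] at this
    exact this
  have hde : e = F.diagPoints d * e' := by rw [hd, inv_mul_cancel_right]
  have hle : l e = F'.diagPoints (Points.map h d) * l e' := by rw [hde, map_mul, hc.l_incl]
  rw [kHom_eq_diagHom_comp hde ht ht', ← Category.assoc, cancel_mono, ← diagHom_mul] at hy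
  rw [kHom_eq_diagHom_comp hle (hc.comp_specGal ht) (hc.comp_specGal ht'), ← mapHom_constPt,
    ← Category.assoc, ← diagHom_mul, ← diagHom_injective hy, map_mul]

variable [PerfectField k] [IsAffine F.arr] [IsAffine F'.arr]

/-- The morphism on schemes of arrows defined by a pair `(h, l)`. -/
lemma exists_left (hc : IsCompatible h l) (hF : IsTransitiveAffine F) :
    ∃ f : F.arr ⟶ F'.arr, ∀ {O : CommRingCat.{u}} [IsLocalRing O] {t t' : Spec O ⟶ SpecF K}
      (y : Over.mk t ⟶ F.diag) (e : F.KPoints) (ht : t ≫ specGal (gal e) = t'),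
      (diagHom y ≫ kHom e ht).val ≫ f =
        (diagHom (F := F') (mapHom h _ y) ≫ kHom (l e) (hc.comp_specGal ht)).val := by
  obtain ⟨s, hs, hsσ⟩ := hF.exists_section
  let e : F.arr → F.KPoints := s ∘ galAt F.d₀ F.d₁ F.d_over
  have he : Continuous e := hs.comp (continuous_galAt F.d₀ F.d₁ F.d_over)
  have hgal : ∀ {O : CommRingCat.{u}} [IsLocalRing O] (x : Spec O ⟶ F.arr),
      (x ≫ F.d₀) ≫ specGal (gal (e (x (IsLocalRing.closedPoint O)))) = x ≫ F.d₁ := by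
    intro O _ x
    rw [comp_galAt F.d₀ F.d₁ F.d_over x, Category.assoc]
    congr 3
    exact hsσ _
  have hl₁ : LocConst fun w : F.KPoints => F.d₀ ≫ w.val := locConst_val.precomp F.d₀
  have hl₂ : LocConst fun w : F.KPoints => F.d₀ ≫ (l w).val :=
    ((continuous_kPoints_iff _).mp hc.continuous).precomp F.d₀
  have hg₁ : hl₁.glue e he ≫ F.d₀ = F.d₀ := hom_ext_of_local fun O _ x => by
    rw [← Category.assoc, hl₁.comp_glue, Category.assoc, Category.assoc, KPoints.val_d₀,
      Category.comp_id]
  have hg₂ : hl₁.glue e he ≫ F.d₁ = F.d₁ := hom_ext_of_local fun O _ x => by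
    rw [← Category.assoc, hl₁.comp_glue, Category.assoc, Category.assoc, ← specGal_gal,
      ← Category.assoc, hgal]
  have hg₃ : hl₂.glue e he ≫ F'.d₀ = F.d₀ := hom_ext_of_local fun O _ x => by
    rw [← Category.assoc, hl₂.comp_glue, Category.assoc, Category.assoc, KPoints.val_d₀,
      Category.comp_id]
  -- `S` is the glued section, evaluated at the automorphism separating source and target. The
  -- universal arrow `U` is then `Y ∘ S` with `Y` in the diagonal, and `f` is `h(Y)` composed with
  -- the glued image of the section under `l`.
  let S : (⟨F.d₀⟩ : PtObj F F.arr) ⟶ ⟨F.d₁⟩ := PtHom.mk (hl₁.glue e he) hg₁ hg₂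
  let U : (⟨F.d₀⟩ : PtObj F F.arr) ⟶ ⟨F.d₁⟩ := PtHom.mk (𝟙 _) (Category.id_comp _)
    (Category.id_comp _)
  obtain ⟨Y, hY⟩ := exists_diagHom (U ≫ CategoryTheory.inv S)
  have hYS : U = diagHom Y ≫ S := by
    rw [hY, Category.assoc, IsIso.inv_hom_id, Category.comp_id]
  let f : F.arr ⟶ F'.arr := F'.mul (diagHom (F := F') (mapHom h _ Y)).val (hl₂.glue e he)
    (by rw [hg₃]; exact (diagHom (F := F') (mapHom h _ Y)).val_d₁)
  refine ⟨f, fun {O} _ {t t'} y e' ht => ?_⟩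
  set x : Spec O ⟶ F.arr := (diagHom y ≫ kHom e' ht).val with hx
  have hx₀ : x ≫ F.d₀ = t := (diagHom y ≫ kHom e' ht).val_d₀
  have hx₁ : x ≫ F.d₁ = t' := (diagHom y ≫ kHom e' ht).val_d₁
  set e₀ := e (x (IsLocalRing.closedPoint O)) with he₀
  have ht₀ : t ≫ specGal (gal e₀) = t' := by rw [← hx₀, ← hx₁]; exact hgal x
  let y₀ : Over.mk t ⟶ F.diag := preHom F.diagGrp x hx₀ Y
  have hee : gal e' = gal e₀ := comp_specGal_injective t (ht.trans ht₀.symm)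
  -- The point has the given decomposition and the one used to define `f`; `comp_kHom_eq` says that
  -- the two images agree.
  have key : diagHom y ≫ kHom e' ht = diagHom y₀ ≫ kHom e₀ ht₀ := PtHom.ext (by
    have h1 := congrArg (x ≫ ·) (congrArg PtHom.val hYS)
    change x ≫ 𝟙 _ = x ≫ F.mul _ _ _ at h1
    rw [Category.comp_id, F.comp_mul] at h1
    refine h1.trans (mul_congr ?_ ?_)
    · exact (Category.assoc _ _ _).symm
    · refine (hl₁.comp_glue e he x).trans ?_
      rw [← Category.assoc, hx₀]
      rfl)
  rw [hc.comp_kHom_eq ht ht₀ hee y y₀ key, F'.comp_mul]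
  refine mul_congr ?_ ?_
  · exact (Category.assoc _ _ _).symm
  · refine (hl₂.comp_glue e he x).trans ?_
    rw [← Category.assoc, hx₀]
    rfl

end IsCompatible

end GroupoidOver

namespace GroupoidOver

variable {k K : Type u} [Field k] [Field K] [Algebra k K] {F F' : GroupoidOver k K}
variable {T T' : Scheme.{u}} [IsAlgClosure k K]

namespace IsCompatible

variable {h : F.diagGrp ⟶ F'.diagGrp} {l : F.KPoints →* F'.KPoints}

/-- This is the equivariance `act_h` read in the groupoid of points of `F'`. -/
lemma diagHom_mapHom_semiHom (hc : IsCompatible h l) (e : F.KPoints) {t t' : T ⟶ SpecF K}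
    (ht : t ≫ specGal (gal e)⁻¹ = t') (ht' : t' ≫ specGal (gal e) = t)
    (y : Over.mk t ⟶ F.diag) :
    diagHom (F := F') (mapHom h _ ((isSemilinearHom_actHom e).semiHom ht y)) =
      kHom (l e) (hc.comp_specGal ht') ≫ diagHom (F := F') (mapHom h _ y) ≫
        CategoryTheory.inv (kHom (l e) (hc.comp_specGal ht')) := by
  rw [← diagHom_semiHom (l e) (by rw [hc.gal_l, ht])]
  congr 1
  apply Over.OverMorphism.ext
  rw [mapHom_left, IsSemilinearHom.semiHom_left, IsSemilinearHom.semiHom_left, mapHom_left,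
    Category.assoc, Category.assoc, hc.act_h]

variable [PerfectField k] [IsAffine F.arr] [IsAffine F'.arr]

/-- A compatible pair `(h, l)` is induced by a morphism of groupoids. -/
theorem exists_hom (hc : IsCompatible h l) (hF : IsTransitiveAffine F) :
    ∃ f : F ⟶ F', diagMapOver f = h.hom.hom ∧ ∀ e, pointsMap f e = l e := by
  obtain ⟨f, hf⟩ := hc.exists_left hF
  have hd₀ : f ≫ F'.d₀ = F.d₀ := hom_ext_of_local fun O _ x => by
    obtain ⟨e, he⟩ := exists_kPoint_of_local hF x
    obtain ⟨y, hy⟩ := exists_eq_diagHom_comp_kHom e he (PtHom.mk x rfl rfl)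
    have hx : x = (diagHom y ≫ kHom e he).val := congrArg PtHom.val hy
    have h1 := (congrArg (· ≫ f) hx).trans (hf y e he)
    rw [← Category.assoc]
    exact (congrArg (· ≫ F'.d₀) h1).trans (PtHom.val_d₀ _)
  have hd₁ : f ≫ F'.d₁ = F.d₁ := hom_ext_of_local fun O _ x => by
    obtain ⟨e, he⟩ := exists_kPoint_of_local hF x
    obtain ⟨y, hy⟩ := exists_eq_diagHom_comp_kHom e he (PtHom.mk x rfl rfl)
    have hx : x = (diagHom y ≫ kHom e he).val := congrArg PtHom.val hy
    have h1 := (congrArg (· ≫ f) hx).trans (hf y e he)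
    rw [← Category.assoc]
    exact (congrArg (· ≫ F'.d₁) h1).trans (PtHom.val_d₁ _)
  have hmul : ∀ {O : CommRingCat.{u}} [IsLocalRing O] (x x' : Spec O ⟶ F.arr)
      (hxx : x ≫ F.d₁ = x' ≫ F.d₀), F.mul x x' hxx ≫ f = F'.mul (x ≫ f) (x' ≫ f)
        (by rw [Category.assoc, hd₁, hxx, Category.assoc, hd₀]) := by
    intro O _ x x' hxx
    obtain ⟨e, he⟩ := exists_kPoint_of_local hF x
    obtain ⟨e', he'⟩ := exists_kPoint_of_local hF x'
    rw [← hxx] at he'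
    obtain ⟨y, hy⟩ := exists_eq_diagHom_comp_kHom e he (PtHom.mk x rfl rfl)
    obtain ⟨y', hy'⟩ := exists_eq_diagHom_comp_kHom e' he' (PtHom.mk x' hxx.symm rfl)
    have hei : (x ≫ F.d₁) ≫ specGal (gal e)⁻¹ = x ≫ F.d₀ := by
      rw [← he, Category.assoc, specGal_comp_inv, Category.comp_id]
    have hee' : (x ≫ F.d₀) ≫ specGal (gal (e * e')) = x' ≫ F.d₁ := by
      rw [gal_mul, specGal_mul, ← Category.assoc, he, he']
    have hx : x ≫ f = (diagHom (F := F') (mapHom h _ y) ≫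
        kHom (l e) (hc.comp_specGal he)).val :=
      (congrArg (· ≫ f) (congrArg PtHom.val hy)).trans (hf y e he)
    have hx' : x' ≫ f = (diagHom (F := F') (mapHom h _ y') ≫
        kHom (l e') (hc.comp_specGal he')).val :=
      (congrArg (· ≫ f) (congrArg PtHom.val hy')).trans (hf y' e' he')
    -- The product formula `(y ∘ e)(y' ∘ e') = (y · e(y')) ∘ ee'`; it is applied in `F` and compared
    -- with its image in `F'`.
    have hm : F.mul x x' hxx = (diagHom (y * (isSemilinearHom_actHom e).semiHom hei y') ≫
        kHom (e * e') hee').val := by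
      have h1 : F.mul x x' hxx = ((diagHom y ≫ kHom e he) ≫ diagHom y' ≫ kHom e' he').val :=
        mul_congr (congrArg PtHom.val hy) (congrArg PtHom.val hy')
      rw [h1]
      congr 1
      rw [diagHom_mul, diagHom_semiHom e hei he, kHom_mul e e' he he']
      simp
    have hm' : F.mul x x' hxx ≫ f = (diagHom (F := F')
        (mapHom h _ (y * (isSemilinearHom_actHom e).semiHom hei y')) ≫
        kHom (l (e * e')) (hc.comp_specGal hee')).val :=
      (congrArg (· ≫ f) hm).trans (hf _ _ _)
    have hr : F'.mul (x ≫ f) (x' ≫ f) (by rw [Category.assoc, hd₁, hxx, Category.assoc, hd₀]) =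
        ((diagHom (F := F') (mapHom h _ y) ≫ kHom (l e) (hc.comp_specGal he)) ≫
        diagHom (F := F') (mapHom h _ y') ≫ kHom (l e') (hc.comp_specGal he')).val :=
      mul_congr hx hx'
    rw [hm', hr]
    congr 1
    have hk : kHom (l (e * e')) (hc.comp_specGal hee') =
        kHom (l e) (hc.comp_specGal he) ≫ kHom (l e') (hc.comp_specGal he') := by
      rw [← kHom_mul]
      congr 1
      exact map_mul l e e'
    rw [hk, map_mul, diagHom_mul, hc.diagHom_mapHom_semiHom e hei he]
    simp
  let φ : F ⟶ F' := Hom.mk f hd₀ hd₁ (hom_ext_of_local fun O _ x => by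
    have h1 := hmul (x ≫ pullback.fst F.d₁ F.d₀) (x ≫ pullback.snd F.d₁ F.d₀)
      (by rw [Category.assoc, pullback.condition, Category.assoc])
    have h2 : x ≫ F.comp = F.mul (x ≫ pullback.fst F.d₁ F.d₀) (x ≫ pullback.snd F.d₁ F.d₀)
        (by rw [Category.assoc, pullback.condition, Category.assoc]) := by
      rw [CompGraph.mul]
      congr 1
      apply pullback.hom_ext
      · rw [pullback.lift_fst]
      · rw [pullback.lift_snd]
    rw [← Category.assoc, h2, h1, F'.comp_mul]
    exact mul_congr (Category.assoc _ _ _) (Category.assoc _ _ _))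
  have hφ : Hom.left φ = f := rfl
  refine ⟨φ, ?_, fun e => ?_⟩
  · apply Over.OverMorphism.ext
    apply diag_hom_ext
    rw [diagMapOver_ι, hφ]
    refine hom_ext_of_local fun O _ x => ?_
    let y : Over.mk (x ≫ F.diag.hom) ⟶ F.diag := Over.homMk x rfl
    -- Points of the diagonal are those with trivial second factor.
    have h1 := hf y 1 (t' := x ≫ F.diag.hom) (by rw [gal_one, specGal_one, Category.comp_id])
    rw [kHom_one, Category.comp_id] at h1
    rw [← Category.assoc, ← Category.assoc]
    refine h1.trans ?_
    have hk : kHom (l 1) (hc.comp_specGal (show (x ≫ F.diag.hom) ≫ specGal (gal (1 : F.KPoints)) =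
        x ≫ F.diag.hom by rw [gal_one, specGal_one, Category.comp_id])) = 𝟙 _ := by
      rw [← kHom_one]
      congr 1
      exact map_one l
    rw [hk, Category.comp_id]
    rfl
  · apply KPoints.ext
    have he : 𝟙 (SpecF K) ≫ specGal (gal e) = specGal (gal e) := Category.id_comp _
    -- Elements of `F(K)_K` are those with trivial diagonal factor.
    have h1 := hf (O := CommRingCat.of K) (1 : Over.mk (𝟙 (SpecF K)) ⟶ F.diag) e he
    have h2 : (mapHom h (Over.mk (𝟙 (SpecF K))) 1) = 1 := map_one _
    have h3 : diagHom (F := F') (mapHom h (Over.mk (𝟙 (SpecF K))) 1) = 𝟙 _ := by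
      rw [h2]
      exact diagHom_one _
    rw [diagHom_one, Category.id_comp, h3, Category.id_comp, kHom_val, kHom_val,
      Category.id_comp, Category.id_comp] at h1
    exact h1

end IsCompatible

end GroupoidOver

/-! ### The groupoid of a Galois extended group -/

namespace ExtData

variable {k K : Type u} [Field k] [Field K] [Algebra k K]

/-- A Galois extended group has a continuous section of the projection preserving identities. -/
lemma IsGaloisExtended.exists_section [IsAlgClosure k K] [PerfectField k] {G : ExtData k K} (hG : G.IsGaloisExtended) :
    ∃ s : Gal(K/k) → G.E, Continuous s ∧ (∀ σ, G.proj (s σ) = σ) ∧ s 1 = 1 := by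
  have := hG.topologicalGroup
  -- Which local section is used near `x` is chosen in a locally constant way; the diagonal values
  -- `g x x` then form a global continuous section.
  obtain ⟨g, hg, hgs⟩ := exists_isLocallyConstant_choice
    (fun (x : Gal(K/k)) (s : Gal(K/k) → G.E) => ContinuousAt s x ∧ G.proj (s x) = x)
    (fun x => by
      obtain ⟨U, hU, hx, s, hs, hs'⟩ := hG.local_section x
      refine ⟨s, ?_⟩
      filter_upwards [hU.mem_nhds hx] with y hy
      exact ⟨hs.continuousAt (hU.mem_nhds hy), hs' y hy⟩)
  have hc : Continuous fun x => g x x := by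
    rw [continuous_iff_continuousAt]
    intro x
    refine (hgs x).1.congr ?_
    filter_upwards [(IsLocallyConstant.iff_eventually_eq g).mp hg x] with y hy
    rw [hy]
  have h1 : G.proj (g 1 1) = 1 := (hgs 1).2
  -- The correcting factor lies above `1`, so it normalizes the section without changing the
  -- projection.
  refine ⟨fun x => g x x * (g 1 1)⁻¹, hc.mul continuous_const, fun σ => ?_, mul_inv_cancel _⟩
  rw [map_mul, map_inv, h1, inv_one, mul_one, (hgs σ).2]

lemma IsGaloisExtended.proj_incl {G : ExtData k K} (hG : G.IsGaloisExtended) (d : Points G.D) :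
    G.proj (G.incl d) = 1 := by
  have h : G.incl d ∈ G.proj.ker := by
    rw [← hG.range_incl]
    exact ⟨d, rfl⟩
  exact h

/-- A Galois extended group together with a continuous section of its projection. -/
structure Sectioned (G : ExtData k K) where
  isGaloisExtended : G.IsGaloisExtended
  /-- the section -/
  s : Gal(K/k) → G.E
  continuous_s : Continuous s
  proj_s : ∀ σ, G.proj (s σ) = σ
  s_one : s 1 = 1

namespace Sectioned

variable {G : ExtData k K} (S : Sectioned G)

lemma exists_cc (e : G.E) : ∃ d, G.incl d = e * (S.s (G.proj e))⁻¹ := by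
  have h : e * (S.s (G.proj e))⁻¹ ∈ G.incl.range := by
    rw [S.isGaloisExtended.range_incl, MonoidHom.mem_ker, map_mul, map_inv, S.proj_s,
      mul_inv_cancel]
  exact h

/-- The point `d` of `D` with `e = d s(σ)` for `e` above `σ`. -/
def cc (e : G.E) : Points G.D := Classical.choose (S.exists_cc e)

lemma incl_cc (e : G.E) : G.incl (S.cc e) = e * (S.s (G.proj e))⁻¹ :=
  Classical.choose_spec (S.exists_cc e)

lemma incl_cc_mul_s (e : G.E) : G.incl (S.cc e) * S.s (G.proj e) = e := by
  rw [S.incl_cc, inv_mul_cancel_right]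

lemma cc_incl_mul (d : Points G.D) (e : G.E) : S.cc (G.incl d * e) = d * S.cc e := by
  apply S.isGaloisExtended.isEmbedding_incl.injective
  rw [S.incl_cc, map_mul, map_mul, S.incl_cc, S.isGaloisExtended.proj_incl, one_mul, mul_assoc]

lemma cc_s (σ : Gal(K/k)) : S.cc (S.s σ) = 1 := by
  apply S.isGaloisExtended.isEmbedding_incl.injective
  rw [S.incl_cc, S.proj_s, mul_inv_cancel, map_one]

lemma cc_one : S.cc 1 = 1 := by
  rw [← S.s_one, S.cc_s]

lemma continuous_cc : Continuous S.cc := by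
  have := S.isGaloisExtended.topologicalGroup
  rw [S.isGaloisExtended.isEmbedding_incl.continuous_iff]
  simp only [Function.comp_def, S.incl_cc]
  exact continuous_id.mul (S.continuous_s.comp S.isGaloisExtended.continuous_proj).inv

/-- The scheme `D ×ₖ Spec K`. -/
def arr (_ : Sectioned G) : Scheme.{u} :=
  pullback (G.D.X.hom ≫ structureMap k K) (structureMap k K)

/-- The projection onto `D`. -/
def fst : S.arr ⟶ G.D.X.left := pullback.fst (G.D.X.hom ≫ structureMap k K) (structureMap k K)

/-- The target. -/
def d₀ : S.arr ⟶ SpecF K := S.fst ≫ G.D.X.hom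

/-- The source. -/
def d₁ : S.arr ⟶ SpecF K := pullback.snd (G.D.X.hom ≫ structureMap k K) (structureMap k K)

lemma d_over : S.d₀ ≫ structureMap k K = S.d₁ ≫ structureMap k K :=
  (Category.assoc _ _ _).trans pullback.condition

variable {T T' : Scheme.{u}}

/-- The point with given components. -/
def lift (x : T ⟶ G.D.X.left) (t : T ⟶ SpecF K)
    (h : (x ≫ G.D.X.hom) ≫ structureMap k K = t ≫ structureMap k K) : T ⟶ S.arr :=
  pullback.lift x t ((Category.assoc _ _ _).symm.trans h)

@[simp] lemma lift_fst (x : T ⟶ G.D.X.left) (t : T ⟶ SpecF K) (h) : S.lift x t h ≫ S.fst = x :=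
  pullback.lift_fst _ _ _

@[simp] lemma lift_d₁ (x : T ⟶ G.D.X.left) (t : T ⟶ SpecF K) (h) : S.lift x t h ≫ S.d₁ = t :=
  pullback.lift_snd _ _ _

lemma hom_ext {x y : T ⟶ S.arr} (h : x ≫ S.fst = y ≫ S.fst) (h' : x ≫ S.d₁ = y ≫ S.d₁) : x = y :=
  pullback.hom_ext h h'

instance : IsAffine S.arr := by
  have := S.isGaloisExtended.affine
  exact inferInstanceAs (IsAffine (pullback _ _))

/-- The morphism to `D` over `K` defined by a morphism of schemes. -/
def toOver (x : T ⟶ G.D.X.left) : Over.mk (x ≫ G.D.X.hom) ⟶ G.D.X := Over.homMk x rfl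

lemma specGal_structureMap (σ : Gal(K/k)) : specGal σ ≫ structureMap k K = structureMap k K := by
  rw [specGal, structureMap, ← Spec.map_comp]
  congr 1
  ext x
  exact σ.commutes x

/-- The point `x ∘ e` of the groupoid for `x` a point of `D` and `e` in the extension. -/
def pt (x : T ⟶ G.D.X.left) (e : G.E) : T ⟶ S.arr :=
  S.lift (toOver x * constPt G.D (x ≫ G.D.X.hom) (S.cc e)).left
    ((x ≫ G.D.X.hom) ≫ specGal (G.proj e))
    (by rw [Over.w, Category.assoc, specGal_structureMap]; rfl)

lemma pt_fst {t : T ⟶ SpecF K} (x : Over.mk t ⟶ G.D.X) (e : G.E) :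
    S.pt x.left e ≫ S.fst = (x * constPt G.D t (S.cc e)).left := by
  obtain ⟨y, hy, rfl⟩ : ∃ (y : T ⟶ G.D.X.left) (hy : y ≫ G.D.X.hom = t), x = Over.homMk y hy :=
    ⟨x.left, Over.w x, rfl⟩
  subst hy
  exact S.lift_fst _ _ _

lemma pt_d₀ (x : T ⟶ G.D.X.left) (e : G.E) : S.pt x e ≫ S.d₀ = x ≫ G.D.X.hom := by
  rw [d₀, ← Category.assoc, pt, S.lift_fst]
  exact Over.w _

lemma pt_d₁ (x : T ⟶ G.D.X.left) (e : G.E) :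
    S.pt x e ≫ S.d₁ = (x ≫ G.D.X.hom) ≫ specGal (G.proj e) := S.lift_d₁ _ _ _

lemma comp_pt (v : T' ⟶ T) (x : T ⟶ G.D.X.left) (e : G.E) :
    v ≫ S.pt x e = S.pt (v ≫ x) e := by
  apply S.hom_ext
  · rw [Category.assoc]
    refine (congrArg (v ≫ ·) (S.pt_fst (toOver x) e)).trans ?_
    refine Eq.trans ?_ (S.pt_fst (preHom G.D v rfl (toOver x)) e).symm
    have h : constPt G.D (v ≫ x ≫ G.D.X.hom) (S.cc e) =
        preHom G.D v rfl (constPt G.D (x ≫ G.D.X.hom) (S.cc e)) := by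
      apply Over.OverMorphism.ext
      exact Category.assoc _ _ _
    rw [h, ← map_mul, preHom_left]
  · rw [Category.assoc, S.pt_d₁, S.pt_d₁]
    simp only [Category.assoc]

/-- The rule `x ∘ (d e) = (x d) ∘ e`, by which `x ∘ e` behaves as a point of the contracted product
of `D` and the extension over `D(K)_K`. -/
lemma pt_incl_mul {t : T ⟶ SpecF K} (x : Over.mk t ⟶ G.D.X) (d : Points G.D) (e : G.E) :
    S.pt x.left (G.incl d * e) = S.pt (x * constPt G.D t d).left e := by
  apply S.hom_ext
  · rw [S.pt_fst, S.pt_fst, S.cc_incl_mul, map_mul, mul_assoc]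
  · rw [S.pt_d₁, S.pt_d₁, Over.w, Over.w, map_mul, S.isGaloisExtended.proj_incl, one_mul]

/-- Over a local ring the two projections to `Spec K` differ by some `σ`; no correction of the
component in `D` is needed, as `cc` is trivial on the section. -/
lemma exists_eq_pt [IsAlgClosure k K] [PerfectField k] {O : CommRingCat.{u}} [IsLocalRing O] (u : Spec O ⟶ S.arr) :
    ∃ σ : Gal(K/k), u = S.pt (u ≫ S.fst) (S.s σ) := by
  obtain ⟨σ, hσ⟩ := exists_eq_comp_specGal (k := k) (u ≫ S.d₀) (u ≫ S.d₁)
    (by rw [Category.assoc, S.d_over, Category.assoc])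
  refine ⟨σ, S.hom_ext ?_ ?_⟩
  · refine Eq.trans ?_ (S.pt_fst (toOver (u ≫ S.fst)) (S.s σ)).symm
    rw [S.cc_s, map_one, mul_one]
    rfl
  · rw [S.pt_d₁, S.proj_s, hσ, d₀]
    simp only [Category.assoc]

end Sectioned

end ExtData

/-! ### Action of the extension on points, and gluing of the composition and the inverse -/

namespace ExtData

variable {k K : Type u} [Field k] [Field K] [Algebra k K] {G : ExtData k K} {T T' : Scheme.{u}}

namespace IsGaloisExtended

variable (hG : G.IsGaloisExtended)

/-- The action of an element of the extension on the points of `D`. -/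
def actOn (e : G.E) {t t' : T ⟶ SpecF K} (h : t' ≫ specGal (G.proj e)⁻¹ = t) :
    (Over.mk t' ⟶ G.D.X) →* (Over.mk t ⟶ G.D.X) := (hG.semilinear e).semiHom h

lemma actOn_left (e : G.E) {t t' : T ⟶ SpecF K} (h : t' ≫ specGal (G.proj e)⁻¹ = t)
    (x : Over.mk t' ⟶ G.D.X) : (hG.actOn e h x).left = x.left ≫ (G.act e).hom := rfl

lemma actOn_congr {e e' : G.E} (he : e = e') {t t' : T ⟶ SpecF K}
    (h : t' ≫ specGal (G.proj e)⁻¹ = t) (x : Over.mk t' ⟶ G.D.X) :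
    hG.actOn e h x = hG.actOn e' (he ▸ h) x := by
  subst he
  rfl

lemma actOn_one {t : T ⟶ SpecF K} (h : t ≫ specGal (G.proj 1)⁻¹ = t)
    (x : Over.mk t ⟶ G.D.X) : hG.actOn 1 h x = x := by
  apply Over.OverMorphism.ext
  rw [actOn_left, map_one]
  exact Category.comp_id _

lemma actOn_mul (e e' : G.E) {t t' t'' : T ⟶ SpecF K} (h : t' ≫ specGal (G.proj e)⁻¹ = t)
    (h' : t'' ≫ specGal (G.proj e')⁻¹ = t') (h'' : t'' ≫ specGal (G.proj (e * e'))⁻¹ = t)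
    (x : Over.mk t'' ⟶ G.D.X) :
    hG.actOn (e * e') h'' x = hG.actOn e h (hG.actOn e' h' x) := by
  apply Over.OverMorphism.ext
  rw [actOn_left, actOn_left, actOn_left, map_mul]
  exact (Category.assoc _ _ _).symm

/-- Condition (a) on the action, for constant points of `D` in any scheme. -/
lemma actOn_constPt (e : G.E) {t t' : T ⟶ SpecF K} (h : t' ≫ specGal (G.proj e)⁻¹ = t)
    (d : Points G.D) {d' : Points G.D} (hd : G.incl d' = e * G.incl d * e⁻¹) :
    hG.actOn e h (constPt G.D t' d) = constPt G.D t d' := by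
  rw [← hG.act_points] at hd
  rw [hG.isEmbedding_incl.injective hd]
  apply Over.OverMorphism.ext
  rw [actOn_left, constPt_left, constPt_left, ← h]
  change _ = (t' ≫ specGal (G.proj e)⁻¹) ≫ specGal (G.proj e) ≫ d.left ≫ (G.act e).hom
  rw [Category.assoc, Category.assoc, ← Category.assoc (specGal (G.proj e)⁻¹), specGal_inv_comp,
    Category.id_comp]

/-- Condition (b) on the action, for points of `D` in any scheme. -/
lemma actOn_incl (d : Points G.D) {t : T ⟶ SpecF K} (h : t ≫ specGal (G.proj (G.incl d))⁻¹ = t)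
    (x : Over.mk t ⟶ G.D.X) :
    hG.actOn (G.incl d) h x = constPt G.D t d * x * (constPt G.D t d)⁻¹ := by
  have h1 : x ≫ conjHom d = constPt G.D t d * x * (constPt G.D t d)⁻¹ := by
    have h2 : x ≫ CartesianMonoidalCategory.toUnit G.D.X ≫ (d : 𝟙_ (Over (SpecF K)) ⟶ G.D.X) =
        constPt G.D t d := by
      apply Over.OverMorphism.ext
      exact (Category.assoc _ _ _).symm.trans (congrArg (· ≫ d.left) (Over.w x))
    rw [conjHom, MonObj.comp_mul, MonObj.comp_mul, GrpObj.comp_inv, h2, Category.comp_id]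
  apply Over.OverMorphism.ext
  rw [← h1, actOn_left, hG.act_incl]
  rfl

/-- The gluing of the actions of elements of the extension. -/
lemma exists_glue_act (hG : G.IsGaloisExtended) (z : T ⟶ G.D.X.left) (t : T ⟶ SpecF K) (ε : T → G.E) (hε : Continuous ε)
    (h : ∀ (O : CommRingCat.{u}) [IsLocalRing O] (u : Spec O ⟶ T),
      (u ≫ z ≫ G.D.X.hom) ≫ specGal (G.proj (ε (u (IsLocalRing.closedPoint O))))⁻¹ = u ≫ t) :
    ∃ A : Over.mk t ⟶ G.D.X, ∀ (O : CommRingCat.{u}) [IsLocalRing O] (u : Spec O ⟶ T),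
      u ≫ A.left = u ≫ z ≫ (G.act (ε (u (IsLocalRing.closedPoint O)))).hom := by
  have := hG.affine
  have hl : LocConst fun e => z ≫ (G.act e).hom :=
    hG.continuous_act.locConst.precomp z
  refine ⟨Over.homMk (hl.glue ε hε) (hom_ext_of_local fun O _ u => ?_),
    fun O _ u => hl.comp_glue ε hε u⟩
  rw [← Category.assoc, hl.comp_glue, Category.assoc, Category.assoc,
    (hG.semilinear _).over_specGal]
  refine Eq.trans ?_ (h O u)
  simp only [Category.assoc]

/-- The gluing of constant points. -/
lemma exists_glue_points (hG : G.IsGaloisExtended) (t : T ⟶ SpecF K) (ε : T → Points G.D) (hε : Continuous ε) :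
    ∃ C : Over.mk t ⟶ G.D.X, ∀ (O : CommRingCat.{u}) [IsLocalRing O] (u : Spec O ⟶ T),
      u ≫ C.left = u ≫ t ≫ (ε (u (IsLocalRing.closedPoint O))).left := by
  have := hG.affine
  have hl : LocConst fun d : Points G.D => t ≫ d.left :=
    ((continuous_points_iff _).mp continuous_id).precomp t
  refine ⟨Over.homMk (hl.glue ε hε) (hom_ext_of_local fun O _ u => ?_),
    fun O _ u => hl.comp_glue ε hε u⟩
  rw [← Category.assoc, hl.comp_glue, Category.assoc, Category.assoc]
  have h1 : ∀ d : Points G.D, d.left ≫ G.D.X.hom = 𝟙 _ :=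
    fun d => Over.w (d : 𝟙_ (Over (SpecF K)) ⟶ G.D.X)
  rw [h1, Category.comp_id]
  rfl

end IsGaloisExtended

namespace Sectioned

variable (S : Sectioned G)

/-- This identifies the product formula for arbitrary `e`, `e'` with the formula in which they are
replaced by values `s`, `s'` of the section, the points `d`, `d'` being moved to the `D`-components.
The latter formula is the one that can be glued. -/
lemma actOn_mul_cc {e e' s s' : G.E} {d d' : Points G.D} (he : e = G.incl d * s)
    (he' : e' = G.incl d' * s') {t t' : T ⟶ SpecF K} (h : t' ≫ specGal (G.proj e)⁻¹ = t)
    (hs : t' ≫ specGal (G.proj s)⁻¹ = t) (x : Over.mk t' ⟶ G.D.X) :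
    S.isGaloisExtended.actOn e h x * constPt G.D t (S.cc (e * e')) =
      constPt G.D t d * S.isGaloisExtended.actOn s hs (x * constPt G.D t' d') *
        constPt G.D t (S.cc (s * s')) := by
  have hG := S.isGaloisExtended
  subst he he'
  let d'' := semilinearOnPoints (G.proj s) (G.act s).hom (hG.semilinear s).over_specGal d'
  have hd'' : G.incl d'' = s * G.incl d' * s⁻¹ := hG.act_points s d'
  have h1 : G.incl d * s * (G.incl d' * s') = G.incl (d * d'') * (s * s') := by
    rw [map_mul, hd'']
    group
  have ht : t ≫ specGal (G.proj (G.incl d))⁻¹ = t := by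
    rw [hG.proj_incl, inv_one, specGal_one, Category.comp_id]
  rw [hG.actOn_mul _ _ ht hs, hG.actOn_incl, h1, S.cc_incl_mul, map_mul (hG.actOn s hs),
    hG.actOn_constPt s hs d' hd'']
  simp only [map_mul]
  group

lemma actOn_inv_mul_cc {e s : G.E} {d : Points G.D} (he : e = G.incl d * s)
    {t t' : T ⟶ SpecF K} (h : t ≫ specGal (G.proj e⁻¹)⁻¹ = t')
    (hs : t ≫ specGal (G.proj s⁻¹)⁻¹ = t') (x : Over.mk t ⟶ G.D.X) :
    S.isGaloisExtended.actOn e⁻¹ h x⁻¹ * constPt G.D t' (S.cc e⁻¹) =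
      (S.isGaloisExtended.actOn s⁻¹ hs (x * constPt G.D t d))⁻¹ *
        constPt G.D t' (S.cc s⁻¹) := by
  have hG := S.isGaloisExtended
  have he' : e⁻¹ = s⁻¹ * G.incl d⁻¹ := by rw [he, mul_inv_rev, map_inv]
  let d' := semilinearOnPoints (G.proj s⁻¹) (G.act s⁻¹).hom (hG.semilinear s⁻¹).over_specGal d⁻¹
  have hd' : G.incl d' = s⁻¹ * G.incl d⁻¹ * s⁻¹⁻¹ := hG.act_points s⁻¹ d⁻¹
  have h1 : e⁻¹ = G.incl d' * s⁻¹ := by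
    rw [he', hd']
    group
  have ht : t ≫ specGal (G.proj (G.incl d⁻¹))⁻¹ = t := by
    rw [hG.proj_incl, inv_one, specGal_one, Category.comp_id]
  have h2 : S.cc e⁻¹ = d' * S.cc s⁻¹ := by rw [h1, S.cc_incl_mul]
  rw [h2, hG.actOn_congr he', hG.actOn_mul _ _ hs ht,
    hG.actOn_incl]
  simp only [map_mul]
  rw [← hG.actOn_constPt s⁻¹ hs d⁻¹ hd']
  simp only [map_inv, inv_inv]
  group

variable [IsAlgClosure k K] [PerfectField k]

lemma galAt_eq {t₀ t₁ : T ⟶ SpecF K} (h : t₀ ≫ structureMap k K = t₁ ≫ structureMap k K)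
    {O : CommRingCat.{u}} [IsLocalRing O] (u : Spec O ⟶ T) (σ : Gal(K/k))
    (hσ : u ≫ t₁ = (u ≫ t₀) ≫ specGal σ) :
    galAt t₀ t₁ h (u (IsLocalRing.closedPoint O)) = σ := by
  apply comp_specGal_injective (u ≫ t₀)
  rw [← hσ, comp_galAt t₀ t₁ h u, Category.assoc]

/-- The law is `(x ∘ e)(x' ∘ e') = (x · e(x')) ∘ ee'`. Globally the `D`-component is `X * A * C`:
here `X` is the component of the first arrow, `A` is that of the second acted on by `s(τ)`, and `C`
is the cocycle `cc (s(τ) s(τ'))`, for the continuous functions `τ`, `τ'` attached to the two arrows.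
-/
lemma exists_comp : ∃ c : pullback S.d₁ S.d₀ ⟶ S.arr,
    ∀ {O : CommRingCat.{u}} [IsLocalRing O] {t t' : Spec O ⟶ SpecF K}
      (x : Over.mk t ⟶ G.D.X) (x' : Over.mk t' ⟶ G.D.X) (e e' : G.E)
      (h : t' ≫ specGal (G.proj e)⁻¹ = t) (h' : S.pt x.left e ≫ S.d₁ = S.pt x'.left e' ≫ S.d₀),
      pullback.lift (S.pt x.left e) (S.pt x'.left e') h' ≫ c =
        S.pt (x * S.isGaloisExtended.actOn e h x').left (e * e') := by
  have hG := S.isGaloisExtended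
  have := hG.topologicalGroup
  set p := pullback.fst S.d₁ S.d₀ with hp
  set q := pullback.snd S.d₁ S.d₀ with hq
  have hp₀ : (p ≫ S.d₀) ≫ structureMap k K = (p ≫ S.d₁) ≫ structureMap k K := by
    rw [Category.assoc, S.d_over, Category.assoc]
  have hq₀ : (q ≫ S.d₀) ≫ structureMap k K = (q ≫ S.d₁) ≫ structureMap k K := by
    rw [Category.assoc, S.d_over, Category.assoc]
  let τ := galAt (p ≫ S.d₀) (p ≫ S.d₁) hp₀
  let τ' := galAt (q ≫ S.d₀) (q ≫ S.d₁) hq₀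
  have hτ : Continuous τ := continuous_galAt _ _ _
  have hτ' : Continuous τ' := continuous_galAt _ _ _
  obtain ⟨A, hA⟩ := hG.exists_glue_act (q ≫ S.fst) (p ≫ S.d₀) (fun m => S.s (τ m))
    (S.continuous_s.comp hτ) (fun O _ u => by
      have h1 := comp_galAt (p ≫ S.d₀) (p ≫ S.d₁) hp₀ u
      have h2 : u ≫ (q ≫ S.fst) ≫ G.D.X.hom = u ≫ p ≫ S.d₁ := by
        rw [Category.assoc]
        exact congrArg (u ≫ ·) pullback.condition.symm
      rw [h2, h1, S.proj_s, Category.assoc, Category.assoc, specGal_comp_inv, Category.comp_id])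
  obtain ⟨C, hC⟩ := hG.exists_glue_points (p ≫ S.d₀) (fun m => S.cc (S.s (τ m) * S.s (τ' m)))
    (S.continuous_cc.comp ((S.continuous_s.comp hτ).mul (S.continuous_s.comp hτ')))
  let X : Over.mk (p ≫ S.d₀) ⟶ G.D.X := Over.homMk (p ≫ S.fst) (Category.assoc _ _ _)
  refine ⟨S.lift (X * A * C).left (q ≫ S.d₁) ?_, fun {O} _ {t t'} x x' e e' h h' => ?_⟩
  · rw [Over.w]
    refine hp₀.trans ?_
    rw [pullback.condition, hq₀]
  set u := pullback.lift (S.pt x.left e) (S.pt x'.left e') h' with hu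
  have hup : u ≫ p = S.pt x.left e := pullback.lift_fst _ _ _
  have huq : u ≫ q = S.pt x'.left e' := pullback.lift_snd _ _ _
  have ht : u ≫ p ≫ S.d₀ = t := by
    rw [← Category.assoc, hup, S.pt_d₀]
    exact Over.w x
  have ht' : u ≫ q ≫ S.d₀ = t' := by
    rw [← Category.assoc, huq, S.pt_d₀]
    exact Over.w x'
  have ht₁ : u ≫ p ≫ S.d₁ = t ≫ specGal (G.proj e) := by
    rw [← Category.assoc, hup, S.pt_d₁]
    exact congrArg (· ≫ specGal (G.proj e)) (Over.w x)
  have ht₁' : u ≫ q ≫ S.d₁ = t' ≫ specGal (G.proj e') := by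
    rw [← Category.assoc, huq, S.pt_d₁]
    exact congrArg (· ≫ specGal (G.proj e')) (Over.w x')
  have hτu : τ (u (IsLocalRing.closedPoint O)) = G.proj e :=
    galAt_eq hp₀ u _ (by rw [ht₁, ht])
  have hτu' : τ' (u (IsLocalRing.closedPoint O)) = G.proj e' :=
    galAt_eq hq₀ u _ (by rw [ht₁', ht'])
  have hs : t' ≫ specGal (G.proj (S.s (G.proj e)))⁻¹ = t := by rw [S.proj_s, h]
  have hX : preHom G.D u ht X = x * constPt G.D t (S.cc e) := by
    apply Over.OverMorphism.ext
    rw [preHom_left, ← S.pt_fst, ← hup]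
    exact (Category.assoc _ _ _).symm
  have hA' : preHom G.D u ht A =
      hG.actOn (S.s (G.proj e)) hs (x' * constPt G.D t' (S.cc e')) := by
    apply Over.OverMorphism.ext
    rw [preHom_left, hA, hG.actOn_left, ← S.pt_fst, ← huq, hτu]
    simp only [Category.assoc]
  have hC' : preHom G.D u ht C = constPt G.D t (S.cc (S.s (G.proj e) * S.s (G.proj e'))) := by
    apply Over.OverMorphism.ext
    rw [preHom_left, hC, constPt_left, hτu, hτu', ← Category.assoc, ht]
  apply S.hom_ext
  · rw [Category.assoc, S.lift_fst, S.pt_fst, ← preHom_left u ht, map_mul, map_mul, hX, hA', hC',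
      mul_assoc x (hG.actOn e h x'), S.actOn_mul_cc (S.incl_cc_mul_s e).symm
        (S.incl_cc_mul_s e').symm h hs]
    simp only [mul_assoc]
  · rw [Category.assoc, S.lift_d₁, S.pt_d₁, ht₁', Over.w, map_mul, specGal_mul, ← h]
    change _ = (t' ≫ specGal (G.proj e)⁻¹) ≫ specGal (G.proj e) ≫ specGal (G.proj e')
    rw [Category.assoc, ← Category.assoc (specGal (G.proj e)⁻¹), specGal_inv_comp,
      Category.id_comp]

/-- The inverse of `x ∘ e` is `e⁻¹(x⁻¹) ∘ e⁻¹`, glued in the same way. -/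
lemma exists_inv : ∃ i : S.arr ⟶ S.arr,
    ∀ {O : CommRingCat.{u}} [IsLocalRing O] {t t' : Spec O ⟶ SpecF K}
      (x : Over.mk t ⟶ G.D.X) (e : G.E) (h : t ≫ specGal (G.proj e⁻¹)⁻¹ = t'),
      S.pt x.left e ≫ i = S.pt (S.isGaloisExtended.actOn e⁻¹ h x⁻¹).left e⁻¹ := by
  have hG := S.isGaloisExtended
  have := hG.topologicalGroup
  let τ := galAt S.d₀ S.d₁ S.d_over
  have hτ : Continuous τ := continuous_galAt _ _ _
  obtain ⟨A, hA⟩ := hG.exists_glue_act S.fst S.d₁ (fun m => (S.s (τ m))⁻¹)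
    (S.continuous_s.comp hτ).inv (fun O _ u => by
      have h1 := comp_galAt S.d₀ S.d₁ S.d_over u
      rw [h1, map_inv, S.proj_s, inv_inv, Category.assoc]
      rfl)
  obtain ⟨C, hC⟩ := hG.exists_glue_points S.d₁ (fun m => S.cc (S.s (τ m))⁻¹)
    (S.continuous_cc.comp (S.continuous_s.comp hτ).inv)
  refine ⟨S.lift (A⁻¹ * C).left S.d₀ ?_, fun {O} _ {t t'} x e h => ?_⟩
  · rw [Over.w]
    exact S.d_over.symm
  set u := S.pt x.left e with hu
  have ht : u ≫ S.d₀ = t := by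
    rw [S.pt_d₀]
    exact Over.w x
  have ht₁ : u ≫ S.d₁ = t ≫ specGal (G.proj e) := by
    rw [S.pt_d₁]
    exact congrArg (· ≫ specGal (G.proj e)) (Over.w x)
  have hτu : τ (u (IsLocalRing.closedPoint O)) = G.proj e :=
    galAt_eq S.d_over u _ (by rw [ht₁, ht])
  have ht' : u ≫ S.d₁ = t' := by rw [ht₁, ← h, map_inv, inv_inv]
  have hs : t ≫ specGal (G.proj (S.s (G.proj e))⁻¹)⁻¹ = t' := by
    rw [map_inv, S.proj_s, ← map_inv, h]
  have hA' : preHom G.D u ht' A =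
      hG.actOn (S.s (G.proj e))⁻¹ hs (x * constPt G.D t (S.cc e)) := by
    apply Over.OverMorphism.ext
    rw [preHom_left, hA, hG.actOn_left, ← S.pt_fst, hτu, Category.assoc]
  have hC' : preHom G.D u ht' C = constPt G.D t' (S.cc (S.s (G.proj e))⁻¹) := by
    apply Over.OverMorphism.ext
    rw [preHom_left, hC, constPt_left, hτu, ← Category.assoc, ht']
  apply S.hom_ext
  · rw [Category.assoc, S.lift_fst, S.pt_fst, ← preHom_left u ht', map_mul, map_inv, hA', hC',
      S.actOn_inv_mul_cc (S.incl_cc_mul_s e).symm h hs]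
  · rw [Category.assoc, S.lift_d₁, S.pt_d₁, ht, Over.w, map_inv, ← h, map_inv, inv_inv]
    change _ = (t ≫ specGal (G.proj e)) ≫ specGal (G.proj e)⁻¹
    rw [Category.assoc, specGal_comp_inv, Category.comp_id]

end Sectioned

end ExtData

/-! ### The groupoid axioms -/

namespace ExtData

namespace Sectioned

variable {k K : Type u} [Field k] [Field K] [Algebra k K] {G : ExtData k K} {T T' : Scheme.{u}}
variable (S : Sectioned G)

lemma pt_left_d₀ {t : T ⟶ SpecF K} (x : Over.mk t ⟶ G.D.X) (e : G.E) :
    S.pt x.left e ≫ S.d₀ = t := (S.pt_d₀ _ _).trans (Over.w x)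

lemma pt_left_d₁ {t : T ⟶ SpecF K} (x : Over.mk t ⟶ G.D.X) (e : G.E) :
    S.pt x.left e ≫ S.d₁ = t ≫ specGal (G.proj e) :=
  (S.pt_d₁ _ _).trans (congrArg (· ≫ specGal (G.proj e)) (Over.w x))

lemma comp_specGal_of_pt_d₁ {t t' : T ⟶ SpecF K} {x : Over.mk t ⟶ G.D.X} {e : G.E}
    (h : S.pt x.left e ≫ S.d₁ = t') : t' ≫ specGal (G.proj e)⁻¹ = t := by
  rw [← h, S.pt_left_d₁, Category.assoc, specGal_comp_inv, Category.comp_id]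

lemma composable {t t' : T ⟶ SpecF K} {x : Over.mk t ⟶ G.D.X} {x' : Over.mk t' ⟶ G.D.X}
    {e e' : G.E} (h : S.pt x.left e ≫ S.d₁ = S.pt x'.left e' ≫ S.d₀) :
    t' ≫ specGal (G.proj e)⁻¹ = t := S.comp_specGal_of_pt_d₁ (h.trans (S.pt_left_d₀ _ _))

lemma comp_specGal_inv_inv (t : T ⟶ SpecF K) (e : G.E) :
    t ≫ specGal (G.proj e⁻¹)⁻¹ = t ≫ specGal (G.proj e) := by
  rw [map_inv, inv_inv]

/-- The identities. -/
def ident : SpecF K ⟶ S.arr := S.pt (1 : Over.mk (𝟙 (SpecF K)) ⟶ G.D.X).left 1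

lemma comp_ident (t : T ⟶ SpecF K) : t ≫ S.ident = S.pt (1 : Over.mk t ⟶ G.D.X).left 1 := by
  rw [ident, S.comp_pt, ← preHom_left t (Category.comp_id t), map_one]

lemma ident_d₀ : S.ident ≫ S.d₀ = 𝟙 _ := S.pt_left_d₀ _ _

lemma ident_d₁ : S.ident ≫ S.d₁ = 𝟙 _ := by
  refine (S.pt_left_d₁ _ _).trans ?_
  rw [map_one, specGal_one, Category.comp_id]

variable [IsAlgClosure k K] [PerfectField k]

/-- The composition law. -/
def comp : pullback S.d₁ S.d₀ ⟶ S.arr := Classical.choose S.exists_comp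

lemma lift_pt_comp {O : CommRingCat.{u}} [IsLocalRing O] {t t' : Spec O ⟶ SpecF K}
    (x : Over.mk t ⟶ G.D.X) (x' : Over.mk t' ⟶ G.D.X) (e e' : G.E)
    (h : t' ≫ specGal (G.proj e)⁻¹ = t) (h' : S.pt x.left e ≫ S.d₁ = S.pt x'.left e' ≫ S.d₀) :
    pullback.lift (S.pt x.left e) (S.pt x'.left e') h' ≫ S.comp =
      S.pt (x * S.isGaloisExtended.actOn e h x').left (e * e') :=
  Classical.choose_spec S.exists_comp x x' e e' h h'

/-- The inverse. -/
def inv : S.arr ⟶ S.arr := Classical.choose S.exists_inv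

lemma pt_inv {O : CommRingCat.{u}} [IsLocalRing O] {t t' : Spec O ⟶ SpecF K}
    (x : Over.mk t ⟶ G.D.X) (e : G.E) (h : t ≫ specGal (G.proj e⁻¹)⁻¹ = t') :
    S.pt x.left e ≫ S.inv = S.pt (S.isGaloisExtended.actOn e⁻¹ h x⁻¹).left e⁻¹ :=
  Classical.choose_spec S.exists_inv x e h

lemma exists_pt {O : CommRingCat.{u}} [IsLocalRing O] (u : Spec O ⟶ S.arr) :
    ∃ (t : Spec O ⟶ SpecF K) (x : Over.mk t ⟶ G.D.X) (e : G.E), S.pt x.left e = u := by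
  obtain ⟨σ, hσ⟩ := S.exists_eq_pt u
  exact ⟨u ≫ S.d₀, Over.homMk (u ≫ S.fst) (Category.assoc _ _ _), S.s σ, hσ.symm⟩

/-- The composite of two points. -/
def mul (u v : T ⟶ S.arr) (h : u ≫ S.d₁ = v ≫ S.d₀) : T ⟶ S.arr := pullback.lift u v h ≫ S.comp

lemma mul_congr {x x' y y' : T ⟶ S.arr} {h : x ≫ S.d₁ = y ≫ S.d₀} (hx : x = x')
    (hy : y = y') : S.mul x y h = S.mul x' y' (by rw [← hx, h, hy]) := by
  subst hx hy
  rfl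

lemma comp_mul (z : T' ⟶ T) (u v : T ⟶ S.arr) (h : u ≫ S.d₁ = v ≫ S.d₀) :
    z ≫ S.mul u v h = S.mul (z ≫ u) (z ≫ v) (by rw [Category.assoc, h, Category.assoc]) := by
  rw [mul, mul, ← Category.assoc]
  congr 1
  apply pullback.hom_ext
  · rw [Category.assoc, pullback.lift_fst, pullback.lift_fst]
  · rw [Category.assoc, pullback.lift_snd, pullback.lift_snd]

/-- Both sides are natural in the base, so the formula extends from local rings to arbitrary
schemes. -/
lemma mul_pt {t t' : T ⟶ SpecF K} (x : Over.mk t ⟶ G.D.X) (x' : Over.mk t' ⟶ G.D.X) (e e' : G.E)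
    (h : t' ≫ specGal (G.proj e)⁻¹ = t) (h' : S.pt x.left e ≫ S.d₁ = S.pt x'.left e' ≫ S.d₀) :
    S.mul (S.pt x.left e) (S.pt x'.left e') h' =
      S.pt (x * S.isGaloisExtended.actOn e h x').left (e * e') := by
  refine hom_ext_of_local fun O _ u => ?_
  have h1 := S.lift_pt_comp (preHom G.D u rfl x) (preHom G.D u rfl x') e e'
    (by rw [Category.assoc, h]) (by
      have := congrArg (u ≫ ·) h'
      simp only [← Category.assoc, S.comp_pt] at this
      exact this)
  refine (S.comp_mul _ _ _ _).trans ?_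
  refine (S.mul_congr (S.comp_pt u _ _) (S.comp_pt u _ _)).trans ?_
  refine h1.trans ?_
  refine Eq.trans ?_ (S.comp_pt u _ _).symm
  have h2 : S.isGaloisExtended.actOn e (by rw [Category.assoc, h]) (preHom G.D u rfl x') =
      preHom G.D u rfl (S.isGaloisExtended.actOn e h x') := by
    apply Over.OverMorphism.ext
    exact Category.assoc _ _ _
  rw [h2, ← map_mul, preHom_left]

lemma comp_eq_mul (u : T ⟶ pullback S.d₁ S.d₀) :
    u ≫ S.comp = S.mul (u ≫ pullback.fst S.d₁ S.d₀) (u ≫ pullback.snd S.d₁ S.d₀)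
      (by rw [Category.assoc, pullback.condition, Category.assoc]) := by
  rw [mul]
  congr 1
  apply pullback.hom_ext
  · rw [pullback.lift_fst]
  · rw [pullback.lift_snd]

lemma mul_d₀_of_local {O : CommRingCat.{u}} [IsLocalRing O] (u v : Spec O ⟶ S.arr)
    (h : u ≫ S.d₁ = v ≫ S.d₀) : S.mul u v h ≫ S.d₀ = u ≫ S.d₀ := by
  obtain ⟨t, x, e, rfl⟩ := S.exists_pt u
  obtain ⟨t', x', e', rfl⟩ := S.exists_pt v
  rw [S.mul_pt x x' e e' (S.composable h) h, S.pt_left_d₀, S.pt_left_d₀]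

lemma mul_d₁_of_local {O : CommRingCat.{u}} [IsLocalRing O] (u v : Spec O ⟶ S.arr)
    (h : u ≫ S.d₁ = v ≫ S.d₀) : S.mul u v h ≫ S.d₁ = v ≫ S.d₁ := by
  obtain ⟨t, x, e, rfl⟩ := S.exists_pt u
  obtain ⟨t', x', e', rfl⟩ := S.exists_pt v
  rw [S.mul_pt x x' e e' (S.composable h) h, S.pt_left_d₁, S.pt_left_d₁, map_mul, specGal_mul,
    ← Category.assoc, ← S.pt_left_d₁ x e, h, S.pt_left_d₀]

/-- The graph underlying the groupoid. -/
def graph : CompGraph k K where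
  arr := S.arr
  d₀ := S.d₀
  d₁ := S.d₁
  d_over := S.d_over
  comp := S.comp
  comp_d₀ := hom_ext_of_local fun O _ u => by
    rw [← Category.assoc, S.comp_eq_mul, S.mul_d₀_of_local, Category.assoc]
  comp_d₁ := hom_ext_of_local fun O _ u => by
    rw [← Category.assoc, S.comp_eq_mul, S.mul_d₁_of_local, Category.assoc]

lemma mul_d₀ (u v : T ⟶ S.arr) (h : u ≫ S.d₁ = v ≫ S.d₀) : S.mul u v h ≫ S.d₀ = u ≫ S.d₀ :=
  S.graph.mul_d₀ u v h

lemma mul_d₁ (u v : T ⟶ S.arr) (h : u ≫ S.d₁ = v ≫ S.d₀) : S.mul u v h ≫ S.d₁ = v ≫ S.d₁ :=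
  S.graph.mul_d₁ u v h

/-- In terms of `x ∘ e` this is associativity in a semidirect product: elements of the extension act
multiplicatively and by homomorphisms. -/
lemma assoc_of_local {O : CommRingCat.{u}} [IsLocalRing O] (u v w : Spec O ⟶ S.arr)
    (h : u ≫ S.d₁ = v ≫ S.d₀) (h' : v ≫ S.d₁ = w ≫ S.d₀) :
    S.mul (S.mul u v h) w (by rw [S.mul_d₁, h']) =
      S.mul u (S.mul v w h') (by rw [S.mul_d₀, h]) := by
  have hG := S.isGaloisExtended
  obtain ⟨t, x, e, rfl⟩ := S.exists_pt u
  obtain ⟨t', x', e', rfl⟩ := S.exists_pt v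
  obtain ⟨t'', x'', e'', rfl⟩ := S.exists_pt w
  have h1 := S.composable h
  have h2 := S.composable h'
  have h3 : t'' ≫ specGal (G.proj (e * e'))⁻¹ = t := by
    rw [map_mul, mul_inv_rev, specGal_mul, ← Category.assoc, h2, h1]
  rw [S.mul_congr (S.mul_pt x x' e e' h1 h) rfl, S.mul_congr rfl (S.mul_pt x' x'' e' e'' h2 h'),
    S.mul_pt _ _ _ _ h3, S.mul_pt _ _ _ _ h1, map_mul, ← hG.actOn_mul e e' h1 h2 h3, mul_assoc,
    mul_assoc]

lemma mul_assoc' (u v w : T ⟶ S.arr) (h : u ≫ S.d₁ = v ≫ S.d₀) (h' : v ≫ S.d₁ = w ≫ S.d₀) :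
    S.mul (S.mul u v h) w (by rw [S.mul_d₁, h']) =
      S.mul u (S.mul v w h') (by rw [S.mul_d₀, h]) := by
  refine hom_ext_of_local fun O _ z => ?_
  refine (S.comp_mul _ _ _ _).trans ((S.mul_congr (S.comp_mul z u v h) rfl).trans ?_)
  refine Eq.trans ?_ (S.comp_mul _ _ _ _).symm
  refine Eq.trans ?_ (S.mul_congr rfl (S.comp_mul z v w h')).symm
  exact S.assoc_of_local _ _ _ _ _

lemma ident_mul (u : T ⟶ S.arr) :
    S.mul (u ≫ S.d₀ ≫ S.ident) u (by simp only [Category.assoc, S.ident_d₁, Category.comp_id]) =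
      u := by
  refine hom_ext_of_local fun O _ z => ?_
  rw [S.comp_mul]
  obtain ⟨t, x, e, hx⟩ := S.exists_pt (z ≫ u)
  have h1 : z ≫ u ≫ S.d₀ ≫ S.ident = S.pt (1 : Over.mk t ⟶ G.D.X).left 1 := by
    rw [← S.comp_ident, ← S.pt_left_d₀ x e, hx]
    simp only [Category.assoc]
  have h2 : t ≫ specGal (G.proj 1)⁻¹ = t := by
    rw [map_one, inv_one, specGal_one, Category.comp_id]
  rw [S.mul_congr h1 hx.symm, S.mul_pt _ _ _ _ h2, S.isGaloisExtended.actOn_one, one_mul, one_mul,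
    hx]

lemma mul_ident (u : T ⟶ S.arr) :
    S.mul u (u ≫ S.d₁ ≫ S.ident) (by simp only [Category.assoc, S.ident_d₀, Category.comp_id]) =
      u := by
  refine hom_ext_of_local fun O _ z => ?_
  rw [S.comp_mul]
  obtain ⟨t, x, e, hx⟩ := S.exists_pt (z ≫ u)
  have h1 : z ≫ u ≫ S.d₁ ≫ S.ident =
      S.pt (1 : Over.mk (t ≫ specGal (G.proj e)) ⟶ G.D.X).left 1 := by
    rw [← S.comp_ident, ← S.pt_left_d₁ x e, hx]
    simp only [Category.assoc]
  have h2 := S.comp_specGal_of_pt_d₁ (S.pt_left_d₁ x e)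
  rw [S.mul_congr hx.symm h1, S.mul_pt _ _ _ _ h2, map_one, mul_one, mul_one, hx]

lemma inv_d₀ : S.inv ≫ S.d₀ = S.d₁ := hom_ext_of_local fun O _ z => by
  obtain ⟨t, x, e, rfl⟩ := S.exists_pt z
  rw [← Category.assoc, S.pt_inv x e (comp_specGal_inv_inv t e), S.pt_left_d₀, S.pt_left_d₁]

lemma inv_d₁ : S.inv ≫ S.d₁ = S.d₀ := hom_ext_of_local fun O _ z => by
  obtain ⟨t, x, e, rfl⟩ := S.exists_pt z
  rw [← Category.assoc, S.pt_inv x e (comp_specGal_inv_inv t e), S.pt_left_d₀, S.pt_left_d₁,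
    map_inv, Category.assoc, specGal_comp_inv, Category.comp_id]

lemma mul_inv (u : T ⟶ S.arr) :
    S.mul u (u ≫ S.inv) (by rw [Category.assoc, S.inv_d₀]) = u ≫ S.d₀ ≫ S.ident := by
  refine hom_ext_of_local fun O _ z => ?_
  have hG := S.isGaloisExtended
  rw [S.comp_mul]
  obtain ⟨t, x, e, hx⟩ := S.exists_pt (z ≫ u)
  have h0 := comp_specGal_inv_inv t e
  have h1 : z ≫ u ≫ S.inv = S.pt (hG.actOn e⁻¹ h0 x⁻¹).left e⁻¹ := by
    rw [← S.pt_inv x e h0, hx, Category.assoc]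
  have h2 := S.comp_specGal_of_pt_d₁ (S.pt_left_d₁ x e)
  have h4 : t ≫ specGal (G.proj (e * e⁻¹))⁻¹ = t := by
    rw [mul_inv_cancel, map_one, inv_one, specGal_one, Category.comp_id]
  have h5 := hG.actOn_mul e e⁻¹ h2 h0 h4 x⁻¹
  rw [hG.actOn_congr (mul_inv_cancel e), hG.actOn_one] at h5
  rw [S.mul_congr hx.symm h1, S.mul_pt _ _ _ _ h2, ← h5, mul_inv_cancel, mul_inv_cancel,
    ← S.comp_ident, ← S.pt_left_d₀ x e, hx]
  simp only [Category.assoc]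

lemma inv_mul (u : T ⟶ S.arr) :
    S.mul (u ≫ S.inv) u (by rw [Category.assoc, S.inv_d₁]) = u ≫ S.d₁ ≫ S.ident := by
  refine hom_ext_of_local fun O _ z => ?_
  have hG := S.isGaloisExtended
  rw [S.comp_mul]
  obtain ⟨t, x, e, hx⟩ := S.exists_pt (z ≫ u)
  have h0 := comp_specGal_inv_inv t e
  have h1 : z ≫ u ≫ S.inv = S.pt (hG.actOn e⁻¹ h0 x⁻¹).left e⁻¹ := by
    rw [← S.pt_inv x e h0, hx, Category.assoc]
  rw [S.mul_congr h1 hx.symm, S.mul_pt _ _ _ _ h0, ← map_mul, inv_mul_cancel, inv_mul_cancel,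
    map_one, ← S.comp_ident, ← S.pt_left_d₁ x e, hx]
  simp only [Category.assoc]

/-- The groupoid defined by a Galois extended group with a section. -/
def groupoid : GroupoidOver k K where
  toCompGraph := S.graph
  assoc u v w h h' := S.mul_assoc' u v w h h'
  ident := S.ident
  ident_d₀ := S.ident_d₀
  ident_d₁ := S.ident_d₁
  ident_mul u := S.ident_mul u
  mul_ident u := S.mul_ident u
  inv := S.inv
  inv_d₀ := S.inv_d₀
  inv_d₁ := S.inv_d₁
  mul_inv u := S.mul_inv u
  inv_mul u := S.inv_mul u

end Sectioned

end ExtData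

/-! ### Comparison of a Galois extended group with that of its groupoid -/

namespace ExtData

namespace Sectioned

variable {k K : Type u} [Field k] [Field K] [Algebra k K] {G : ExtData k K} {T T' : Scheme.{u}}
variable (S : Sectioned G)

/-- The unit is a section of the structural morphism. -/
lemma surjective_hom (D : Grp (Over (SpecF K))) : Surjective D.X.hom := by
  constructor
  intro y
  refine ⟨(1 : Points D).left y, ?_⟩
  have h : (1 : Points D).left ≫ D.X.hom = 𝟙 _ := Over.w (1 : 𝟙_ (Over (SpecF K)) ⟶ D.X)
  rw [← Scheme.Hom.comp_apply, h]
  rfl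

/-- As a scheme over `Spec K ×ₖ Spec K`, the scheme of arrows is the base change of `D`; hence `(d₀,
d₁)` inherits affineness, flatness and surjectivity from `D` over `Spec K`. -/
lemma isPullback : IsPullback (pullback.lift S.d₀ S.d₁ S.d_over) S.fst
    (pullback.fst (structureMap k K) (structureMap k K)) G.D.X.hom := by
  refine IsPullback.of_right (h₁₂ := pullback.snd (structureMap k K) (structureMap k K))
    (v₁₃ := structureMap k K) (h₂₂ := structureMap k K) ?_ ?_ (IsPullback.of_hasPullback _ _).flip
  · rw [pullback.lift_snd]
    exact (IsPullback.of_hasPullback _ _).flip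
  · rw [pullback.lift_fst]
    rfl

lemma pt_one_fst (x : T ⟶ G.D.X.left) : S.pt x 1 ≫ S.fst = x := by
  refine (S.pt_fst (toOver x) 1).trans ?_
  rw [S.cc_one, map_one, mul_one]
  rfl

lemma pt_one_d₁ (x : T ⟶ G.D.X.left) : S.pt x 1 ≫ S.d₁ = x ≫ G.D.X.hom := by
  rw [S.pt_d₁, map_one, specGal_one, Category.comp_id]

variable [IsAlgClosure k K] [PerfectField k]

lemma isTransitiveAffine : GroupoidOver.IsTransitiveAffine S.groupoid := by
  have := S.isGaloisExtended.affine
  have := surjective_hom G.D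
  have h := S.isPullback.flip
  have h1 : IsAffineHom G.D.X.hom := inferInstance
  have h2 : Flat G.D.X.hom := inferInstance
  exact ⟨MorphismProperty.of_isPullback h h1, MorphismProperty.of_isPullback h h2,
    MorphismProperty.of_isPullback (P := @Surjective) h this⟩

instance : IsAffine S.groupoid.arr := inferInstanceAs (IsAffine S.arr)

/-- The point of the groupoid defined by an element of the extension. -/
def toKPoints (e : G.E) : S.groupoid.KPoints :=
  ⟨S.pt (1 : Over.mk (𝟙 (SpecF K)) ⟶ G.D.X).left e, S.pt_left_d₀ _ _⟩

lemma toKPoints_val (e : G.E) :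
    (S.toKPoints e).val = S.pt (1 : Over.mk (𝟙 (SpecF K)) ⟶ G.D.X).left e := rfl

lemma comp_toKPoints_val (t : T ⟶ SpecF K) (e : G.E) :
    t ≫ (S.toKPoints e).val = S.pt (1 : Over.mk t ⟶ G.D.X).left e := by
  refine (S.comp_pt _ _ _).trans ?_
  rw [← preHom_left t (Category.comp_id t), map_one]

lemma gal_toKPoints (e : G.E) : GroupoidOver.gal (S.toKPoints e) = G.proj e := by
  apply specGal_injective
  rw [GroupoidOver.specGal_gal]
  refine (S.pt_left_d₁ _ _).trans (Category.id_comp _)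

lemma toKPoints_mul (e e' : G.E) : S.toKPoints (e * e') = S.toKPoints e * S.toKPoints e' := by
  apply GroupoidOver.KPoints.ext
  rw [GroupoidOver.KPoints.mul_val]
  have h1 : specGal (G.proj e) ≫ specGal (G.proj e)⁻¹ = 𝟙 _ := specGal_comp_inv _
  have h2 : specGal (GroupoidOver.gal (S.toKPoints e)) ≫ (S.toKPoints e').val =
      S.pt (1 : Over.mk (specGal (G.proj e)) ⟶ G.D.X).left e' := by
    rw [gal_toKPoints, comp_toKPoints_val]
  refine Eq.trans ?_ (GroupoidOver.mul_congr (F := S.groupoid) rfl h2).symm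
  refine Eq.trans ?_ (S.mul_pt (1 : Over.mk (𝟙 (SpecF K)) ⟶ G.D.X) _ e e' h1 ?_).symm
  · rw [map_one, mul_one]
    rfl
  · rw [S.pt_left_d₁, S.pt_left_d₀, Category.id_comp]

/-- The two coordinates of the point in `D ×ₖ Spec K` are `cc e` and `Spec` of the projection of
`e`, both continuous in `e`. -/
lemma continuous_toKPoints : Continuous S.toKPoints := by
  have := S.isGaloisExtended.affine
  have : Algebra.IsAlgebraic k K := IsAlgClosure.isAlgebraic
  rw [GroupoidOver.continuous_kPoints_iff]
  refine LocConst.of_pullback (p := G.D.X.hom ≫ structureMap k K) (q := structureMap k K)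
    (f := fun e => S.pt (1 : Over.mk (𝟙 (SpecF K)) ⟶ G.D.X).left e) ?_ ?_
  · have h1 : ∀ e, S.pt (1 : Over.mk (𝟙 (SpecF K)) ⟶ G.D.X).left e ≫ S.fst = (S.cc e).left := by
      intro e
      rw [S.pt_fst, one_mul, constPt_left, Category.id_comp]
    have h2 : LocConst fun e => (S.cc e).left := (continuous_points_iff _).mp S.continuous_cc
    simp only [← h1] at h2
    exact h2
  · have h1 : ∀ e, S.pt (1 : Over.mk (𝟙 (SpecF K)) ⟶ G.D.X).left e ≫ S.d₁ =
        specGal (G.proj e) := fun e => (S.pt_left_d₁ _ _).trans (Category.id_comp _)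
    have h2 : LocConst fun e => specGal (G.proj e) :=
      (locConst_specGal_iff _).mpr S.isGaloisExtended.continuous_proj
    simp only [← h1] at h2
    exact h2

/-- The point of `D` underlying a point of the groupoid. -/
def fstPoint (v : S.groupoid.KPoints) : Points G.D :=
  Over.homMk (U := 𝟙_ (Over (SpecF K))) (V := G.D.X) (v.val ≫ S.fst)
    ((Category.assoc _ _ _).trans v.val_d₀)

/-- The element of the extension defined by a point of the groupoid. -/
def ofKPoints (v : S.groupoid.KPoints) : G.E :=
  G.incl (S.fstPoint v) * S.s (GroupoidOver.gal v)

lemma continuous_ofKPoints : Continuous S.ofKPoints := by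
  have := S.isGaloisExtended.affine
  have := S.isGaloisExtended.topologicalGroup
  have h : Continuous S.fstPoint := by
    have h1 : LocConst fun v : S.groupoid.KPoints => v.val := GroupoidOver.locConst_val
    have h2 : LocConst fun v : S.groupoid.KPoints => (v.val : SpecF K ⟶ S.arr) ≫ S.fst :=
      h1.comp S.fst
    exact (continuous_points_iff _).mpr h2
  exact (S.isGaloisExtended.isEmbedding_incl.continuous.comp h).mul
    (S.continuous_s.comp GroupoidOver.continuous_gal)

lemma toKPoints_ofKPoints (v : S.groupoid.KPoints) : S.toKPoints (S.ofKPoints v) = v := by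
  apply GroupoidOver.KPoints.ext
  rw [toKPoints_val, ofKPoints]
  refine (S.pt_incl_mul _ _ _).trans ?_
  apply S.hom_ext
  · rw [S.pt_fst, S.cc_s, map_one, mul_one, one_mul, constPt_left, Category.id_comp]
    rfl
  · rw [S.pt_left_d₁, S.proj_s, GroupoidOver.specGal_gal, Category.id_comp]
    rfl

lemma ofKPoints_toKPoints (e : G.E) : S.ofKPoints (S.toKPoints e) = e := by
  have h : S.fstPoint (S.toKPoints e) = S.cc e := by
    apply Over.OverMorphism.ext
    change S.pt (1 : Over.mk (𝟙 (SpecF K)) ⟶ G.D.X).left e ≫ S.fst = (S.cc e).left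
    rw [S.pt_fst, one_mul, constPt_left, Category.id_comp]
  rw [ofKPoints, h, gal_toKPoints, S.incl_cc_mul_s]

/-- The morphism from `D` to the diagonal of the groupoid. -/
def toDiag : G.D.X ⟶ S.groupoid.diag :=
  Over.homMk (GroupoidOver.diagLift (F := S.groupoid) (S.pt (𝟙 G.D.X.left) 1) G.D.X.hom
      ((S.pt_d₀ _ _).trans (Category.id_comp _)) ((S.pt_one_d₁ _).trans (Category.id_comp _)))
    (GroupoidOver.diagLift_hom _ _ _ _)

lemma toDiag_left : S.toDiag.left ≫ S.groupoid.diagι = S.pt (𝟙 G.D.X.left) 1 :=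
  GroupoidOver.diagLift_ι (F := S.groupoid) (S.pt (𝟙 G.D.X.left) 1) G.D.X.hom
    ((S.pt_d₀ _ _).trans (Category.id_comp _)) ((S.pt_one_d₁ _).trans (Category.id_comp _))

/-- The morphism from the diagonal of the groupoid to `D`. -/
def ofDiag : S.groupoid.diag ⟶ G.D.X :=
  Over.homMk (S.groupoid.diagι ≫ S.fst) ((Category.assoc _ _ _).trans S.groupoid.diagι_d₀)

lemma toDiag_ofDiag : S.toDiag ≫ S.ofDiag = 𝟙 _ := by
  apply Over.OverMorphism.ext
  refine (Category.assoc _ _ _).symm.trans ?_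
  exact (congrArg (· ≫ S.fst) S.toDiag_left).trans (S.pt_one_fst _)

lemma ofDiag_toDiag : S.ofDiag ≫ S.toDiag = 𝟙 _ := by
  apply Over.OverMorphism.ext
  apply GroupoidOver.diag_hom_ext
  refine (Category.assoc _ _ _).trans ((congrArg (S.ofDiag.left ≫ ·) S.toDiag_left).trans ?_)
  refine (S.comp_pt _ _ _).trans ?_
  refine Eq.trans ?_ (Category.id_comp _).symm
  apply S.hom_ext
  · rw [S.pt_one_fst]
    exact Category.comp_id _
  · rw [S.pt_one_d₁, Category.comp_id]
    exact (Over.w S.ofDiag).trans S.groupoid.diagι_d₁.symm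

lemma comp_toDiag {t : T ⟶ SpecF K} (x : Over.mk t ⟶ G.D.X) :
    (x ≫ S.toDiag).left ≫ S.groupoid.diagι = S.pt x.left 1 := by
  refine (Category.assoc _ _ _).trans ((congrArg (x.left ≫ ·) S.toDiag_left).trans ?_)
  refine (S.comp_pt _ _ _).trans ?_
  rw [Category.comp_id]

lemma mul_toDiag {X : Over (SpecF K)} (x y : X ⟶ G.D.X) :
    (x * y) ≫ S.toDiag = (x ≫ S.toDiag) * (y ≫ S.toDiag) := by
  apply Over.OverMorphism.ext
  apply GroupoidOver.diag_hom_ext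
  refine Eq.trans ?_ (S.groupoid.diag_mul_left _ _).symm
  refine (S.comp_toDiag (t := X.hom) (x * y)).trans ?_
  refine Eq.trans ?_ (GroupoidOver.mul_congr (F := S.groupoid) (S.comp_toDiag (t := X.hom) x)
    (S.comp_toDiag (t := X.hom) y)).symm
  have h : X.hom ≫ specGal (G.proj 1)⁻¹ = X.hom := by
    rw [map_one, inv_one, specGal_one, Category.comp_id]
  refine Eq.trans ?_ (S.mul_pt (t := X.hom) (t' := X.hom) x y 1 1 h ?_).symm
  · rw [S.isGaloisExtended.actOn_one, mul_one]
  · rw [S.pt_left_d₁ (t := X.hom) x, S.pt_left_d₀ (t := X.hom) y, map_one, specGal_one,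
      Category.comp_id]

end Sectioned

end ExtData

section GrpHom

variable {K : Type u} [Field K] {D D' : Grp (Over (SpecF K))}

/-- The homomorphism of group schemes defined by a morphism compatible with the products of
points. -/
def grpHomOfMul (f : D.X ⟶ D'.X)
    (hf : ∀ {X : Over (SpecF K)} (x y : X ⟶ D.X), (x * y) ≫ f = (x ≫ f) * (y ≫ f)) : D ⟶ D' :=
  Grp.homMk'' f
    (by
      have h := hf (η[D.X]) (η[D.X])
      have h1 : (η[D.X] : 𝟙_ (Over (SpecF K)) ⟶ D.X) = 1 := MonObj.one_eq_one _
      have h2 : (η[D'.X] : 𝟙_ (Over (SpecF K)) ⟶ D'.X) = 1 := MonObj.one_eq_one _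
      change η[D.X] ≫ f = η[D'.X]
      rw [h1, mul_one] at h
      rw [h1, h2]
      exact left_eq_mul.mp h)
    (by
      have h := hf (CartesianMonoidalCategory.fst D.X D.X) (CartesianMonoidalCategory.snd D.X D.X)
      change μ[D.X] ≫ f = (f ⊗ₘ f) ≫ μ[D'.X]
      rw [Hom.mul_def, Hom.mul_def, CartesianMonoidalCategory.lift_fst_snd, Category.id_comp] at h
      rw [h]
      congr 1)

lemma mul_comp_of_inverse {f : D.X ⟶ D'.X} {g : D'.X ⟶ D.X} (hfg : f ≫ g = 𝟙 _) (hgf : g ≫ f = 𝟙 _)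
    (hf : ∀ {X : Over (SpecF K)} (x y : X ⟶ D.X), (x * y) ≫ f = (x ≫ f) * (y ≫ f))
    {X : Over (SpecF K)} (x y : X ⟶ D'.X) : (x * y) ≫ g = (x ≫ g) * (y ≫ g) := by
  have h := congrArg (· ≫ g) (hf (x ≫ g) (y ≫ g))
  simp only [Category.assoc, hfg, hgf, Category.comp_id] at h
  exact h.symm

end GrpHom

namespace ExtData

variable {k K : Type u} [Field k] [Field K] [Algebra k K] {G G' : ExtData k K}

/-- A morphism with invertible components is invertible. -/
def Hom.iso (f : Hom G G') (g : G'.D ⟶ G.D) (hfg : f.h ≫ g = 𝟙 _) (hgf : g ≫ f.h = 𝟙 _)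
    (m : G'.E → G.E) (hm : Continuous m) (hml : ∀ e, m (f.l e) = e) (hlm : ∀ e, f.l (m e) = e) :
    G ≅ G' where
  hom := f
  inv :=
    { h := g
      l := { MonoidHom.mk' m (fun e e' => by
          rw [← hml (m e * m e'), map_mul, hlm, hlm]) with continuous_toFun := hm }
      l_incl := fun d => by
        change m (G'.incl d) = _
        have h : Points.map f.h (Points.map g d) = d :=
          (Category.assoc _ _ _).trans ((congrArg (fun z : G'.D ⟶ G'.D =>
            (d : 𝟙_ (Over (SpecF K)) ⟶ G'.D.X) ≫ z.hom.hom) hgf).trans (Category.comp_id _))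
        rw [← hml (G.incl (Points.map g d)), f.l_incl, h]
      proj_l := fun e => by
        change G.proj (m e) = _
        rw [← f.proj_l, hlm]
      act_h := fun e => by
        change (G'.act e).hom ≫ g.hom.hom.left = g.hom.hom.left ≫ (G.act (m e)).hom
        have h1 : g.hom.hom.left ≫ f.h.hom.hom.left = 𝟙 _ :=
          congrArg (fun z : G'.D ⟶ G'.D => z.hom.hom.left) hgf
        have h2 : f.h.hom.hom.left ≫ g.hom.hom.left = 𝟙 _ :=
          congrArg (fun z : G.D ⟶ G.D => z.hom.hom.left) hfg
        have h3 := congrArg (fun z => g.hom.hom.left ≫ z ≫ g.hom.hom.left) (f.act_h (m e))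
        simp only [Category.assoc, h2, Category.comp_id, hlm] at h3
        rw [h3, ← Category.assoc, h1, Category.id_comp] }
  hom_inv_id := Hom.ext hfg (ContinuousMonoidHom.ext hml)
  inv_hom_id := Hom.ext hgf (ContinuousMonoidHom.ext hlm)

namespace Sectioned

variable (S : Sectioned G) [IsAlgClosure k K] [PerfectField k]

lemma toKPoints_incl (d : Points G.D) : S.toKPoints (G.incl d) =
    S.groupoid.diagPoints (Points.map (grpHomOfMul (D' := S.groupoid.diagGrp) S.toDiag S.mul_toDiag) d) := by
  apply GroupoidOver.KPoints.ext
  rw [toKPoints_val, GroupoidOver.diagPoints_val]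
  refine Eq.trans ?_ (S.comp_toDiag (t := 𝟙 (SpecF K)) d).symm
  have h := S.pt_incl_mul (1 : Over.mk (𝟙 (SpecF K)) ⟶ G.D.X) d 1
  rw [mul_one, one_mul] at h
  refine h.trans ?_
  rw [constPt_left, Category.id_comp]
  rfl

/-- In the groupoid, `e(x) ∘ e = e ∘ x` by the product formula `mul_pt`, so conjugation by the point
of `e` is the given action; `x` is the universal point of `D`. -/
lemma act_toDiag (e : G.E) : (G.act e).hom ≫ S.toDiag.left =
    S.toDiag.left ≫ GroupoidOver.actHom (S.toKPoints e) := by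
  have hG := S.isGaloisExtended
  apply GroupoidOver.diag_hom_ext
  have hg := S.gal_toKPoints e
  let t : G.D.X.left ⟶ SpecF K := G.D.X.hom
  let t' : G.D.X.left ⟶ SpecF K := t ≫ specGal (G.proj e)⁻¹
  have ht : t' ≫ specGal (G.proj e) = t := by
    rw [Category.assoc, specGal_inv_comp, Category.comp_id]
  have ht' : t' ≫ specGal (GroupoidOver.gal (S.toKPoints e)) = t := by rw [hg, ht]
  let x : Over.mk t ⟶ G.D.X := 𝟙 G.D.X
  let y : Over.mk t' ⟶ G.D.X := hG.actOn e rfl x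
  have hy : y.left = (G.act e).hom := Category.id_comp _
  let X : Over.mk t ⟶ S.groupoid.diag := x ≫ S.toDiag
  let Y : Over.mk t' ⟶ S.groupoid.diag := y ≫ S.toDiag
  have hX : X.left = S.toDiag.left := Category.id_comp _
  have hY : Y.left = (G.act e).hom ≫ S.toDiag.left := congrArg (· ≫ S.toDiag.left) hy
  have h1 := GroupoidOver.diagHom_actHom (S.toKPoints e) ht' X
  have key : GroupoidOver.diagHom Y ≫ GroupoidOver.kHom (S.toKPoints e) ht' =
      GroupoidOver.kHom (S.toKPoints e) ht' ≫ GroupoidOver.diagHom X := by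
    apply GroupoidOver.PtHom.ext
    rw [GroupoidOver.ptHom_comp_val, GroupoidOver.ptHom_comp_val]
    have hk : (GroupoidOver.kHom (S.toKPoints e) ht').val =
        S.pt (1 : Over.mk t' ⟶ G.D.X).left e := S.comp_toKPoints_val t' e
    have hXv : (GroupoidOver.diagHom X).val = S.pt x.left 1 := S.comp_toDiag x
    have hYv : (GroupoidOver.diagHom Y).val = S.pt y.left 1 := S.comp_toDiag y
    have h2 : t' ≫ specGal (G.proj 1)⁻¹ = t' := by
      rw [map_one, inv_one, specGal_one, Category.comp_id]
    have hl := S.mul_pt y (1 : Over.mk t' ⟶ G.D.X) 1 e h2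
      (by rw [S.pt_left_d₁, S.pt_left_d₀, map_one, specGal_one, Category.comp_id])
    have hr := S.mul_pt (1 : Over.mk t' ⟶ G.D.X) x e 1 rfl
      (by rw [S.pt_left_d₁, S.pt_left_d₀, ht])
    refine (GroupoidOver.mul_congr (F := S.groupoid) hYv hk).trans ?_
    refine Eq.trans ?_ (GroupoidOver.mul_congr (F := S.groupoid) hk hXv).symm
    refine hl.trans (Eq.trans ?_ hr.symm)
    rw [map_one, mul_one, one_mul, one_mul, mul_one]
  rw [← Category.assoc (GroupoidOver.kHom _ _), ← key, Category.assoc, IsIso.hom_inv_id,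
    Category.comp_id, GroupoidOver.diagHom_val, hX, hY] at h1
  exact h1.symm.trans (Category.assoc _ _ _).symm

/-- The morphism from a Galois extended group to the one defined by the associated groupoid. -/
def toExtData : Hom G S.groupoid.extData where
  h := grpHomOfMul (D' := S.groupoid.diagGrp) S.toDiag S.mul_toDiag
  l := { MonoidHom.mk' S.toKPoints S.toKPoints_mul with
    continuous_toFun := S.continuous_toKPoints }
  l_incl d := S.toKPoints_incl d
  proj_l e := S.gal_toKPoints e
  act_h e := S.act_toDiag e

/-- A Galois extended group is isomorphic to the one defined by the associated groupoid. -/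
def isoExtData : G ≅ S.groupoid.extData :=
  Hom.iso S.toExtData
    (grpHomOfMul (D := S.groupoid.diagGrp) S.ofDiag
      (mul_comp_of_inverse (D' := S.groupoid.diagGrp) S.toDiag_ofDiag S.ofDiag_toDiag S.mul_toDiag))
    (Grp.hom_ext _ _ S.toDiag_ofDiag) (Grp.hom_ext _ _ S.ofDiag_toDiag)
    S.ofKPoints S.continuous_ofKPoints S.ofKPoints_toKPoints S.toKPoints_ofKPoints

end Sectioned

end ExtData

/-! ### The equivalence of categories -/

section Main

variable (k K : Type u) [Field k] [PerfectField k] [Field K] [Algebra k K] [IsAlgClosure k K]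

lemma galoisExtended_extFunctor (F : TransitiveAffineGroupoid k K) :
    galoisExtended k K ((extFunctor k K).obj F.obj) := by
  have := F.property.isAffine
  exact GroupoidOver.IsTransitiveAffine.isGaloisExtended F.property

/-- The functor from transitive affine groupoids to Galois extended groups. -/
abbrev galoisFunctor : TransitiveAffineGroupoid k K ⥤ GaloisExtendedGroup k K :=
  (galoisExtended k K).lift (GroupoidOver.IsTransitiveAffine.ι ⋙ extFunctor k K)
    (galoisExtended_extFunctor k K)

instance : (galoisFunctor k K).Faithful where
  map_injective {F F'} f g h := by
    have := F'.property.isAffine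
    have h1 : GroupoidOver.extMap f.hom = GroupoidOver.extMap g.hom :=
      congrArg (fun z => z.hom) h
    apply ObjectProperty.hom_ext
    refine GroupoidOver.Hom.faithful_of_transitiveAffine F.property ?_ fun e => ?_
    · exact congrArg (fun z : ExtData.Hom _ _ => z.h.hom.hom) h1
    · exact congrArg (fun z : ExtData.Hom _ _ => z.l e) h1

instance : (galoisFunctor k K).Full where
  map_surjective {F F'} f := by
    have := F.property.isAffine
    have := F'.property.isAffine
    let f' : ExtData.Hom F.obj.extData F'.obj.extData := f.hom
    have hc : GroupoidOver.IsCompatible (F := F.obj) (F' := F'.obj) f'.h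
        f'.l.toMonoidHom :=
      ⟨f'.l.continuous_toFun, f'.l_incl, f'.proj_l, f'.act_h⟩
    obtain ⟨g, hg, hg'⟩ := hc.exists_hom F.property
    refine ⟨ObjectProperty.homMk g, ?_⟩
    apply ObjectProperty.hom_ext
    exact ExtData.Hom.ext (Grp.hom_ext _ _ hg) (ContinuousMonoidHom.ext hg')

instance : (galoisFunctor k K).EssSurj where
  mem_essImage G := by
    obtain ⟨s, hs, hs', hs1⟩ := ExtData.IsGaloisExtended.exists_section G.property
    let S : ExtData.Sectioned G.obj := ⟨G.property, s, hs, hs', hs1⟩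
    exact ⟨⟨S.groupoid, S.isTransitiveAffine⟩,
      ⟨(galoisExtended k K).isoMk S.isoExtData.symm⟩⟩

end Main

end GalGrpd

end

theorem propositionp (k K : Type u) [Field k] [PerfectField k] [Field K] [Algebra k K]
    [IsAlgClosure k K] :
    ∃ h : ∀ F : GalGrpd.TransitiveAffineGroupoid k K,
        GalGrpd.galoisExtended k K ((GalGrpd.extFunctor k K).obj F.obj),
      ((GalGrpd.galoisExtended k K).lift
        (GalGrpd.GroupoidOver.IsTransitiveAffine.ι ⋙ GalGrpd.extFunctor k K) h).IsEquivalence := by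
  exact ⟨GalGrpd.galoisExtended_extFunctor k K, ⟨inferInstance, inferInstance, inferInstance⟩⟩
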